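/- **Setting.** There are $n\ge 1$ nodes, each holding a variable in $\mathbb R^p$ ($p\ge1$); write $x=(x_1,\dots,x_n)\in(\mathbb R^p)^n$ for the stacked variable, with the Euclidean norm, $d=np$ for its dimension, $\mathcal L=\{x_1=\dots=x_n\}$, $\mathcal L^\perp=\{\sum_i x_i=0\}$. Let $F(x,\xi)=\sum_i f_i(x_i,\xi)$ and $F(x)=\mathbb E_\xi F(x,\xi)$, where every $f_i(\cdot)=\mathbb E_\xi f_i(\cdot,\xi)$ is $\mu$-strongly convex, $\mu>0$ (no smoothness is assumed). Let $\varepsilon,M_2>0$ and $\gamma=\varepsilon/(2M_2)$, and let $Q$ be a convex set such that $|F(y,\xi)-F(x,\xi)|\le M_2(\xi)\|y-x\|$ for all $x,y$ in $Q+\gamma\bar B$ ($\bar B$ the closed unit ball), with $\mathbb E M_2(\xi)^2\le M_2^2$. The gradient-free oracle returns $F_\delta(x,\xi)=F(x,\xi)+\delta(x,\xi)$ with $|\delta|\le\widetilde\Delta$. In round $q=0,1,\dots$ the nodes communicate over an undirected graph $\mathcal G^q$ through a symmetric positive semidefinite matrix $W(q)$ with $W(q)_{ij}=0$ if $i\ne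 j$ are not adjacent in $\mathcal G^q$, $\ker W(q)=\mathrm{span}(1,\dots,1)$, and $\|W(q)v-v\|^2\le(1-\chi^{-1})\|v\|^2$ if $\sum_i v_i=0$, where $\chi\ge1$. **Algorithm.** Let $F_\gamma(x)=\mathbb E F(x+\gamma u)$, $u$ uniform on the unit ball of $(\mathbb R^p)^n$, and $L=\sqrt d M_2/\gamma$. ZO-SADOM starts from $x_f^0=x^0$, $y_f^0=y^0$, $z_f^0=z^0\in\mathcal L^\perp$, $m^0$, and iterates, with $\mathbf W(k)$ acting as $\mathbf W(k)\otimes I_p$, $$\begin{aligned} &x_g^k=\tau_1x^k+(1-\tau_1)x_f^k,\quad x^{k+1}=x^k+\eta\alpha(x_g^k-x^{k+1})-\eta[g^k-\nu x_g^k-y^{k+1}],\quad x_f^{k+1}=x_g^k+\tau_2(x^{k+1}-x^k),\\ &y_g^k=\vartheta_1y^k+(1-\vartheta_1)y_f^k,\quad y^{k+1}=y^k+\theta\beta(g^k-\nu x_g^k-y^{k+1})-\theta[\nu^{-1}(y_g^k+z_g^k)+x^{k+1}],\quad y_f^{k+1}=y_g^k+\vartheta_2(y^{k+1}-y^k),\\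 &z_g^k=\vartheta_1z^k+(1-\vartheta_1)z_f^k,\quad z^{k+1}=z^k+\varkappa\pi(z_g^k-z^k)-\mathbf W(k)[\varkappa\nu^{-1}(y_g^k+z_g^k)+m^k],\\ &m^{k+1}=(I-\mathbf W(k))[\varkappa\nu^{-1}(y_g^k+z_g^k)+m^k],\quad z_f^{k+1}=z_g^k-\zeta\mathbf W(k)(y_g^k+z_g^k), \end{aligned}$$ where $g^k$ is the average of $B$ two-point estimators $\frac{d}{2\gamma}\big(F_\delta(x_g^k+\gamma e,\xi)-F_\delta(x_g^k-\gamma e,\xi)\big)e$ over independent samples $(\xi,e)$, $e$ uniform on the unit sphere of $(\mathbb R^p)^n$ and independent of $\xi$. In the basic version $\mathbf W(k)=W(k)$ and $\chi_1=\chi$; in the version with multi-gossip of length $T$, $\mathbf W(k)=I-\prod_{q=kT}^{kT+T-1}(I-W(q))$ (later rounds to the left) and $\chi_1=2$. The parameters are $\tau_2=\sqrt{\beta\mu}$, $\tau_1=(1/\tau_2+1/2)^{-1}$, $\eta=((1/\beta+L)\tau_2)^{-1}$, $\alpha=\mu/4$, $\nu=\mu/2$, $\vartheta_2=\sqrt{\beta\mu}/(16\chi_1)$,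 $\vartheta_1=(1/\vartheta_2+1/2)^{-1}$, $\theta=\nu/(4\vartheta_2)$, $\varkappa=\nu/(14\vartheta_2\chi_1^2)$, $\pi=\beta/16$, $\zeta=1/2$, where $\beta\in(0,1/(2L)]$ can be tuned. **Accuracy.** Let $x^*$ and $x_\gamma^*$ minimize $F$ and $F_\gamma$ over $\mathcal L$, and $h=\nabla F_\gamma(x^*_\gamma)$. We say that $N$ iterations solve the problem to accuracy $\varepsilon$ if $$\begin{aligned} &\mathbb E\Big[\tfrac\mu2\|x^N-x_\gamma^*\|^2+F_\gamma(x_f^N)-F_\gamma(x_\gamma^*)-\langle h,x_f^N-x_\gamma^*\rangle-\tfrac\mu4\|x_f^N-x_\gamma^*\|^2\Big]\le\tfrac\varepsilon2,\\ &\mathbb E\Big[\tfrac\mu2\|x^N-x^*\|^2+F(x_f^N)-F(x^*)-\langle h,x_f^N-x^*\rangle-\tfrac\mu4\|x_f^N-x^*\|^2\Big]\le\varepsilon,\qquad \mathbb E\,\tfrac\mu2\|x^N-x^*\|^2\le\varepsilon \end{aligned}$$ (all these expectations being finite) whenever $x^*,x_\gamma^*\in Q$, almost surely $x^k,x_f^k\in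 Q$ for $k\le N$, and $\mu^2\|x^0-x_\gamma^*\|^2+\|y^0-h+\nu x_\gamma^*\|^2+\|z^0+h\|^2+\|m^0\|^2\le R^2$. (For $Q=(\mathbb R^p)^n$ the conditions involving $Q$ say that $F(\cdot,\xi)$ is globally $M_2(\xi)$-Lipschitz.) Put $\Lambda=\log\big(2+\chi+\frac{M_2^2}{\varepsilon\mu}+\frac{R^2}{M_2^2}\big)$. **Statement.** There are universal constants $C,c>0$ such that for all $n,p\ge1$, $\mu,M_2,\varepsilon>0$, $\chi\ge1$, $R\ge0$: 1. For every $B\ge1$ there is $\beta\in(0,1/(2L)]$ such that the basic version with batch size $B$ solves every such problem to accuracy $\varepsilon$ in $N$ iterations whenever $N\ge1$, $$N\ge C\max\Big\{\frac{d^{1/4}M_2\chi}{\sqrt{\varepsilon\mu}},\frac{\chi^2dM_2^2}{\varepsilon B\mu}\Big\}\Lambda,\qquad \widetilde\Delta^2\le c\min\Big\{\frac{\varepsilon^{5/2}\mu^{1/2}}{d^{7/4}M_2N},\frac{B\mu N\varepsilon^3}{\chi^2M_2^2d}\Big\}.$$ 2. Suppose $\mu\le L$ (as is automatic when $Q$ has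 more than one point). With $B=\lceil d^{3/4}M_2/\sqrt{\varepsilon\mu}\rceil$ and multi-gossip of length $T=\lceil\chi\ln2\rceil$, there are $N\ge1$ and $\beta\in(0,1/(2L)]$ such that $N$ iterations solve every such problem to accuracy $\varepsilon$ if $\widetilde\Delta^2\le c\min\big\{\frac{\varepsilon^{5/2}\mu^{1/2}}{d^{7/4}M_2N},\frac{B\mu N\varepsilon^3}{4M_2^2d}\big\}$, and use $$N_{\rm oracle}=2NB\le C\,\frac{dM_2^2}{\varepsilon\mu}\,\Lambda\ \text{ oracle calls and }\ N_{\rm comm}=NT\le C\,\frac{d^{1/4}M_2\chi}{\sqrt{\varepsilon\mu}}\,\Lambda\ \text{ communication rounds.}$$ -/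

import Mathlib

open MeasureTheory ProbabilityTheory
open scoped Pointwise RealInnerProductSpace

universe u v

noncomputable section

namespace ZOSADOM

/-! ### The network and the stacked variable -/

/-- The space `ℝ^p` in which every node keeps its local variable. -/
abbrev Node (p : ℕ) : Type := EuclideanSpace ℝ (Fin p)

/-- The space `(ℝ^p)^V` of stacked variables `x = (x_1, …, x_n)`, with the Euclidean norm.
Its dimension is `n * p`. -/
abbrev Stacked (n p : ℕ) : Type := PiLp 2 (fun _ : Fin n => Node p)

/-- The consensus space `x_1 = … = x_n`. -/
def consensus (n p : ℕ) : Set (Stacked n p) := {x | ∀ i j, x i = x j}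

/-- The orthogonal complement of the consensus space, `∑ i, z_i = 0`. -/
def consensusPerp (n p : ℕ) : Set (Stacked n p) := {z | ∑ i, z i = 0}

/-- The action of `W ⊗ I_p` on stacked variables. -/
def gossipApply {n p : ℕ} (W : Matrix (Fin n) (Fin n) ℝ) (x : Stacked n p) : Stacked n p :=
  WithLp.toLp 2 (fun i => ∑ j, W i j • x j)

/-- `W q` is a gossip matrix of the (undirected) communication graph `G q` of round `q`, for every
round, with the common contraction factor `1 - 1/χ` on vectors of zero sum. -/
structure IsGossipSequence {n : ℕ} (G : ℕ → SimpleGraph (Fin n))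
    (W : ℕ → Matrix (Fin n) (Fin n) ℝ) (χ : ℝ) : Prop where
  posSemidef : ∀ q, (W q).PosSemidef
  support : ∀ q i j, i ≠ j → ¬ (G q).Adj i j → W q i j = 0
  ker : ∀ q (v : Fin n → ℝ), (W q).mulVec v = 0 ↔ ∀ i j, v i = v j
  contraction : ∀ q (v : Fin n → ℝ), ∑ i, v i = 0 →
    ∑ i, ((W q).mulVec v i - v i) ^ 2 ≤ (1 - χ⁻¹) * ∑ i, v i ^ 2

/-- The product `(I - W (q₀ + T - 1)) ⋯ (I - W q₀)` of `T` consecutive rounds. -/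
def gossipProd {n : ℕ} (W : ℕ → Matrix (Fin n) (Fin n) ℝ) (q₀ : ℕ) :
    ℕ → Matrix (Fin n) (Fin n) ℝ
  | 0 => 1
  | T + 1 => (1 - W (q₀ + T)) * gossipProd W q₀ T

/-- Multi-gossip: iteration `k` uses the `T` rounds `k T, …, k T + T - 1`, which act together as
the matrix `I - ∏ (I - W q)`. For `T = 1` this is the sequence `W` itself. -/
def multiGossip {n : ℕ} (W : ℕ → Matrix (Fin n) (Fin n) ℝ) (T k : ℕ) :
    Matrix (Fin n) (Fin n) ℝ :=
  1 - gossipProd W (k * T) T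

theorem multiGossip_one {n : ℕ} (W : ℕ → Matrix (Fin n) (Fin n) ℝ) : multiGossip W 1 = W := by
  funext k
  simp [multiGossip, gossipProd]

/-! ### The algorithm SADOM -/

/-- The parameters of SADOM. -/
structure Params where
  (τ₁ τ₂ η α ν θ β ϑ₁ ϑ₂ ϰ π ζ : ℝ)

/-- The choice of all parameters in terms of the strong convexity constant `μ`, the smoothness
constant `L`, the network constant `χ` and the tunable `β`. -/
def params (μ L χ β : ℝ) : Params where
  τ₁ := (1 / √(β * μ) + 1 / 2)⁻¹
  τ₂ := √(β * μ)
  η := ((1 / β + L) * √(β * μ))⁻¹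
  α := μ / 4
  ν := μ / 2
  θ := (μ / 2) / (4 * (√(β * μ) / (16 * χ)))
  β := β
  ϑ₁ := (1 / (√(β * μ) / (16 * χ)) + 1 / 2)⁻¹
  ϑ₂ := √(β * μ) / (16 * χ)
  ϰ := (μ / 2) / (14 * (√(β * μ) / (16 * χ)) * χ ^ 2)
  π := β / 16
  ζ := 1 / 2

/-- The variables which SADOM carries from one iteration to the next. -/
structure State (n p : ℕ) where
  (x xf y yf z zf m : Stacked n p)

namespace State

variable {n p : ℕ}

/-- `x_g = τ₁ x + (1 - τ₁) x_f` -/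
def xg (s : State n p) (a : Params) : Stacked n p := a.τ₁ • s.x + (1 - a.τ₁) • s.xf

/-- `y_g = ϑ₁ y + (1 - ϑ₁) y_f` -/
def yg (s : State n p) (a : Params) : Stacked n p := a.ϑ₁ • s.y + (1 - a.ϑ₁) • s.yf

/-- `z_g = ϑ₁ z + (1 - ϑ₁) z_f` -/
def zg (s : State n p) (a : Params) : Stacked n p := a.ϑ₁ • s.z + (1 - a.ϑ₁) • s.zf

end State

/-- `t` is obtained from `s` by one iteration of SADOM with gossip matrix `W`, where `g` is the
stochastic gradient computed at `x_g`. The lines for `x` and `y` are implicit. -/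
structure IsStep {n p : ℕ} (a : Params) (W : Matrix (Fin n) (Fin n) ℝ) (g : Stacked n p)
    (s t : State n p) : Prop where
  x : t.x = s.x + (a.η * a.α) • (s.xg a - t.x) - a.η • (g - a.ν • s.xg a - t.y)
  xf : t.xf = s.xg a + a.τ₂ • (t.x - s.x)
  y : t.y = s.y + (a.θ * a.β) • (g - a.ν • s.xg a - t.y)
        - a.θ • (a.ν⁻¹ • (s.yg a + s.zg a) + t.x)
  yf : t.yf = s.yg a + a.ϑ₂ • (t.y - s.y)
  z : t.z = s.z + (a.ϰ * a.π) • (s.zg a - s.z)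
        - gossipApply W ((a.ϰ * a.ν⁻¹) • (s.yg a + s.zg a) + s.m)
  m : t.m = (a.ϰ * a.ν⁻¹) • (s.yg a + s.zg a) + s.m
        - gossipApply W ((a.ϰ * a.ν⁻¹) • (s.yg a + s.zg a) + s.m)
  zf : t.zf = s.zg a - a.ζ • gossipApply W (s.yg a + s.zg a)

/-- `s 0, s 1, …` is a run of SADOM from `(x⁰, y⁰, z⁰, m⁰)`, where `W k` is the gossip matrix and
`g k` the stochastic gradient oracle of iteration `k`. -/
structure IsRun {n p : ℕ} (a : Params) (W : ℕ → Matrix (Fin n) (Fin n) ℝ)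
    (g : ℕ → Stacked n p → Stacked n p) (x₀ y₀ z₀ m₀ : Stacked n p) (s : ℕ → State n p) :
    Prop where
  init : s 0 = ⟨x₀, x₀, y₀, y₀, z₀, z₀, m₀⟩
  step : ∀ k, IsStep a (W k) (g k ((s k).xg a)) (s k) (s (k + 1))

/-! ### The stochastic objective, its smoothing and the two-point estimator -/

variable {n p : ℕ} {Ξ : Type*}

/-- `F(x, ξ) = ∑ i, f_i(x_i, ξ)`. -/
def total (f : Fin n → Node p → Ξ → ℝ) (x : Stacked n p) (ξ : Ξ) : ℝ := ∑ i, f i (x i) ξ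

/-- `F(x) = E_ξ F(x, ξ)`. -/
def objective [MeasurableSpace Ξ] (P : Measure Ξ) (f : Fin n → Node p → Ξ → ℝ)
    (x : Stacked n p) : ℝ := ∫ ξ, total f x ξ ∂P

/-- The uniform distribution on the Euclidean unit ball of `(ℝ^p)^V`. -/
def unifBall (n p : ℕ) : Measure (Stacked n p) := cond volume (Metric.closedBall 0 1)

/-- The uniform distribution on the Euclidean unit sphere of `(ℝ^p)^V`. -/
def unifSphere (n p : ℕ) : Measure (Stacked n p) :=
  (cond (volume : Measure (Stacked n p)).toSphere Set.univ).map Subtype.val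

/-- The smoothed function `F_γ(x) = E F(x + γ u)`, `u` uniform on the unit ball. -/
def smoothed (F : Stacked n p → ℝ) (γ : ℝ) (x : Stacked n p) : ℝ :=
  ∫ u, F (x + γ • u) ∂(unifBall n p)

/-- The two-point feedback estimator
`(d / 2γ) (F_δ(x + γ e, ξ) - F_δ(x - γ e, ξ)) e`, `F_δ = F + δ`, with `d = n p`. -/
def twoPoint (f : Fin n → Node p → Ξ → ℝ) (δ : Stacked n p → Ξ → ℝ) (γ : ℝ)
    (x : Stacked n p) (ξ : Ξ) (e : Stacked n p) : Stacked n p :=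
  (((n * p : ℕ) : ℝ) / (2 * γ) *
    ((total f (x + γ • e) ξ + δ (x + γ • e) ξ) - (total f (x - γ • e) ξ + δ (x - γ • e) ξ))) • e

/-- The batched two-point feedback estimator. -/
def batchTwoPoint {B : ℕ} (f : Fin n → Node p → Ξ → ℝ) (δ : Stacked n p → Ξ → ℝ) (γ : ℝ)
    (S : Fin B → Ξ × Stacked n p) (x : Stacked n p) : Stacked n p :=
  (B : ℝ)⁻¹ • ∑ b, twoPoint f δ γ x (S b).1 (S b).2

/-- The assumptions on the stochastic objective and on the noisy gradient-free oracle: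
each `f_i = E f_i(·, ξ)` is `μ`-strongly convex, `F(·, ξ)` is `M(ξ)`-Lipschitz on the
`γ`-neighbourhood of the convex set `Q` with `E M(ξ)² ≤ M²`, and the noise is bounded by `Δ`.
For `Q = univ` the Lipschitz condition is the global one. -/
structure Admissible [MeasurableSpace Ξ] (P : Measure Ξ) (f : Fin n → Node p → Ξ → ℝ)
    (δ : Stacked n p → Ξ → ℝ) (Q : Set (Stacked n p)) (μ M γ Δ : ℝ) : Prop where
  measurable_f : ∀ i, Measurable (Function.uncurry (f i))
  integrable_f : ∀ i v, Integrable (f i v) P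
  strongConvex : ∀ i, StrongConvexOn Set.univ μ (fun v => ∫ ξ, f i v ξ ∂P)
  convex_Q : Convex ℝ Q
  lipschitz : ∃ Mξ : Ξ → ℝ, Measurable Mξ ∧ Integrable (fun ξ => Mξ ξ ^ 2) P ∧
    ∫ ξ, Mξ ξ ^ 2 ∂P ≤ M ^ 2 ∧
    ∀ ξ, ∀ x ∈ Q + Metric.closedBall 0 γ, ∀ y ∈ Q + Metric.closedBall 0 γ,
      |total f y ξ - total f x ξ| ≤ Mξ ξ * ‖y - x‖
  measurable_δ : Measurable (Function.uncurry δ)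
  noise : ∀ x ξ, |δ x ξ| ≤ Δ

/-- The samples `(ξ, e)` of all iterations and all members of the batches are independent, with
`ξ` distributed according to `P`, `e` uniform on the unit sphere, and `ξ`, `e` independent. -/
structure IsSampling {Ω : Type*} [MeasurableSpace Ω] [MeasurableSpace Ξ] (Pr : Measure Ω)
    (P : Measure Ξ) {B : ℕ} (S : ℕ × Fin B → Ω → Ξ × Stacked n p) : Prop where
  measurable : ∀ i, Measurable (S i)
  law : ∀ i, Pr.map (S i) = P.prod (unifSphere n p)
  indep : iIndepFun S Pr

/-- The Bregman-type divergence `F(x) - F(y) - ⟪g, x - y⟫`. -/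
def bregman (F : Stacked n p → ℝ) (g x y : Stacked n p) : ℝ := F x - F y - ⟪g, x - y⟫

/-- The accuracy measure
`μ/2 ‖x - x⋆‖² + (F(x_f) - F(x⋆) - ⟪g, x_f - x⋆⟫) - μ/4 ‖x_f - x⋆‖²`. -/
def gap (F : Stacked n p → ℝ) (g xs : Stacked n p) (μ : ℝ) (s : State n p) : ℝ :=
  μ / 2 * ‖s.x - xs‖ ^ 2 + bregman F g s.xf xs - μ / 4 * ‖s.xf - xs‖ ^ 2

/-- The smoothing parameter `γ = ε / (2 M)`. -/
def smoothingRadius (M ε : ℝ) : ℝ := ε / (2 * M)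

/-- The Lipschitz constant `√d M / γ` of the gradient of the smoothed function. -/
def smoothness (d : ℕ) (M ε : ℝ) : ℝ := √d * M / smoothingRadius M ε

/-- ZO-SADOM with two-point feedback, batches of size `B`, `T` gossip rounds per iteration, network
constant `χ₁` in the parameters and tuning parameter `β`, solves after `N` iterations every
problem with constants `μ`, `M`, every network with constant `χ` and every noise of size `Δ` to
accuracy `ε`, from every initial point at distance at most `R` from the solution
`(x_γ, ∇F_γ(x_γ) - (μ/2) x_γ, -∇F_γ(x_γ))` of the saddle-point reformulation, provided that the
solutions and the iterates lie in the set `Q` near which `F(·, ξ)` is Lipschitz. Here `xs` is the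
solution `x⋆` of the initial problem and `xγ` that of the smoothed problem. Accuracy is understood
as `ε / 2` for the smoothed problem and `ε` for the initial one. -/
def Solves (n p : ℕ) (μ M χ ε Δ R : ℝ) (B T : ℕ) (χ₁ β : ℝ) (N : ℕ) : Prop :=
  ∀ (Ξ : Type u) [MeasurableSpace Ξ] (P : Measure Ξ) [IsProbabilityMeasure P]
    (Ω : Type v) [MeasurableSpace Ω] (Pr : Measure Ω) [IsProbabilityMeasure Pr]
    (G : ℕ → SimpleGraph (Fin n)) (W : ℕ → Matrix (Fin n) (Fin n) ℝ)
    (f : Fin n → Node p → Ξ → ℝ) (δ : Stacked n p → Ξ → ℝ) (Q : Set (Stacked n p))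
    (S : ℕ × Fin B → Ω → Ξ × Stacked n p)
    (xs xγ x₀ y₀ z₀ m₀ : Stacked n p) (s : ℕ → Ω → State n p),
    let γ := smoothingRadius M ε
    let F := objective P f
    let Fγ := smoothed F γ
    let g := gradient Fγ xγ
    let a := params μ (smoothness (n * p) M ε) χ₁ β
    IsGossipSequence G W χ →
    Admissible P f δ Q μ M γ Δ →
    IsSampling Pr P S →
    xs ∈ consensus n p → IsMinOn F (consensus n p) xs →
    xγ ∈ consensus n p → IsMinOn Fγ (consensus n p) xγ →
    z₀ ∈ consensusPerp n p →
    μ ^ 2 * ‖x₀ - xγ‖ ^ 2 + ‖y₀ - (g - (μ / 2) • xγ)‖ ^ 2 + ‖z₀ + g‖ ^ 2 + ‖m₀‖ ^ 2 ≤ R ^ 2 →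
    (∀ ω, IsRun a (multiGossip W T)
      (fun k => batchTwoPoint f δ γ (fun b => S (k, b) ω)) x₀ y₀ z₀ m₀ (fun k => s k ω)) →
    xs ∈ Q → xγ ∈ Q →
    (∀ k ≤ N, ∀ᵐ ω ∂Pr, (s k ω).x ∈ Q ∧ (s k ω).xf ∈ Q) →
    (Integrable (fun ω => gap Fγ g xγ μ (s N ω)) Pr ∧
      ∫ ω, gap Fγ g xγ μ (s N ω) ∂Pr ≤ ε / 2) ∧
    (Integrable (fun ω => gap F g xs μ (s N ω)) Pr ∧
      ∫ ω, gap F g xs μ (s N ω) ∂Pr ≤ ε) ∧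
    (Integrable (fun ω => μ / 2 * ‖(s N ω).x - xs‖ ^ 2) Pr ∧
      ∫ ω, μ / 2 * ‖(s N ω).x - xs‖ ^ 2 ∂Pr ≤ ε)

/-! ### The rates -/

/-- `max { d^{1/4} M χ / √(ε μ) ; χ² d M² / (ε B μ) }`. -/
def iterationRate (d : ℕ) (M χ ε μ : ℝ) (B : ℕ) : ℝ :=
  max ((d : ℝ) ^ (1 / 4 : ℝ) * M * χ / √(ε * μ)) (χ ^ 2 * d * M ^ 2 / (ε * B * μ))

/-- `min { ε^{5/2} μ^{1/2} / (d^{7/4} M N) ; B μ N ε³ / (χ² M² d) }`. -/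
def noiseRate (d : ℕ) (M χ ε μ : ℝ) (B N : ℕ) : ℝ :=
  min (ε ^ (5 / 2 : ℝ) * μ ^ (1 / 2 : ℝ) / ((d : ℝ) ^ (7 / 4 : ℝ) * M * N))
    (B * μ * N * ε ^ 3 / (χ ^ 2 * M ^ 2 * d))

/-- The logarithmic factor hidden in `Õ`. -/
def logFactor (M χ ε μ R : ℝ) : ℝ := Real.log (2 + χ + M ^ 2 / (ε * μ) + R ^ 2 / M ^ 2)

/-- Each of the `N` iterations draws `B` samples, each of which calls the gradient-free oracle at
the two points `x_g ± γ e`. -/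
def oracleCalls (N B : ℕ) : ℕ := N * (2 * B)

/-- Each of the `N` iterations uses `T` communication rounds. -/
def communications (N T : ℕ) : ℕ := N * T

end ZOSADOM

end

set_option linter.unusedSectionVars false

/-! The proof combines smoothing, a deterministic Lyapunov analysis of SADOM on the smoothed
problem, and an orthogonality argument for the sampling error.

Smoothing. The divergence theorem on the unit ball for Lipschitz functions
(`integral_closedBall_lineDeriv`) identifies the gradient of F_γ with an average over the sphere
(`hasGradientAt_ballSmooth`). The two-point estimator without noise has exactly this mean. The
gradient is √d M/γ-Lipschitz on Q (`norm_sphereGrad_sub_le`, transported to Q by a global convex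
Lipschitz extension), and F ≤ F_γ everywhere with F_γ ≤ F + γM = F + ε/2 on Q. The second moment of
the estimator is O(dM²) rather than the trivial O(d²M²), because the odd part of a K-Lipschitz
function on the sphere has variance O(K²/d) (`integral_sphereUnif_sub_neg_sq_le`). That bound comes
from a rotation argument in the style of Maurey and Pisier: under a Gaussian weight on E × E,
rotating a pair (x, y) through the angle π sends x to -x. Cutting the rotation into infinitesimal
pieces bounds the energy of the odd function by that of its derivative at x in the independent
direction y, and averaging over y produces the factor 1/d.

Contraction. Let r = √(βμ). Measured from the saddle point (x_γ, h - (μ/2) x_γ, -h), one iteration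
multiplies a weighted sum of squared deviations and a Bregman divergence by 1 - r/(32χ), up to inner
products with the gradient error (`lyapunov_step`, `IsStep.stateLyapunov_le`). It is assembled from
one energy inequality for each of the x, y, (y_f), (y_f + z_f) and (z, m) updates. The weights are
such that the mixed inner products and the projected coupling term cancel, and the remaining
positive terms are absorbed. Of the gossip matrix only three facts are used: it kills consensus
vectors, its image has zero sum, and I - W contracts zero-sum vectors. So a product of several
rounds is covered as well.

Errors. Solving the implicit (x, y) update shows that the gradient error enters the next x and y
additively. The sampling error is orthogonal to everything determined by earlier samples, so only
its square survives in expectation, and independence divides it by B. The noise of the oracle is a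
bounded bias, absorbed by terms left over in the contraction (`IsStep.noise_le`). Iterating gives an
expected accuracy of at most r/2 (1 - r/(32χ))^N Ψ₀ plus 16χ times the error per iteration
(`integral_gap_smoothed_le`).

Conclusion. `tuning` is the largest β compatible both with smoothness and with a sampling error of
ε/48. For it r is at least a constant times χ divided by the iteration rate, so a logarithmic
multiple of the rate kills the initial error (`initial_error_le`), while the assumed bound on the
noise handles the bias (`noise_error_le`). Accuracy ε/16 for F_γ is transferred to F by comparing
the two minimizers (`gap_le_of_gap`, `dist_sq_le_of_gap`). For the second part, T rounds of gossip
act as a network with constant 2, and the batch size balances the two terms of the rate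
(`complexity_le`). -/

noncomputable section
namespace ZOSADOM

open Filter Topology Set Metric

/-! ### The divergence theorem on the unit ball for Lipschitz functions. -/

section Sphere

variable {E : Type*} [NormedAddCommGroup E] [InnerProductSpace ℝ E] [FiniteDimensional ℝ E]
  [MeasurableSpace E] [BorelSpace E] [Nontrivial E] (μ : Measure E) [μ.IsAddHaarMeasure]

/-- Polar coordinates for a function which splits into a radial and an angular factor. -/
theorem integral_radial_mul_angular (φ : ℝ → ℝ) (k : E → ℝ) :
    ∫ x, φ ‖x‖ * k (‖x‖⁻¹ • x) ∂μ =
      (∫ r in Ioi (0 : ℝ), r ^ (Module.finrank ℝ E - 1) * φ r) * ∫ e, k e ∂μ.toSphere :=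
  calc
    ∫ x, φ ‖x‖ * k (‖x‖⁻¹ • x) ∂μ
      = ∫ x : ({(0)}ᶜ : Set E), φ ‖x.1‖ * k (‖x.1‖⁻¹ • x.1) ∂(μ.comap (↑)) := by
      rw [integral_subtype_comap (measurableSet_singleton _).compl
        fun x ↦ φ ‖x‖ * k (‖x‖⁻¹ • x), restrict_compl_singleton]
    _ = ∫ x, k x.1 * φ x.2 ∂μ.toSphere.prod (.volumeIoiPow (Module.finrank ℝ E - 1)) := by
      rw [← μ.measurePreserving_homeomorphUnitSphereProd.integral_comp
        (Homeomorph.measurableEmbedding _) (fun x => k x.1 * φ x.2)]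
      simp [mul_comm]
    _ = (∫ e, k e ∂μ.toSphere) *
        ∫ x : Ioi (0 : ℝ), φ x ∂.volumeIoiPow (Module.finrank ℝ E - 1) :=
      integral_prod_mul (fun e : sphere (0 : E) 1 => k e) (fun r : Ioi (0 : ℝ) => φ r)
    _ = _ := by
      rw [mul_comm]
      congr 1
      simp only [Measure.volumeIoiPow, ENNReal.ofReal]
      rw [integral_withDensity_eq_integral_smul,
        integral_subtype_comap measurableSet_Ioi
          fun a ↦ Real.toNNReal (a ^ (Module.finrank ℝ E - 1)) • φ a,
        setIntegral_congr_fun measurableSet_Ioi fun x hx ↦ ?_]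
      · rw [NNReal.smul_def, Real.coe_toNNReal _ (pow_nonneg hx.out.le _), smul_eq_mul]
      · exact (measurable_subtype_coe.pow_const _).real_toNNReal

/-- The piecewise linear cutoff which is `1` up to radius `1` and `0` from radius `1 + ε`. -/
def radialCutoff (ε r : ℝ) : ℝ := max 0 (min 1 ((1 + ε - r) / ε))

theorem radialCutoff_nonneg (ε r : ℝ) : 0 ≤ radialCutoff ε r := le_max_left _ _

theorem radialCutoff_le_one (ε r : ℝ) : radialCutoff ε r ≤ 1 :=
  max_le zero_le_one (min_le_left _ _)

theorem radialCutoff_eq_one {ε r : ℝ} (hε : 0 < ε) (hr : r ≤ 1) : radialCutoff ε r = 1 := by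
  have : 1 ≤ (1 + ε - r) / ε := by rw [le_div_iff₀ hε]; linarith
  simp [radialCutoff, min_eq_left this]

theorem radialCutoff_eq_zero {ε r : ℝ} (hε : 0 < ε) (hr : 1 + ε ≤ r) : radialCutoff ε r = 0 := by
  have : (1 + ε - r) / ε ≤ 0 := div_nonpos_of_nonpos_of_nonneg (by linarith) hε.le
  exact max_eq_left ((min_le_right _ _).trans this)

theorem radialCutoff_eq_linear {ε r : ℝ} (hε : 0 < ε) (hr : 1 ≤ r) (hr' : r ≤ 1 + ε) :
    radialCutoff ε r = (1 + ε - r) / ε := by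
  have h1 : (1 + ε - r) / ε ≤ 1 := by rw [div_le_one hε]; linarith
  have h2 : 0 ≤ (1 + ε - r) / ε := div_nonneg (by linarith) hε.le
  rw [radialCutoff, min_eq_right h1, max_eq_right h2]

theorem lipschitzWith_radialCutoff {ε : ℝ} (hε : 0 < ε) :
    LipschitzWith (Real.toNNReal ε⁻¹) (radialCutoff ε) := by
  have h : LipschitzWith (Real.toNNReal ε⁻¹) fun r : ℝ => (1 + ε - r) / ε := by
    refine LipschitzWith.of_dist_le_mul fun x y => ?_
    rw [Real.coe_toNNReal _ (inv_nonneg.2 hε.le), Real.dist_eq, Real.dist_eq, ← sub_div, abs_div,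
      abs_of_pos hε, div_eq_inv_mul]
    refine le_of_eq ?_
    congr 1
    rw [← abs_neg]; congr 1; ring
  exact (h.const_min 1).const_max 0

theorem hasCompactSupport_radialCutoff {ε : ℝ} (hε : 0 < ε) :
    HasCompactSupport fun x : E => radialCutoff ε ‖x‖ := by
  refine HasCompactSupport.intro (isCompact_closedBall (0 : E) (1 + ε)) fun x hx => ?_
  rw [mem_closedBall_zero_iff, not_le] at hx
  exact radialCutoff_eq_zero hε hx.le

/-- The cutoff is locally constant off the shell and affine in the norm inside it, so its gradient
there is -1/ε times the outer normal. The two excluded spheres are null sets. -/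
theorem lineDeriv_radialCutoff {ε : ℝ} (hε : 0 < ε) (v x : E) (h1 : ‖x‖ ≠ 1)
    (h2 : ‖x‖ ≠ 1 + ε) :
    lineDeriv ℝ (fun x : E => radialCutoff ε ‖x‖) x v =
      (Ioo 1 (1 + ε)).indicator (fun _ => -ε⁻¹) ‖x‖ * ⟪‖x‖⁻¹ • x, v⟫ := by
  rcases lt_or_gt_of_ne h1 with h1 | h1
  · have : (fun x : E => radialCutoff ε ‖x‖) =ᶠ[𝓝 x] fun _ => 1 := by
      filter_upwards [(isOpen_lt continuous_norm continuous_const).mem_nhds h1] with y hy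
      exact radialCutoff_eq_one hε (le_of_lt hy)
    rw [this.lineDeriv_eq, indicator_of_notMem (fun h => by linarith [h.1])]
    simp [lineDeriv]
  rcases lt_or_gt_of_ne h2 with h2 | h2
  · have hx0 : x ≠ 0 := by rintro rfl; simp at h1; linarith
    have : (fun x : E => radialCutoff ε ‖x‖) =ᶠ[𝓝 x] fun y => (1 + ε - ‖y‖) / ε := by
      filter_upwards [(isOpen_lt continuous_norm continuous_const).mem_nhds h2,
        (isOpen_lt continuous_const continuous_norm).mem_nhds h1] with y hy hy'
      exact radialCutoff_eq_linear hε (le_of_lt hy') (le_of_lt hy)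
    rw [this.lineDeriv_eq, indicator_of_mem (show ‖x‖ ∈ Ioo 1 (1 + ε) from ⟨h1, h2⟩)]
    have hn : HasFDerivAt (fun y : E => ‖y‖) (‖x‖⁻¹ • innerSL ℝ x) x := by
      have h := ((hasStrictFDerivAt_norm_sq x).hasFDerivAt).sqrt (by positivity)
      simp only [Real.sqrt_sq (norm_nonneg _)] at h
      convert h using 1
      ext y
      simp
      field_simp
    have h := ((hn.const_sub (1 + ε)).mul_const ε⁻¹).hasLineDerivAt v
    simp only [← div_eq_mul_inv] at h
    rw [h.lineDeriv]
    simp [real_inner_smul_left]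
  · have : (fun x : E => radialCutoff ε ‖x‖) =ᶠ[𝓝 x] fun _ => 0 := by
      filter_upwards [(isOpen_lt continuous_const continuous_norm).mem_nhds h2] with y hy
      exact radialCutoff_eq_zero hε (le_of_lt hy)
    rw [this.lineDeriv_eq, indicator_of_notMem (fun h => by linarith [h.2])]
    simp [lineDeriv]

theorem tendsto_radialCutoff (r : ℝ) :
    Tendsto (fun ε => radialCutoff ε r) (𝓝[>] 0) (𝓝 ((Iic (1 : ℝ)).indicator (fun _ => 1) r)) := by
  rcases le_or_gt r 1 with h | h
  · rw [indicator_of_mem (mem_Iic.2 h)]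
    refine tendsto_const_nhds.congr' ?_
    filter_upwards [self_mem_nhdsWithin] with ε hε
    exact (radialCutoff_eq_one hε h).symm
  · rw [indicator_of_notMem (by simpa using h)]
    refine tendsto_const_nhds.congr' ?_
    filter_upwards [Ioo_mem_nhdsGT (sub_pos.2 h)] with ε hε
    exact (radialCutoff_eq_zero hε.1 (by linarith [hε.2])).symm

/-- This is the difference quotient at t = 1 of t ↦ ∫ r^m over [1, t], whose derivative at 1 is 1.
-/
theorem tendsto_shell_average (m : ℕ) :
    Tendsto (fun ε : ℝ => ∫ r in Ioi (0 : ℝ), r ^ m * (Ioo 1 (1 + ε)).indicator (fun _ => ε⁻¹) r)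
      (𝓝[>] 0) (𝓝 1) := by
  have hc : Continuous fun r : ℝ => r ^ m := by fun_prop
  have h := (intervalIntegral.integral_hasDerivAt_right (hc.intervalIntegrable 1 1)
    (hc.stronglyMeasurableAtFilter _ _) hc.continuousAt).tendsto_slope_zero_right
  simp only [intervalIntegral.integral_same, sub_zero, one_pow, smul_eq_mul] at h
  refine h.congr' ?_
  filter_upwards [self_mem_nhdsWithin] with ε hε
  have hε : 0 < ε := hε
  have : ∀ r : ℝ, r ^ m * (Ioo 1 (1 + ε)).indicator (fun _ => ε⁻¹) r =
      (Ioo 1 (1 + ε)).indicator (fun r => ε⁻¹ * r ^ m) r := by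
    intro r
    by_cases hr : r ∈ Ioo 1 (1 + ε) <;> simp [hr, mul_comm]
  simp_rw [this]
  rw [setIntegral_indicator measurableSet_Ioo, inter_eq_self_of_subset_right
    (fun r hr => by simp only [mem_Ioi]; linarith [hr.1]), ← integral_Ioc_eq_integral_Ioo,
    integral_const_mul, intervalIntegral.integral_of_le (by linarith)]

/-- The divergence theorem on the unit ball for Lipschitz functions. -/
theorem integral_closedBall_lineDeriv {f : E → ℝ} {C : NNReal} (hf : LipschitzWith C f) (v : E) :
    ∫ x in closedBall 0 1, lineDeriv ℝ f x v ∂μ = ∫ e, ⟪(e : E), v⟫ * f e ∂μ.toSphere := by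
  set m := Module.finrank ℝ E - 1
  set c : ℝ → ℝ := fun ε =>
    ∫ r in Ioi (0 : ℝ), r ^ m * (Ioo 1 (1 + ε)).indicator (fun _ => ε⁻¹) r with hc
  set I := ∫ e, ⟪(e : E), v⟫ * f e ∂μ.toSphere with hI
  have hlim : Tendsto (fun ε => ∫ x, lineDeriv ℝ f x v * radialCutoff ε ‖x‖ ∂μ) (𝓝[>] 0)
      (𝓝 (∫ x in closedBall 0 1, lineDeriv ℝ f x v ∂μ)) := by
    rw [← integral_indicator measurableSet_closedBall]
    refine tendsto_integral_filter_of_dominated_convergence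
      ((closedBall (0 : E) 2).indicator fun _ => C * ‖v‖) ?_ ?_ ?_ ?_
    · filter_upwards [self_mem_nhdsWithin] with ε hε
      exact ((aestronglyMeasurable_lineDeriv hf.continuous μ)).mul
        (((lipschitzWith_radialCutoff hε).continuous.comp continuous_norm).aestronglyMeasurable)
    · filter_upwards [Ioo_mem_nhdsGT one_pos] with ε hε
      refine .of_forall fun x => ?_
      rw [norm_mul, Real.norm_of_nonneg (radialCutoff_nonneg _ _)]
      by_cases hx : x ∈ closedBall (0 : E) 2
      · rw [indicator_of_mem hx]
        have := norm_lineDeriv_le_of_lipschitz ℝ hf (x₀ := x) (v := v)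
        nlinarith [radialCutoff_nonneg ε ‖x‖, radialCutoff_le_one ε ‖x‖,
          norm_nonneg (lineDeriv ℝ f x v)]
      · rw [indicator_of_notMem hx]
        rw [mem_closedBall_zero_iff, not_le] at hx
        rw [radialCutoff_eq_zero hε.1 (by linarith [hε.2]), mul_zero]
    · exact (integrable_indicator_iff measurableSet_closedBall).2
        (integrableOn_const (measure_closedBall_lt_top.ne))
    · refine .of_forall fun x => ?_
      have h := (tendsto_radialCutoff ‖x‖).const_mul (lineDeriv ℝ f x v)
      convert h using 2
      by_cases hx : ‖x‖ ≤ 1 <;> simp [hx, indicator]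
  -- Integration by parts moves the derivative onto the cutoff, which turns the volume integral into
  -- an average over a thin shell outside the unit sphere.
  have hparts : ∀ ε, 0 < ε → ∫ x, lineDeriv ℝ f x v * radialCutoff ε ‖x‖ ∂μ =
      ∫ x, (Ioo 1 (1 + ε)).indicator (fun _ => ε⁻¹) ‖x‖ * (⟪‖x‖⁻¹ • x, v⟫ * f x) ∂μ := by
    intro ε hε
    rw [hf.integral_lineDeriv_mul_eq (g := fun x : E => radialCutoff ε ‖x‖)
      ((lipschitzWith_radialCutoff hε).comp lipschitzWith_one_norm)
      (hasCompactSupport_radialCutoff hε)]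
    refine integral_congr_ae ?_
    have h1 : ∀ᵐ x ∂μ, ‖x‖ ≠ 1 := by
      filter_upwards [measure_eq_zero_iff_ae_notMem.1 (Measure.addHaar_sphere μ (0 : E) 1)]
        with x hx
      simpa using hx
    have h2 : ∀ᵐ x ∂μ, ‖x‖ ≠ 1 + ε := by
      filter_upwards [measure_eq_zero_iff_ae_notMem.1 (Measure.addHaar_sphere μ (0 : E) (1 + ε))]
        with x hx
      simpa using hx
    filter_upwards [h1, h2] with x h1 h2
    have := lineDeriv_radialCutoff hε (-v) x h1 h2
    rw [this]
    by_cases hx : ‖x‖ ∈ Ioo 1 (1 + ε) <;> simp [hx]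
    ring
  have hpolar : ∀ ε, ∫ x, (Ioo 1 (1 + ε)).indicator (fun _ => ε⁻¹) ‖x‖ *
      (⟪‖x‖⁻¹ • x, v⟫ * f (‖x‖⁻¹ • x)) ∂μ = c ε * I := fun ε =>
    integral_radial_mul_angular μ ((Ioo 1 (1 + ε)).indicator fun _ => ε⁻¹)
      fun e => ⟪e, v⟫ * f e
  have hmass : ∀ ε, ∫ x : E, (Ioo 1 (1 + ε)).indicator (fun _ => ε⁻¹) ‖x‖ ∂μ =
      c ε * μ.toSphere.real univ := by
    intro ε
    have := integral_radial_mul_angular μ ((Ioo 1 (1 + ε)).indicator fun _ => ε⁻¹) fun _ => 1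
    simpa using this
  have hmeas : ∀ ε : ℝ, Measurable fun x : E => (Ioo 1 (1 + ε)).indicator (fun _ => ε⁻¹) ‖x‖ :=
    fun ε => (measurable_const.indicator measurableSet_Ioo).comp measurable_norm
  have hint0 : ∀ ε : ℝ, Integrable (fun x : E => (Ioo 1 (1 + ε)).indicator (fun _ => ε⁻¹) ‖x‖) μ := by
    intro ε
    refine Integrable.mono' ((integrable_indicator_iff (measurableSet_closedBall (x := (0 : E))
      (ε := 1 + ε))).2 (integrableOn_const (C := |ε⁻¹|) measure_closedBall_lt_top.ne))
      (hmeas ε).aestronglyMeasurable (.of_forall fun x => ?_)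
    by_cases hx : ‖x‖ ∈ Ioo 1 (1 + ε)
    · simp [hx, hx.2.le]
    · simp only [indicator_of_notMem hx, norm_zero]
      exact indicator_nonneg (fun _ _ => abs_nonneg _) _
  -- On the shell x lies within ε of its direction, so replacing f x by its value at the direction
  -- costs at most Cε pointwise. After the replacement polar coordinates apply exactly.
  have hbound : ∀ ε, 0 < ε →
      |∫ x, (Ioo 1 (1 + ε)).indicator (fun _ => ε⁻¹) ‖x‖ * (⟪‖x‖⁻¹ • x, v⟫ * f x) ∂μ - c ε * I| ≤
        ε * (C * ‖v‖) * (c ε * μ.toSphere.real univ) := by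
    intro ε hε
    obtain ⟨K, hK⟩ := (isCompact_closedBall (0 : E) (1 + ε)).exists_bound_of_continuousOn
      hf.continuous.continuousOn
    have hdir : ∀ x : E, ‖‖x‖⁻¹ • x‖ ≤ 1 := by
      intro x
      rcases eq_or_ne x 0 with rfl | hx
      · simp
      · rw [norm_smul, norm_inv, norm_norm, inv_mul_cancel₀ (norm_ne_zero_iff.2 hx)]
    have hin : ∀ x : E, |⟪‖x‖⁻¹ • x, v⟫| ≤ ‖v‖ := fun x =>
      (abs_real_inner_le_norm _ _).trans
        (mul_le_of_le_one_left (norm_nonneg _) (hdir x))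
    have hshell : ∀ (x y : E), ‖x‖ ∈ Ioo 1 (1 + ε) → ‖y‖ ≤ 1 + ε → |⟪‖x‖⁻¹ • x, v⟫ * f y| ≤ ‖v‖ * K := by
      intro x y hx hy
      rw [abs_mul]
      exact mul_le_mul (hin x) (hK y (by simpa using hy)) (abs_nonneg _) (norm_nonneg _)
    have hi : ∀ g : E → E, Measurable g → (∀ x, ‖x‖ ≤ 1 + ε → ‖g x‖ ≤ 1 + ε) →
        Integrable (fun x => (Ioo 1 (1 + ε)).indicator (fun _ => ε⁻¹) ‖x‖ *
          (⟪‖x‖⁻¹ • x, v⟫ * f (g x))) μ := by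
      intro g hg hgx
      refine Integrable.mono' ((hint0 ε).mul_const (‖v‖ * K)) ?_ (.of_forall fun x => ?_)
      · have := hf.continuous.measurable.comp hg
        exact ((hmeas ε).mul (Measurable.mul (by fun_prop) this)).aestronglyMeasurable
      · by_cases hx : ‖x‖ ∈ Ioo 1 (1 + ε)
        · rw [norm_mul, indicator_of_mem hx, Real.norm_of_nonneg (inv_nonneg.2 hε.le)]
          exact mul_le_mul_of_nonneg_left (hshell x _ hx (hgx x hx.2.le)) (inv_nonneg.2 hε.le)
        · simp [hx]
    rw [← hpolar, ← integral_sub (hi (fun x => x) measurable_id fun x hx => hx)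
      (hi (fun x => ‖x‖⁻¹ • x) (by fun_prop) fun x _ => (hdir x).trans (by linarith)), ← hmass,
      ← integral_const_mul, ← Real.norm_eq_abs]
    refine norm_integral_le_of_norm_le ((hint0 ε).const_mul _) (.of_forall fun x => ?_)
    by_cases hx : ‖x‖ ∈ Ioo 1 (1 + ε)
    · have hx0 : (0 : ℝ) < ‖x‖ := by linarith [hx.1]
      simp only [indicator_of_mem hx]
      rw [← mul_sub, ← mul_sub, norm_mul, norm_mul, Real.norm_of_nonneg (inv_nonneg.2 hε.le),
        Real.norm_eq_abs, mul_comm _ ε⁻¹]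
      refine mul_le_mul_of_nonneg_left ?_ (inv_nonneg.2 hε.le)
      have h1 : ‖f x - f (‖x‖⁻¹ • x)‖ ≤ C * ε := by
        refine (hf.norm_sub_le _ _).trans (mul_le_mul_of_nonneg_left ?_ C.2)
        have : x - ‖x‖⁻¹ • x = (1 - ‖x‖⁻¹) • x := by rw [sub_smul, one_smul]
        rw [this, norm_smul, Real.norm_of_nonneg
          (sub_nonneg.2 (inv_le_one_of_one_le₀ hx.1.le)), sub_mul, inv_mul_cancel₀ hx0.ne']
        linarith [hx.2]
      calc |⟪‖x‖⁻¹ • x, v⟫| * ‖f x - f (‖x‖⁻¹ • x)‖ ≤ ‖v‖ * (C * ε) :=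
            mul_le_mul (hin x) h1 (norm_nonneg _) (norm_nonneg _)
        _ = ε * (C * ‖v‖) := by ring
    · simp [hx]
  have hc1 : Tendsto c (𝓝[>] 0) (𝓝 1) := tendsto_shell_average m
  have h0 : Tendsto (fun ε : ℝ => ε) (𝓝[>] 0) (𝓝 0) := tendsto_id.mono_left nhdsWithin_le_nhds
  have hz : Tendsto (fun ε => ∫ x, lineDeriv ℝ f x v * radialCutoff ε ‖x‖ ∂μ - c ε * I) (𝓝[>] 0)
      (𝓝 0) := by
    refine squeeze_zero_norm' (a := fun ε => ε * (C * ‖v‖) * (c ε * μ.toSphere.real univ)) ?_ ?_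
    · filter_upwards [self_mem_nhdsWithin] with ε hε
      rw [hparts ε hε]
      exact hbound ε hε
    · simpa using (h0.mul_const (C * ‖v‖ : ℝ)).mul (hc1.mul_const (μ.toSphere.real univ))
  have hA := hz.add (hc1.mul_const I)
  simp only [sub_add_cancel, zero_add, one_mul] at hA
  exact tendsto_nhds_unique hlim hA

end Sphere

/-! ### Uniform distributions on ball and sphere, and rotations of E × E. -/

section SphereMeasure

variable {E : Type*} [NormedAddCommGroup E] [InnerProductSpace ℝ E] [FiniteDimensional ℝ E]
  [MeasurableSpace E] [BorelSpace E] [Nontrivial E] (μ : Measure E) [μ.IsAddHaarMeasure]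

/-- The uniform distribution on the unit sphere. -/
def sphereUnif : Measure E := (cond μ.toSphere univ).map Subtype.val

/-- The uniform distribution on the unit ball. -/
def ballUnif : Measure E := cond μ (closedBall 0 1)

instance : IsProbabilityMeasure (sphereUnif μ) :=
  haveI := cond_isProbabilityMeasure (μ := μ.toSphere) (s := univ)
    (Measure.measure_univ_ne_zero.2 (Measure.toSphere_ne_zero μ))
  Measure.isProbabilityMeasure_map measurable_subtype_coe.aemeasurable

instance : IsProbabilityMeasure (ballUnif μ) :=
  cond_isProbabilityMeasure_of_finite
    (Metric.measure_closedBall_pos μ 0 one_pos).ne' measure_closedBall_lt_top.ne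

theorem integral_sphereUnif {F : Type*} [NormedAddCommGroup F] [NormedSpace ℝ F] (k : E → F) :
    ∫ e, k e ∂sphereUnif μ = (μ.toSphere.real univ)⁻¹ • ∫ e, k e ∂μ.toSphere := by
  rw [sphereUnif, (MeasurableEmbedding.subtype_coe isClosed_sphere.measurableSet).integral_map,
    ProbabilityTheory.cond, Measure.restrict_univ, integral_smul_measure]
  simp [Measure.real]

theorem ae_norm_eq_one_sphereUnif : ∀ᵐ e ∂sphereUnif μ, ‖e‖ = 1 := by
  rw [sphereUnif, (MeasurableEmbedding.subtype_coe isClosed_sphere.measurableSet).ae_map_iff]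
  exact .of_forall fun e => by simp

theorem integral_ballUnif {F : Type*} [NormedAddCommGroup F] [NormedSpace ℝ F] (k : E → F) :
    ∫ x, k x ∂ballUnif μ = (μ.real (closedBall 0 1))⁻¹ • ∫ x in closedBall 0 1, k x ∂μ := by
  rw [ballUnif, ProbabilityTheory.cond, integral_smul_measure]
  simp [Measure.real]

theorem ae_mem_closedBall_ballUnif : ∀ᵐ x ∂ballUnif μ, x ∈ closedBall (0 : E) 1 := by
  rw [ballUnif, ProbabilityTheory.cond]
  exact Measure.ae_smul_measure (ae_restrict_mem measurableSet_closedBall) _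

theorem ballUnif_absolutelyContinuous : ballUnif μ ≪ μ := cond_absolutelyContinuous

theorem integrable_sphereUnif_of_bound {F : Type*} [NormedAddCommGroup F] {k : E → F}
    (hk : AEStronglyMeasurable k (sphereUnif μ)) (C : ℝ) (hC : ∀ e, ‖e‖ = 1 → ‖k e‖ ≤ C) :
    Integrable k (sphereUnif μ) :=
  Integrable.of_bound hk C (by filter_upwards [ae_norm_eq_one_sphereUnif μ] with e he using hC e he)

theorem integrable_ballUnif_of_bound {F : Type*} [NormedAddCommGroup F] {k : E → F}
    (hk : AEStronglyMeasurable k (ballUnif μ)) (C : ℝ) (hC : ∀ x, ‖x‖ ≤ 1 → ‖k x‖ ≤ C) :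
    Integrable k (ballUnif μ) :=
  Integrable.of_bound hk C (by
    filter_upwards [ae_mem_closedBall_ballUnif μ] with x hx using hC x (by simpa using hx))

theorem integrable_sphereUnif_of_continuous {F : Type*} [NormedAddCommGroup F]
    [SecondCountableTopology F] {k : E → F} (hk : Continuous k) : Integrable k (sphereUnif μ) := by
  obtain ⟨C, hC⟩ := (isCompact_sphere (0 : E) 1).exists_bound_of_continuousOn hk.continuousOn
  exact integrable_sphereUnif_of_bound μ hk.aestronglyMeasurable C fun e he => hC e (by simpa)

theorem integrable_ballUnif_of_continuous {F : Type*} [NormedAddCommGroup F]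
    [SecondCountableTopology F] {k : E → F} (hk : Continuous k) : Integrable k (ballUnif μ) := by
  obtain ⟨C, hC⟩ := (isCompact_closedBall (0 : E) 1).exists_bound_of_continuousOn hk.continuousOn
  exact integrable_ballUnif_of_bound μ hk.aestronglyMeasurable C fun e he => hC e (by simpa)

/-- The divergence theorem on the unit ball, in terms of the uniform distributions. -/
theorem integral_ballUnif_lineDeriv {f : E → ℝ} {C : NNReal} (hf : LipschitzWith C f) (v : E) :
    ∫ x, lineDeriv ℝ f x v ∂ballUnif μ =
      Module.finrank ℝ E * ∫ e, ⟪e, v⟫ * f e ∂sphereUnif μ := by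
  have hpos : (0 : ℝ) < μ.real (ball 0 1) :=
    ENNReal.toReal_pos (measure_ball_pos μ 0 one_pos).ne' measure_ball_lt_top.ne
  have hd : (0 : ℝ) < Module.finrank ℝ E := by exact_mod_cast Module.finrank_pos
  rw [integral_ballUnif, integral_closedBall_lineDeriv μ hf,
    integral_sphereUnif μ fun e => ⟪e, v⟫ * f e, Measure.toSphere_real_apply_univ, Measure.real,
    Measure.addHaar_closedBall_eq_addHaar_ball, ← Measure.real]
  simp only [smul_eq_mul]
  field_simp

/-- The divergence theorem for the linear function ⟪v, ·⟫, whose derivative along v is constant,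
gives the covariance of the sphere without using rotation invariance. -/
theorem integral_sphereUnif_inner_sq (v : E) :
    ∫ e, ⟪e, v⟫ ^ 2 ∂sphereUnif μ = ‖v‖ ^ 2 / Module.finrank ℝ E := by
  have hd : (0 : ℝ) < Module.finrank ℝ E := by exact_mod_cast Module.finrank_pos
  have h := integral_ballUnif_lineDeriv μ (innerSL ℝ v).lipschitz v
  have h2 : ∀ x, lineDeriv ℝ (innerSL ℝ v) x v = ‖v‖ ^ 2 := fun x => by
    rw [((innerSL ℝ v).hasFDerivAt.hasLineDerivAt v).lineDeriv]
    simp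
  simp only [h2, integral_const, probReal_univ, one_smul] at h
  rw [eq_div_iff hd.ne', h, mul_comm]
  congr 2 with e
  simp [real_inner_comm, sq]

/-- The normalised form of polar coordinates: applying the formula also to the constant angular
factor eliminates the one-dimensional radial integral, so that no volume constant has to be
computed. -/
theorem integral_radial_mul_angular' (φ : ℝ → ℝ) (k : E → ℝ) :
    ∫ x, φ ‖x‖ * k (‖x‖⁻¹ • x) ∂μ = (∫ x, φ ‖x‖ ∂μ) * ∫ e, k e ∂sphereUnif μ := by
  have h1 := integral_radial_mul_angular μ φ fun _ => 1
  simp only [mul_one, integral_const, smul_eq_mul] at h1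
  have h0 : μ.toSphere.real univ ≠ 0 :=
    (measureReal_ne_zero_iff).2 (Measure.measure_univ_ne_zero.2 (Measure.toSphere_ne_zero μ))
  rw [integral_radial_mul_angular, h1, integral_sphereUnif, smul_eq_mul]
  field_simp

/-- The symmetry is inherited from the reflection invariance of `μ` on E, by comparing the integrals
over the unit ball of k and of its reflection in polar coordinates. -/
theorem integral_sphereUnif_neg (k : E → ℝ) :
    ∫ e, k (-e) ∂sphereUnif μ = ∫ e, k e ∂sphereUnif μ := by
  have h1 := integral_radial_mul_angular' μ ((Iic 1).indicator fun _ => 1) k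
  have h2 := integral_radial_mul_angular' μ ((Iic 1).indicator fun _ => 1) fun e => k (-e)
  have h3 : ∫ x, (Iic (1 : ℝ)).indicator (fun _ => (1 : ℝ)) ‖x‖ ∂μ = μ.real (closedBall 0 1) := by
    rw [← integral_indicator_one measurableSet_closedBall]
    congr 1 with x
    simp [indicator]
  have hpos : (0 : ℝ) < μ.real (closedBall 0 1) :=
    ENNReal.toReal_pos (measure_closedBall_pos μ 0 one_pos).ne' measure_closedBall_lt_top.ne
  rw [h3] at h1 h2
  rw [← integral_neg_eq_self] at h1
  simp only [norm_neg, smul_neg] at h1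
  exact mul_left_cancel₀ hpos.ne' (h2.symm.trans h1)

theorem integral_ballUnif_neg (k : E → ℝ) :
    ∫ x, k (-x) ∂ballUnif μ = ∫ x, k x ∂ballUnif μ := by
  rw [integral_ballUnif, integral_ballUnif, ← integral_indicator measurableSet_closedBall,
    ← integral_indicator measurableSet_closedBall,
    ← integral_neg_eq_self ((closedBall 0 1).indicator k)]
  congr 2 with x
  simp [indicator]

/-! ### Concentration on the sphere -/

/-- The one-homogeneous extension of the odd part of a function on the sphere. -/
def oddExtension (f : E → ℝ) (x : E) : ℝ := ‖x‖ * (f (‖x‖⁻¹ • x) - f (-(‖x‖⁻¹ • x)))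

theorem oddExtension_neg (f : E → ℝ) (x : E) : oddExtension f (-x) = -oddExtension f x := by
  simp only [oddExtension, norm_neg, smul_neg, neg_neg]
  ring

/-- The increment splits into a change of direction and a change of radius. With a, b the directions
of x, y, one has ‖x‖‖a - b‖ ≤ 2‖x - y‖. On directions the odd difference is 2K-Lipschitz and bounded
by 2K, which gives 4K + 2K. -/
theorem lipschitzWith_oddExtension {f : E → ℝ} {K : NNReal}
    (hf : LipschitzOnWith K f (closedBall 0 1)) : LipschitzWith (6 * K) (oddExtension f) := by
  have hK : (0 : ℝ) ≤ K := K.2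
  have hdir : ∀ x : E, ‖‖x‖⁻¹ • x‖ ≤ 1 := by
    intro x
    rcases eq_or_ne x 0 with rfl | hx
    · simp
    · rw [norm_smul, norm_inv, norm_norm, inv_mul_cancel₀ (norm_ne_zero_iff.2 hx)]
  have hL : ∀ x y : E, ‖x‖ ≤ 1 → ‖y‖ ≤ 1 → |f x - f y| ≤ K * ‖x - y‖ := fun x y hx hy => by
    simpa [Real.dist_eq, dist_eq_norm] using
      hf.dist_le_mul x (by simpa using hx) y (by simpa using hy)
  refine LipschitzWith.of_dist_le_mul fun x y => ?_
  rw [Real.dist_eq, dist_eq_norm]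
  push_cast
  set a := ‖x‖⁻¹ • x with ha
  set b := ‖y‖⁻¹ • y with hb
  have hxa : ‖x‖ • a = x := by
    rcases eq_or_ne x 0 with rfl | hx
    · simp
    · rw [ha, smul_smul, mul_inv_cancel₀ (norm_ne_zero_iff.2 hx), one_smul]
  have hyb : ‖y‖ • b = y := by
    rcases eq_or_ne y 0 with rfl | hx
    · simp
    · rw [hb, smul_smul, mul_inv_cancel₀ (norm_ne_zero_iff.2 hx), one_smul]
  have h1 := hL a b (hdir x) (hdir y)
  have h2 := hL (-a) (-b) (by simpa using hdir x) (by simpa using hdir y)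
  have h3 := hL b (-b) (hdir y) (by simpa using hdir y)
  have h4 : ‖b - -b‖ ≤ 2 := by
    rw [sub_neg_eq_add]
    linarith [norm_add_le b b, hdir y]
  have h5 : ‖-a - -b‖ = ‖a - b‖ := by rw [← norm_neg]; congr 1; abel
  have h6 : ‖x‖ * ‖a - b‖ ≤ 2 * ‖x - y‖ := by
    have : ‖x‖ * ‖a - b‖ = ‖(x - y) + (‖y‖ - ‖x‖) • b‖ := by
      rw [← norm_norm x, ← norm_smul, norm_norm, smul_sub, hxa, sub_smul, hyb]
      congr 1; abel
    rw [this]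
    refine (norm_add_le _ _).trans ?_
    rw [norm_smul, Real.norm_eq_abs, abs_sub_comm]
    nlinarith [abs_norm_sub_norm_le x y, hdir y, abs_nonneg (‖x‖ - ‖y‖), norm_nonneg b]
  have h7 : oddExtension f x - oddExtension f y =
      ‖x‖ * ((f a - f b) - (f (-a) - f (-b))) + (‖x‖ - ‖y‖) * (f b - f (-b)) := by
    simp only [oddExtension, ← ha, ← hb]
    ring
  rw [h7]
  refine (abs_add_le _ _).trans ?_
  rw [abs_mul, abs_mul, abs_norm]
  have h8 : |(f a - f b) - (f (-a) - f (-b))| ≤ 2 * K * ‖a - b‖ := by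
    refine (abs_sub _ _).trans ?_
    rw [h5] at h2
    linarith
  have h9 : |f b - f (-b)| ≤ 2 * K := h3.trans (by nlinarith)
  have h10 := abs_norm_sub_norm_le x y
  calc ‖x‖ * |(f a - f b) - (f (-a) - f (-b))| + |‖x‖ - ‖y‖| * |f b - f (-b)|
      ≤ ‖x‖ * (2 * K * ‖a - b‖) + ‖x - y‖ * (2 * K) := by gcongr
    _ = 2 * K * (‖x‖ * ‖a - b‖) + ‖x - y‖ * (2 * K) := by ring
    _ ≤ 2 * K * (2 * ‖x - y‖) + ‖x - y‖ * (2 * K) := by gcongr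
    _ = 6 * K * ‖x - y‖ := by ring

/-- The rotation of `E × E` by the angle `θ`. -/
abbrev rot (θ : ℝ) : E × E →L[ℝ] E × E := ContinuousLinearMap.rotation θ

theorem rot_apply (θ : ℝ) (z : E × E) :
    rot θ z = (Real.cos θ • z.1 + Real.sin θ • z.2, -Real.sin θ • z.1 + Real.cos θ • z.2) :=
  ContinuousLinearMap.rotation_apply θ z

theorem rot_add (θ φ : ℝ) (z : E × E) : rot θ (rot φ z) = rot (θ + φ) z := by
  simp only [rot_apply, Real.cos_add, Real.sin_add]
  ext1 <;> simp only <;> module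

theorem norm_sq_rot (θ : ℝ) (z : E × E) :
    ‖(rot θ z).1‖ ^ 2 + ‖(rot θ z).2‖ ^ 2 = ‖z.1‖ ^ 2 + ‖z.2‖ ^ 2 := by
  simp only [rot_apply, ← real_inner_self_eq_norm_sq, inner_add_left, inner_add_right,
    real_inner_smul_left, real_inner_smul_right, real_inner_comm z.1 z.2]
  have := Real.sin_sq_add_cos_sq θ
  linear_combination (⟪z.1, z.1⟫ + ⟪z.2, z.2⟫) * this

/-- Conjugation by (x, y) ↦ (x, -y) turns the rotation into its inverse. Its determinant is
therefore its own inverse, hence ±1. -/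
theorem measurePreserving_rot (θ : ℝ) : MeasurePreserving (rot θ : E × E → E × E)
    (μ.prod μ) (μ.prod μ) := by
  have hinv : ((rot θ : E × E →L[ℝ] E × E) : E × E →ₗ[ℝ] E × E) ∘ₗ ((rot (-θ) : E × E →L[ℝ] E × E) : E × E →ₗ[ℝ] E × E) = LinearMap.id := by
    refine LinearMap.ext fun z => ?_
    change rot θ (rot (-θ) z) = z
    rw [rot_add, add_neg_cancel, rot_apply]
    simp
  let S : (E × E) ≃ₗ[ℝ] E × E := (LinearEquiv.refl ℝ E).prodCongr (LinearEquiv.neg ℝ)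
  have hconj : (S : E × E →ₗ[ℝ] E × E) ∘ₗ ((rot θ : E × E →L[ℝ] E × E) : E × E →ₗ[ℝ] E × E) ∘ₗ
      (S.symm : E × E →ₗ[ℝ] E × E) = ((rot (-θ) : E × E →L[ℝ] E × E) : E × E →ₗ[ℝ] E × E) := by
    refine LinearMap.ext fun z => ?_
    have hS : S.symm z = (z.1, -z.2) := rfl
    have hS' : ∀ w, S w = (w.1, -w.2) := fun _ => rfl
    simp [hS, hS', rot_apply, add_comm]
  have hdet : LinearMap.det ((rot θ : E × E →L[ℝ] E × E) : E × E →ₗ[ℝ] E × E) *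
      LinearMap.det ((rot θ : E × E →L[ℝ] E × E) : E × E →ₗ[ℝ] E × E) = 1 := by
    have h := congrArg LinearMap.det hinv
    rwa [LinearMap.det_comp, ← hconj, LinearMap.det_conj, LinearMap.det_id] at h
  have habs : |(LinearMap.det ((rot θ : E × E →L[ℝ] E × E) : E × E →ₗ[ℝ] E × E))⁻¹| = 1 := by
    rw [abs_inv, inv_eq_one]
    have := abs_mul_abs_self (LinearMap.det ((rot θ : E × E →L[ℝ] E × E) : E × E →ₗ[ℝ] E × E))
    rw [hdet] at this
    nlinarith [abs_nonneg (LinearMap.det ((rot θ : E × E →L[ℝ] E × E) : E × E →ₗ[ℝ] E × E))]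
  refine ⟨(rot θ).continuous.measurable, ?_⟩
  have := Measure.map_linearMap_addHaar_eq_smul_addHaar (μ.prod μ)
    (f := ((rot θ : E × E →L[ℝ] E × E) : E × E →ₗ[ℝ] E × E)) (left_ne_zero_of_mul_eq_one hdet)
  rw [habs] at this
  simpa using this

end SphereMeasure

/-! ### Concentration on the sphere through Gaussian rotations. -/

section Concentration

variable {E : Type*} [NormedAddCommGroup E] [InnerProductSpace ℝ E] [FiniteDimensional ℝ E]
  [MeasurableSpace E] [BorelSpace E] [Nontrivial E] (μ : Measure E) [μ.IsAddHaarMeasure]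

theorem integrable_pow_norm_mul_exp (k : ℕ) :
    Integrable (fun x : E => ‖x‖ ^ k * Real.exp (-‖x‖ ^ 2)) μ := by
  refine (integrable_fun_norm_addHaar μ (f := fun r => r ^ k * Real.exp (-r ^ 2))).2 ?_
  have := integrableOn_rpow_mul_exp_neg_mul_sq one_pos
    (s := ((Module.finrank ℝ E - 1 + k : ℕ) : ℝ)) (by
      have : (0 : ℝ) ≤ ((Module.finrank ℝ E - 1 + k : ℕ) : ℝ) := Nat.cast_nonneg _
      linarith)
  refine this.congr_fun (fun r _ => ?_) measurableSet_Ioi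
  simp only [Real.rpow_natCast, pow_add, smul_eq_mul]
  rw [neg_one_mul]; ring

/-- The (unnormalised) Gaussian weight on `E × E`. -/
def gaussWeight (z : E × E) : ℝ := Real.exp (-‖z.1‖ ^ 2) * Real.exp (-‖z.2‖ ^ 2)

theorem gaussWeight_nonneg (z : E × E) : 0 ≤ gaussWeight z := by
  unfold gaussWeight; positivity

theorem continuous_gaussWeight : Continuous (gaussWeight : E × E → ℝ) := by
  unfold gaussWeight; fun_prop

theorem gaussWeight_rot (θ : ℝ) (z : E × E) : gaussWeight (rot θ z) = gaussWeight z := by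
  have := norm_sq_rot θ z
  rw [gaussWeight, gaussWeight, ← Real.exp_add, ← Real.exp_add]
  congr 1
  linarith

/-- Both the product measure and the weight are invariant under rotation. The identity needs no
integrability because the rotation is a measurable embedding. -/
theorem integral_rot_mul_gaussWeight (θ : ℝ) (Φ : E × E → ℝ) :
    ∫ z, Φ (rot θ z) * gaussWeight z ∂μ.prod μ = ∫ z, Φ z * gaussWeight z ∂μ.prod μ := by
  have he : MeasurableEmbedding (rot θ : E × E → E × E) :=
    (ContinuousLinearEquiv.equivOfInverse (rot θ) (rot (-θ))
      (fun z => by rw [rot_add, neg_add_cancel, rot_apply]; simp)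
      (fun z => by rw [rot_add, add_neg_cancel, rot_apply]; simp)
      ).toHomeomorph.measurableEmbedding
  rw [← (measurePreserving_rot μ θ).integral_comp he
    fun z => Φ z * gaussWeight z]
  simp_rw [gaussWeight_rot]

theorem integrable_sq_norm_mul_gaussWeight :
    Integrable (fun z : E × E => (‖z.1‖ ^ 2 + ‖z.2‖ ^ 2) * gaussWeight z) (μ.prod μ) := by
  have h0 := integrable_pow_norm_mul_exp μ 0
  have h2 := integrable_pow_norm_mul_exp μ 2
  refine ((h2.mul_prod h0).add (h0.mul_prod h2)).congr (.of_forall fun z => ?_)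
  simp [gaussWeight]
  ring

theorem norm_rot_fst_sub_le (s : ℝ) (z : E × E) :
    ‖(rot s z).1 - z.1‖ ^ 2 ≤ 2 * s ^ 2 * (‖z.1‖ ^ 2 + ‖z.2‖ ^ 2) := by
  have h1 : (rot s z).1 - z.1 = (Real.cos s - 1) • z.1 + Real.sin s • z.2 := by
    rw [rot_apply]; simp only; module
  have h2 : ‖(rot s z).1 - z.1‖ ≤ |s| * (‖z.1‖ + ‖z.2‖) := by
    rw [h1]
    refine (norm_add_le _ _).trans ?_
    rw [norm_smul, norm_smul, Real.norm_eq_abs, Real.norm_eq_abs, mul_add]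
    have hc : |Real.cos s - 1| ≤ |s| := by
      have := Real.abs_cos_sub_cos_le s 0
      simpa using this
    have hs : |Real.sin s| ≤ |s| := Real.abs_sin_le_abs
    gcongr
  calc ‖(rot s z).1 - z.1‖ ^ 2 ≤ (|s| * (‖z.1‖ + ‖z.2‖)) ^ 2 := by gcongr
    _ = s ^ 2 * (‖z.1‖ + ‖z.2‖) ^ 2 := by rw [mul_pow, sq_abs]
    _ ≤ s ^ 2 * (2 * (‖z.1‖ ^ 2 + ‖z.2‖ ^ 2)) := by
      gcongr
      nlinarith [sq_nonneg (‖z.1‖ - ‖z.2‖)]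
    _ = _ := by ring

variable {μ} in
theorem integrable_mul_gaussWeight {Φ : E × E → ℝ} (hΦ : AEStronglyMeasurable Φ (μ.prod μ)) (C : ℝ)
    (hC : ∀ z, |Φ z| ≤ C * (‖z.1‖ ^ 2 + ‖z.2‖ ^ 2)) :
    Integrable (fun z => Φ z * gaussWeight z) (μ.prod μ) := by
  refine ((integrable_sq_norm_mul_gaussWeight μ).const_mul C).mono'
    (hΦ.mul continuous_gaussWeight.aestronglyMeasurable) (.of_forall fun z => ?_)
  rw [norm_mul, Real.norm_of_nonneg (gaussWeight_nonneg z), ← mul_assoc]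
  exact mul_le_mul_of_nonneg_right (hC z) (gaussWeight_nonneg z)

/-- The energy of the increment of `h` along a rotation by the angle `s`. -/
def rotIncrement (h : E → ℝ) (s : ℝ) : ℝ :=
  ∫ z, (h (rot s z).1 - h z.1) ^ 2 * gaussWeight z ∂μ.prod μ

theorem sq_increment_le {h : E → ℝ} {K : NNReal} (hh : LipschitzWith K h) (s : ℝ) (z : E × E) :
    (h (rot s z).1 - h z.1) ^ 2 ≤ 2 * (K * s) ^ 2 * (‖z.1‖ ^ 2 + ‖z.2‖ ^ 2) := by
  have h1 : |h (rot s z).1 - h z.1| ≤ K * ‖(rot s z).1 - z.1‖ := hh.norm_sub_le _ _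
  calc (h (rot s z).1 - h z.1) ^ 2 = |h (rot s z).1 - h z.1| ^ 2 := (sq_abs _).symm
    _ ≤ (K * ‖(rot s z).1 - z.1‖) ^ 2 := by gcongr
    _ = K ^ 2 * ‖(rot s z).1 - z.1‖ ^ 2 := by ring
    _ ≤ K ^ 2 * (2 * s ^ 2 * (‖z.1‖ ^ 2 + ‖z.2‖ ^ 2)) := by
      gcongr
      exact norm_rot_fst_sub_le s z
    _ = _ := by ring

theorem continuous_rot_fst (s : ℝ) : Continuous fun z : E × E => (rot s z).1 :=
  continuous_fst.comp (rot s).continuous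

/-- Splitting a rotation into `m` equal parts. -/
theorem rotIncrement_le {h : E → ℝ} {K : NNReal} (hh : LipschitzWith K h) (s : ℝ) (m : ℕ) :
    rotIncrement μ h (m * s) ≤ m ^ 2 * rotIncrement μ h s := by
  have hc := hh.continuous
  have hA : ∀ j : ℕ, Integrable (fun z : E × E =>
      (h (rot ((j + 1 : ℕ) * s) z).1 - h (rot (j * s) z).1) ^ 2 * gaussWeight z) (μ.prod μ) ∧
      ∫ z, (h (rot ((j + 1 : ℕ) * s) z).1 - h (rot (j * s) z).1) ^ 2 * gaussWeight z ∂μ.prod μ =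
        rotIncrement μ h s := by
    intro j
    have hrot : ∀ z : E × E, rot ((j + 1 : ℕ) * s) z = rot s (rot (j * s) z) := fun z => by
      rw [rot_add]; congr 1; push_cast; ring_nf
    simp_rw [hrot]
    constructor
    · refine integrable_mul_gaussWeight (Continuous.aestronglyMeasurable ?_) (2 * (K * s) ^ 2)
        fun z => ?_
      · have := (rot (E := E) (j * s)).continuous
        exact ((hc.comp ((continuous_rot_fst s).comp this)).sub
          (hc.comp (continuous_rot_fst _))).pow 2
      · rw [abs_of_nonneg (sq_nonneg _), ← norm_sq_rot (j * s) z]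
        exact sq_increment_le hh s _
    · exact integral_rot_mul_gaussWeight μ (j * s) fun z => (h (rot s z).1 - h z.1) ^ 2
  -- Telescoping along the arc. All m increments have the same energy by rotation invariance, and
  -- Cauchy–Schwarz on the sum costs one further factor m.
  have hsum : ∀ z : E × E, h (rot (m * s) z).1 - h z.1 =
      ∑ j ∈ Finset.range m, (h (rot ((j + 1 : ℕ) * s) z).1 - h (rot (j * s) z).1) := fun z => by
    rw [Finset.sum_range_sub fun j : ℕ => h (rot (j * s) z).1]
    simp [rot_apply]
  calc rotIncrement μ h (m * s)
      ≤ ∫ z, ∑ j ∈ Finset.range m, m *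
        ((h (rot ((j + 1 : ℕ) * s) z).1 - h (rot (j * s) z).1) ^ 2 * gaussWeight z) ∂μ.prod μ := by
        refine integral_mono ?_ (integrable_finsetSum _ fun j _ => (hA j).1.const_mul _) fun z => ?_
        · refine integrable_mul_gaussWeight (Continuous.aestronglyMeasurable ?_)
            (2 * (K * (m * s)) ^ 2) fun z => ?_
          · exact ((hc.comp (continuous_rot_fst _)).sub (hc.comp continuous_fst)).pow 2
          · rw [abs_of_nonneg (sq_nonneg _)]
            exact sq_increment_le hh _ _
        · simp only
          rw [← Finset.mul_sum, ← Finset.sum_mul, ← mul_assoc, hsum]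
          refine mul_le_mul_of_nonneg_right ?_ (gaussWeight_nonneg z)
          simpa using sq_sum_le_card_mul_sum_sq (s := Finset.range m)
            (f := fun j : ℕ => h (rot ((j + 1 : ℕ) * s) z).1 - h (rot (j * s) z).1)
    _ = m ^ 2 * rotIncrement μ h s := by
        rw [integral_finsetSum _ fun j _ => (hA j).1.const_mul _]
        simp only [integral_const_mul, (hA _).2, Finset.sum_const, Finset.card_range, nsmul_eq_mul]
        ring

/-- The integrand is homogeneous of degree two apart from the weight, so it splits in polar
coordinates. The factor 1/d of the concentration bound originates in the angular part. -/
theorem integral_gauss_inner_sq (g : E) :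
    ∫ y, ⟪y, g⟫ ^ 2 * Real.exp (-‖y‖ ^ 2) ∂μ =
      ‖g‖ ^ 2 / Module.finrank ℝ E * ∫ y, ‖y‖ ^ 2 * Real.exp (-‖y‖ ^ 2) ∂μ := by
  have h := integral_radial_mul_angular' μ (fun r => r ^ 2 * Real.exp (-r ^ 2))
    (fun e => ⟪e, g⟫ ^ 2)
  rw [integral_sphereUnif_inner_sq, mul_comm] at h
  rw [← h]
  congr 1 with y
  rcases eq_or_ne y 0 with rfl | hy
  · simp
  · have : ‖y‖ ≠ 0 := norm_ne_zero_iff.2 hy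
    rw [real_inner_smul_left]
    field_simp

/-- The curve s ↦ (rot s z).1 leaves z.1 with velocity z.2. By Rademacher's theorem the difference
quotient converges for almost every z, and the Lipschitz bound on increments dominates. -/
theorem tendsto_rotIncrement {h : E → ℝ} {K : NNReal} (hh : LipschitzWith K h) :
    Tendsto (fun s : ℝ => (s⁻¹) ^ 2 * rotIncrement μ h s) (𝓝[>] 0)
      (𝓝 (∫ z, (fderiv ℝ h z.1 z.2) ^ 2 * gaussWeight z ∂μ.prod μ)) := by
  simp only [rotIncrement, ← integral_const_mul]
  refine tendsto_integral_filter_of_dominated_convergence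
    (fun z => 2 * K ^ 2 * ((‖z.1‖ ^ 2 + ‖z.2‖ ^ 2) * gaussWeight z)) ?_ ?_
    ((integrable_sq_norm_mul_gaussWeight μ).const_mul _) ?_
  · refine .of_forall fun s => Continuous.aestronglyMeasurable ?_
    exact continuous_const.mul ((((hh.continuous.comp (continuous_rot_fst _)).sub
      (hh.continuous.comp continuous_fst)).pow 2).mul continuous_gaussWeight)
  · filter_upwards [self_mem_nhdsWithin] with s hs
    have hs : 0 < s := hs
    refine .of_forall fun z => ?_
    rw [← mul_assoc, norm_mul, Real.norm_of_nonneg (gaussWeight_nonneg z),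
      Real.norm_of_nonneg (by positivity), ← mul_assoc]
    refine mul_le_mul_of_nonneg_right ?_ (gaussWeight_nonneg z)
    calc s⁻¹ ^ 2 * (h (rot s z).1 - h z.1) ^ 2
        ≤ s⁻¹ ^ 2 * (2 * (K * s) ^ 2 * (‖z.1‖ ^ 2 + ‖z.2‖ ^ 2)) := by
          gcongr; exact sq_increment_le hh s z
      _ = _ := by field_simp
  · have : ∀ᵐ z ∂μ.prod μ, DifferentiableAt ℝ h z.1 :=
      Measure.quasiMeasurePreserving_fst.ae hh.ae_differentiableAt
    filter_upwards [this] with z hz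
    have hcurve : HasDerivAt (fun s => (rot s z).1) z.2 0 := by
      simp only [rot_apply]
      have := ((Real.hasDerivAt_cos 0).smul_const z.1).fun_add ((Real.hasDerivAt_sin 0).smul_const z.2)
      simpa using this
    have h0 : (rot 0 z).1 = z.1 := by simp [rot_apply]
    have hd : HasDerivAt (fun s => h (rot s z).1) (fderiv ℝ h z.1 z.2) 0 :=
      HasFDerivAt.comp_hasDerivAt (f := fun s => (rot s z).1) 0 (by rw [h0]; exact hz.hasFDerivAt)
        hcurve
    have := ((hd.tendsto_slope_zero_right).pow 2).mul_const (gaussWeight z)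
    refine this.congr fun s => ?_
    simp only [zero_add, h0, smul_eq_mul, mul_pow]
    ring

/-- The variance of the odd part of a Lipschitz function on the sphere of `ℝ ^ d` is `O(1 / d)`. -/
theorem integral_sphereUnif_sub_neg_sq_le {f : E → ℝ} {K : NNReal}
    (hf : LipschitzOnWith K f (closedBall 0 1)) :
    ∫ e, (f e - f (-e)) ^ 2 ∂sphereUnif μ ≤ 90 * K ^ 2 / Module.finrank ℝ E := by
  have hd : (0 : ℝ) < Module.finrank ℝ E := by exact_mod_cast Module.finrank_pos
  set h := oddExtension f with hh_def
  have hh : LipschitzWith (6 * K) h := lipschitzWith_oddExtension hf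
  set G0 := ∫ x : E, Real.exp (-‖x‖ ^ 2) ∂μ with hG0
  set G2 := ∫ x : E, ‖x‖ ^ 2 * Real.exp (-‖x‖ ^ 2) ∂μ with hG2
  have i0 : Integrable (fun x : E => Real.exp (-‖x‖ ^ 2)) μ := by
    simpa using integrable_pow_norm_mul_exp μ 0
  have i2 := integrable_pow_norm_mul_exp μ 2
  have hG0pos : 0 < G0 := by
    rw [hG0, integral_pos_iff_support_of_nonneg (fun x => (Real.exp_pos _).le) i0]
    simp [Function.support, (Real.exp_pos _).ne']
  have hG2pos : 0 < G2 := by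
    rw [hG2, integral_pos_iff_support_of_nonneg (fun x => by positivity) i2]
    have : (Function.support fun x : E => ‖x‖ ^ 2 * Real.exp (-‖x‖ ^ 2)) = {0}ᶜ := by
      ext x; simp
    rw [this]
    exact isOpen_compl_singleton.measure_pos μ (exists_ne (0 : E))
  set J := ∫ z, (fderiv ℝ h z.1 z.2) ^ 2 * gaussWeight z ∂μ.prod μ with hJ
  -- the limit of the discretised rotation
  have hlim : rotIncrement μ h Real.pi ≤ Real.pi ^ 2 * J := by
    have hs : Tendsto (fun m : ℕ => Real.pi / ((m : ℝ) + 1)) atTop (𝓝[>] 0) := by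
      refine tendsto_nhdsWithin_iff.2 ⟨?_, .of_forall fun m => ?_⟩
      · simpa [div_eq_mul_inv] using
          (tendsto_one_div_add_atTop_nhds_zero_nat (𝕜 := ℝ)).const_mul Real.pi
      · have := Real.pi_pos
        simp only [mem_Ioi]; positivity
    have hT := ((tendsto_rotIncrement μ hh).comp hs).const_mul (Real.pi ^ 2)
    refine ge_of_tendsto' hT fun m => ?_
    have h1 := rotIncrement_le μ hh (Real.pi / ((m : ℝ) + 1)) (m + 1)
    have hm : ((m + 1 : ℕ) : ℝ) * (Real.pi / ((m : ℝ) + 1)) = Real.pi := by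
      push_cast; field_simp
    rw [hm] at h1
    refine h1.trans (le_of_eq ?_)
    have := Real.pi_pos.ne'
    simp only [Function.comp_apply]
    push_cast
    field_simp
  -- bounding the limit
  have hJle : J ≤ (6 * K) ^ 2 / Module.finrank ℝ E * (G0 * G2) := by
    have hbd : ∀ x : E, ‖fderiv ℝ h x‖ ≤ 6 * K := fun x => by
      simpa using norm_fderiv_le_of_lipschitz ℝ hh
    have hmeas : AEStronglyMeasurable (fun z : E × E => (fderiv ℝ h z.1 z.2) ^ 2) (μ.prod μ) := by
      refine ((Measurable.pow_const ?_ 2)).aestronglyMeasurable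
      exact (isBoundedBilinearMap_apply (𝕜 := ℝ) (E := E) (F := ℝ)).continuous.measurable.comp
        (((measurable_fderiv ℝ h).comp measurable_fst).prodMk measurable_snd)
    have hint : Integrable (fun z : E × E => (fderiv ℝ h z.1 z.2) ^ 2 * gaussWeight z)
        (μ.prod μ) := by
      refine integrable_mul_gaussWeight hmeas ((6 * K) ^ 2) fun z => ?_
      rw [abs_of_nonneg (sq_nonneg _), ← sq_abs]
      calc |fderiv ℝ h z.1 z.2| ^ 2 ≤ (6 * K * ‖z.2‖) ^ 2 := by
            gcongr
            exact (ContinuousLinearMap.le_opNorm _ _).trans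
              (mul_le_mul_of_nonneg_right (hbd _) (norm_nonneg _))
        _ ≤ _ := by rw [mul_pow]; gcongr; nlinarith [sq_nonneg ‖z.1‖]
    rw [hJ, integral_prod _ hint]
    have hin : ∀ x : E, ∫ y, (fderiv ℝ h x y) ^ 2 * gaussWeight (x, y) ∂μ ≤
        Real.exp (-‖x‖ ^ 2) * ((6 * K) ^ 2 / Module.finrank ℝ E * G2) := by
      intro x
      have hr : ∀ y, (fderiv ℝ h x y) ^ 2 * gaussWeight (x, y) = Real.exp (-‖x‖ ^ 2) *
          (⟪y, (InnerProductSpace.toDual ℝ E).symm (fderiv ℝ h x)⟫ ^ 2 * Real.exp (-‖y‖ ^ 2)) := by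
        intro y
        rw [real_inner_comm, InnerProductSpace.toDual_symm_apply, gaussWeight]
        ring
      simp_rw [hr]
      rw [integral_const_mul, integral_gauss_inner_sq, LinearIsometryEquiv.norm_map]
      have := hbd x
      gcongr
    calc ∫ x, ∫ y, (fderiv ℝ h x y) ^ 2 * gaussWeight (x, y) ∂μ ∂μ
        ≤ ∫ x, Real.exp (-‖x‖ ^ 2) * ((6 * K) ^ 2 / Module.finrank ℝ E * G2) ∂μ :=
          integral_mono hint.integral_prod_left (i0.mul_const _) hin
      _ = _ := by rw [integral_mul_const]; ring
  -- the left-hand side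
  have hleft : rotIncrement μ h Real.pi =
      4 * (G0 * (G2 * ∫ e, (f e - f (-e)) ^ 2 ∂sphereUnif μ)) := by
    have h1 : ∀ z : E × E, (h (rot Real.pi z).1 - h z.1) ^ 2 * gaussWeight z =
        (4 * (h z.1 ^ 2 * Real.exp (-‖z.1‖ ^ 2))) * Real.exp (-‖z.2‖ ^ 2) := by
      intro z
      -- Since h is odd, its increment over the half turn is -2h, which is where the factor 4 comes
      -- from.
      have : (rot Real.pi z).1 = -z.1 := by simp [rot_apply]
      rw [this, hh_def, oddExtension_neg, gaussWeight]
      ring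
    have h2 : ∫ x, h x ^ 2 * Real.exp (-‖x‖ ^ 2) ∂μ =
        G2 * ∫ e, (f e - f (-e)) ^ 2 ∂sphereUnif μ := by
      rw [← integral_radial_mul_angular' μ (fun r => r ^ 2 * Real.exp (-r ^ 2))]
      congr 1 with x
      rw [hh_def, oddExtension]
      ring
    rw [rotIncrement]
    simp_rw [h1]
    rw [integral_prod_mul (fun x : E => 4 * (h x ^ 2 * Real.exp (-‖x‖ ^ 2)))
      (fun y : E => Real.exp (-‖y‖ ^ 2)), integral_const_mul, h2]
    ring
  set V := ∫ e, (f e - f (-e)) ^ 2 ∂sphereUnif μ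
  -- With π² ≤ 10 the inequality reads 4V ≤ 10 · 36 K²/d, that is V ≤ 90 K²/d.
  have hpi : Real.pi ^ 2 ≤ 10 := by nlinarith [Real.pi_lt_d2, Real.pi_pos]
  have hGG : 0 < G0 * G2 := by positivity
  have hfin : 4 * V * (G0 * G2) ≤ (10 * ((6 * K) ^ 2 / Module.finrank ℝ E)) * (G0 * G2) := by
    calc 4 * V * (G0 * G2) = rotIncrement μ h Real.pi := by rw [hleft]; ring
      _ ≤ Real.pi ^ 2 * J := hlim
      _ ≤ Real.pi ^ 2 * ((6 * K) ^ 2 / Module.finrank ℝ E * (G0 * G2)) := by gcongr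
      _ ≤ 10 * ((6 * K) ^ 2 / Module.finrank ℝ E * (G0 * G2)) := by gcongr
      _ = _ := by ring
  have := le_of_mul_le_mul_right hfin hGG
  rw [mul_div_assoc]
  rw [mul_pow, mul_div_assoc] at this
  linarith

end Concentration

/-! ### Convex analysis: first-order inequalities, co-coercivity, Lipschitz extension. -/

section ConvexAnalysis

variable {E : Type*} [NormedAddCommGroup E] [InnerProductSpace ℝ E]

theorem hasDerivAt_line_of_hasGradientAt [CompleteSpace E] {f : E → ℝ} {G : E} {x v : E} {t : ℝ}
    (h : HasGradientAt f G (x + t • v)) : HasDerivAt (fun s : ℝ => f (x + s • v)) ⟪G, v⟫ t := by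
  have h1 : HasDerivAt (fun s : ℝ => x + s • v) v t := by
    simpa using ((hasDerivAt_id t).smul_const v).const_add x
  have h2 := HasFDerivAt.comp_hasDerivAt t h.hasFDerivAt h1
  rw [InnerProductSpace.toDual_apply_apply] at h2
  exact h2

/-- The first-order inequality for a strongly convex function. -/
theorem strongConvex_first_order [CompleteSpace E] {f : E → ℝ} {m : ℝ}
    (hf : StrongConvexOn univ m f) {G x : E} (hG : HasGradientAt f G x) (y : E) :
    f x + ⟪G, y - x⟫ + m / 2 * ‖y - x‖ ^ 2 ≤ f y := by
  have hd : HasDerivAt (fun s : ℝ => f (x + s • (y - x))) ⟪G, y - x⟫ 0 :=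
    hasDerivAt_line_of_hasGradientAt (by simpa using hG)
  have h1 := hd.tendsto_slope_zero_right
  have h2 : Tendsto (fun t : ℝ => f y - f x - (1 - t) * (m / 2 * ‖y - x‖ ^ 2)) (𝓝[>] 0)
      (𝓝 (f y - f x - (1 - 0) * (m / 2 * ‖y - x‖ ^ 2))) :=
    Tendsto.mono_left (Continuous.tendsto (by fun_prop) _) nhdsWithin_le_nhds
  have := le_of_tendsto_of_tendsto h1 h2 ?_
  · linarith
  · filter_upwards [Ioo_mem_nhdsGT one_pos] with t ht
    have h3 := hf.2 (mem_univ x) (mem_univ y) (sub_nonneg.2 ht.2.le) ht.1.le (by ring)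
    have h4 : (1 - t) • x + t • y = x + t • (y - x) := by module
    rw [h4, norm_sub_rev] at h3
    simp only [smul_eq_mul, zero_add, zero_smul, add_zero] at h3 ⊢
    rw [inv_mul_le_iff₀ ht.1]
    linarith

/-- The descent lemma. -/
theorem le_of_lipschitz_gradient [CompleteSpace E] {f : E → ℝ} {G : E → E} {L : ℝ}
    (hG : ∀ x, HasGradientAt f (G x) x) (hL : ∀ x y, ‖G x - G y‖ ≤ L * ‖x - y‖) (x y : E) :
    f y ≤ f x + ⟪G x, y - x⟫ + L / 2 * ‖y - x‖ ^ 2 := by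
  set v := y - x
  have hd : ∀ t : ℝ, HasDerivAt
      (fun s : ℝ => f (x + s • v) - s * ⟪G x, v⟫ - L / 2 * ‖v‖ ^ 2 * s ^ 2)
      (⟪G (x + t • v), v⟫ - ⟪G x, v⟫ - L * t * ‖v‖ ^ 2) t := by
    intro t
    have h1 := hasDerivAt_line_of_hasGradientAt (v := v) (hG (x + t • v))
    have h2 := (h1.fun_sub ((hasDerivAt_id t).mul_const ⟪G x, v⟫)).fun_sub
      (((hasDerivAt_id t).pow 2).const_mul (L / 2 * ‖v‖ ^ 2))
    refine h2.congr_deriv ?_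
    simp; ring
  have hanti : AntitoneOn
      (fun s : ℝ => f (x + s • v) - s * ⟪G x, v⟫ - L / 2 * ‖v‖ ^ 2 * s ^ 2) (Icc 0 1) := by
    refine antitoneOn_of_deriv_nonpos (convex_Icc 0 1)
      (fun t _ => (hd t).continuousAt.continuousWithinAt)
      (fun t _ => (hd t).differentiableAt.differentiableWithinAt) fun t ht => ?_
    rw [interior_Icc] at ht
    rw [(hd t).deriv, ← inner_sub_left]
    have h1 := real_inner_le_norm (G (x + t • v) - G x) v
    have h2 := hL (x + t • v) x
    rw [add_sub_cancel_left, norm_smul, Real.norm_of_nonneg ht.1.le] at h2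
    nlinarith [mul_le_mul_of_nonneg_right h2 (norm_nonneg v)]
  have := hanti (left_mem_Icc.2 zero_le_one) (right_mem_Icc.2 zero_le_one) zero_le_one
  simp only [one_smul, zero_smul, add_zero, one_mul, zero_mul, sub_zero] at this
  have hv : x + v = y := by simp [v]
  rw [hv] at this
  norm_num at this
  linarith

/-- Co-coercivity of the gradient of a smooth convex function. -/
theorem norm_sub_gradient_sq_le [CompleteSpace E] {f : E → ℝ} {G : E → E} {L : ℝ} (hL0 : 0 < L)
    (hf : ConvexOn ℝ univ f) (hG : ∀ x, HasGradientAt f (G x) x)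
    (hL : ∀ x y, ‖G x - G y‖ ≤ L * ‖x - y‖) (x y : E) :
    ‖G x - G y‖ ^ 2 ≤ 2 * L * (f x - f y - ⟪G y, x - y⟫) := by
  set q := G x - G y
  -- The trial point minimises the quadratic upper model at x after subtracting the tangent at y. It
  -- may leave any given convex set, which is why a globally smooth f is required.
  have h1 := le_of_lipschitz_gradient hG hL x (x - L⁻¹ • q)
  have h2 := strongConvex_first_order (strongConvexOn_zero.2 hf) (hG y) (x - L⁻¹ • q)
  have h3 : x - L⁻¹ • q - x = -(L⁻¹ • q) := by abel
  have h4 : x - L⁻¹ • q - y = (x - y) - L⁻¹ • q := by abel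
  rw [h3, norm_neg, norm_smul, inner_neg_right, real_inner_smul_right, mul_pow, norm_inv,
    Real.norm_of_nonneg hL0.le] at h1
  rw [h4, inner_sub_right, real_inner_smul_right] at h2
  have h5 : ⟪G x, q⟫ - ⟪G y, q⟫ = ‖q‖ ^ 2 := by
    rw [← inner_sub_left, real_inner_self_eq_norm_sq]
  have h6 : L / 2 * (L⁻¹ ^ 2 * ‖q‖ ^ 2) = L⁻¹ * ‖q‖ ^ 2 / 2 := by field_simp
  have h7 : L⁻¹ * ‖q‖ ^ 2 / 2 ≤ f x - f y - ⟪G y, x - y⟫ := by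
    rw [h6] at h1
    rw [← h5] at h1 ⊢
    linarith
  calc ‖q‖ ^ 2 = 2 * L * (L⁻¹ * ‖q‖ ^ 2 / 2) := by field_simp
    _ ≤ _ := by gcongr

/-- A convex function which is Lipschitz on a convex set agrees there with a convex function which
is Lipschitz everywhere. -/
theorem exists_convex_lipschitz_extension {f : E → ℝ} {S : Set E} {M : NNReal}
    (hS : S.Nonempty) (hf : ConvexOn ℝ S f) (hM : LipschitzOnWith M f S) :
    ∃ g : E → ℝ, LipschitzWith M g ∧ ConvexOn ℝ univ g ∧ EqOn f g S := by
  have : Nonempty S := hS.to_subtype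
  obtain ⟨z, hz⟩ := hS
  have hfM : ∀ a ∈ S, ∀ b ∈ S, f a ≤ f b + M * ‖a - b‖ := fun a ha b hb => by
    have := hM.norm_sub_le ha hb
    linarith [(le_abs_self (f a - f b)).trans this]
  have hbdd : ∀ x : E, BddBelow (range fun y : S => f y + M * ‖x - y‖) := by
    intro x
    refine ⟨f z - M * ‖x - z‖, ?_⟩
    rintro _ ⟨y, rfl⟩
    have h1 := hfM z hz y y.2
    have h2 : ‖z - y‖ ≤ ‖x - z‖ + ‖x - (y : E)‖ := by
      rw [norm_sub_rev x z]; simpa using norm_sub_le_norm_sub_add_norm_sub z x (y : E)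
    simp only
    nlinarith [mul_le_mul_of_nonneg_left h2 M.2]
  -- The McShane extension. Being the infimal convolution of two convex functions, it stays convex.
  refine ⟨fun x => ⨅ y : S, (f y + M * ‖x - y‖), ?_, ⟨convex_univ, ?_⟩, ?_⟩
  · refine LipschitzWith.of_le_add_mul M fun x y => ?_
    rw [← sub_le_iff_le_add]
    refine le_ciInf fun s => ?_
    rw [sub_le_iff_le_add]
    refine (ciInf_le (hbdd x) s).trans ?_
    have : ‖x - s‖ ≤ ‖y - s‖ + dist x y := by
      rw [dist_eq_norm, add_comm]; exact norm_sub_le_norm_sub_add_norm_sub x y s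
    nlinarith [mul_le_mul_of_nonneg_left this M.2]
  · intro x _ y _ a b ha hb hab
    simp only [smul_eq_mul]
    rw [Real.mul_iInf_of_nonneg ha, Real.mul_iInf_of_nonneg hb]
    refine le_ciInf_add_ciInf fun s t => ?_
    have hst : a • (s : E) + b • (t : E) ∈ S := hf.1 s.2 t.2 ha hb hab
    refine (ciInf_le (hbdd _) ⟨_, hst⟩).trans ?_
    have h1 := hf.2 s.2 t.2 ha hb hab
    have h2 : ‖a • x + b • y - (a • (s : E) + b • (t : E))‖ ≤ a * ‖x - s‖ + b * ‖y - t‖ := by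
      have : a • x + b • y - (a • (s : E) + b • (t : E)) = a • (x - s) + b • (y - t) := by module
      rw [this]
      refine (norm_add_le _ _).trans ?_
      rw [norm_smul, norm_smul, Real.norm_of_nonneg ha, Real.norm_of_nonneg hb]
    simp only [smul_eq_mul] at h1 ⊢
    nlinarith [mul_le_mul_of_nonneg_left h2 M.2]
  · intro x hx
    refine le_antisymm (le_ciInf fun s => hfM x hx s s.2) ?_
    refine (ciInf_le (hbdd x) ⟨x, hx⟩).trans ?_
    simp

end ConvexAnalysis

/-! ### Averages over balls: gradient, smoothness, strong convexity, comparison. -/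

section Smoothing

variable {E : Type*} [NormedAddCommGroup E] [InnerProductSpace ℝ E] [FiniteDimensional ℝ E]
  [MeasurableSpace E] [BorelSpace E] [Nontrivial E] (μ : Measure E) [μ.IsAddHaarMeasure]

/-- The average of `f` over the ball of radius `γ` around `x`. -/
def ballSmooth (f : E → ℝ) (γ : ℝ) (x : E) : ℝ := ∫ u, f (x + γ • u) ∂ballUnif μ

/-- The gradient of the ball average, as an average over the sphere. -/
def sphereGrad (f : E → ℝ) (γ : ℝ) (x : E) : E :=
  (Module.finrank ℝ E / γ) • ∫ e, f (x + γ • e) • e ∂sphereUnif μ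

theorem inner_sphereGrad {f : E → ℝ} (hf : Continuous f) (γ : ℝ) (x v : E) :
    ⟪sphereGrad μ f γ x, v⟫ =
      Module.finrank ℝ E / γ * ∫ e, f (x + γ • e) * ⟪e, v⟫ ∂sphereUnif μ := by
  rw [sphereGrad, real_inner_smul_left, real_inner_comm, ← integral_inner]
  · simp only [real_inner_smul_right, real_inner_comm]
  · exact integrable_sphereUnif_of_continuous μ (by fun_prop)

/-- Differentiation under the integral sign is licensed by Rademacher's theorem, as a Lipschitz
integrand needs a derivative only for almost every u. The divergence theorem then replaces the
average of the derivative over the ball by the average over the sphere. -/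
theorem hasGradientAt_ballSmooth_of_lipschitz {f : E → ℝ} {C : NNReal} (hf : LipschitzWith C f)
    {γ : ℝ} (hγ : 0 < γ) (x : E) : HasGradientAt (ballSmooth μ f γ) (sphereGrad μ f γ x) x := by
  set φ : E → ℝ := fun u => f (x + γ • u) with hφ
  have hφL : LipschitzWith (C * ⟨γ, hγ.le⟩) φ := by
    refine hf.comp (LipschitzWith.of_dist_le_mul fun a b => ?_)
    rw [dist_add_left, dist_smul₀, Real.norm_of_nonneg hγ.le]; rfl
  have hae : ∀ᵐ u ∂ballUnif μ, DifferentiableAt ℝ φ u :=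
    (ballUnif_absolutelyContinuous μ).ae_le hφL.ae_differentiableAt
  have hcont : ∀ y : E, Continuous fun u => f (y + γ • u) := fun y =>
    hf.continuous.comp (by fun_prop)
  obtain ⟨hint, hder⟩ := hasFDerivAt_integral_of_dominated_loc_of_lip (μ := ballUnif μ)
    (F := fun y u => f (y + γ • u)) (F' := fun u => γ⁻¹ • fderiv ℝ φ u) (x₀ := x)
    (bound := fun _ => C) (s := univ) univ_mem
    (.of_forall fun y => (hcont y).aestronglyMeasurable)
    (integrable_ballUnif_of_continuous μ (hcont x))
    ((measurable_fderiv ℝ φ).const_smul γ⁻¹).aestronglyMeasurable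
    (.of_forall fun u => by
      rw [lipschitzOnWith_univ]
      refine LipschitzWith.of_dist_le_mul fun a b => ?_
      simpa using hf.dist_le_mul (a + γ • u) (b + γ • u))
    (integrable_const _)
    (by
      filter_upwards [hae] with u hu
      -- A shift of the centre y is rewritten as a shift of the variable u, so that
      -- differentiability of φ at u yields differentiability in y at x.
      have h1 : HasFDerivAt (fun y : E => u + γ⁻¹ • (y - x))
          (γ⁻¹ • ContinuousLinearMap.id ℝ E) x :=
        (((hasFDerivAt_id x).sub_const x).const_smul γ⁻¹).const_add u
      have h2 : HasFDerivAt φ (fderiv ℝ φ u) (u + γ⁻¹ • (x - x)) := by simpa using hu.hasFDerivAt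
      have h3 := h2.comp x h1
      have h4 : (φ ∘ fun y : E => u + γ⁻¹ • (y - x)) = fun y => f (y + γ • u) := by
        ext y
        simp only [hφ, Function.comp_apply]
        congr 1
        rw [smul_add, smul_smul, mul_inv_cancel₀ hγ.ne', one_smul]
        abel
      rw [h4] at h3
      convert h3 using 1
      ext v
      simp)
  rw [hasGradientAt_iff_hasFDerivAt]
  refine hder.congr_fderiv ?_
  ext v
  symm
  rw [InnerProductSpace.toDual_apply_apply, inner_sphereGrad μ hf.continuous,
    ContinuousLinearMap.integral_apply hint]
  have h5 : ∫ u, (γ⁻¹ • fderiv ℝ φ u) v ∂ballUnif μ = γ⁻¹ * ∫ u, lineDeriv ℝ φ u v ∂ballUnif μ := by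
    rw [← integral_const_mul]
    refine integral_congr_ae ?_
    filter_upwards [hae] with u hu
    simp [hu.lineDeriv_eq_fderiv]
  rw [h5, integral_ballUnif_lineDeriv μ hφL]
  simp only [hφ, mul_comm ⟪_, v⟫]
  ring

/-- The average of a convex function over balls is differentiable. -/
theorem hasGradientAt_ballSmooth {f : E → ℝ} (hf : LocallyLipschitz f) {γ : ℝ} (hγ : 0 < γ)
    (x : E) : HasGradientAt (ballSmooth μ f γ) (sphereGrad μ f γ x) x := by
  obtain ⟨K, hK⟩ := (hf.locallyLipschitzOn (s := closedBall x (γ + 1))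
    ).exists_lipschitzOnWith_of_compact (isCompact_closedBall x (γ + 1))
  -- Near x both sides see only the values of f on the ball of radius γ + 1, so f may be replaced by
  -- a globally Lipschitz function.
  obtain ⟨g, hg, hfg⟩ := hK.extend_real
  have h := hasGradientAt_ballSmooth_of_lipschitz μ hg hγ x
  have hS : sphereGrad μ f γ x = sphereGrad μ g γ x := by
    rw [sphereGrad, sphereGrad]
    congr 1
    refine integral_congr_ae ?_
    filter_upwards [ae_norm_eq_one_sphereUnif μ] with e he
    rw [hfg]
    rw [mem_closedBall, dist_self_add_left, norm_smul, he, Real.norm_of_nonneg hγ.le]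
    linarith
  have hB : ballSmooth μ f γ =ᶠ[𝓝 x] ballSmooth μ g γ := by
    filter_upwards [closedBall_mem_nhds x one_pos] with y hy
    refine integral_congr_ae ?_
    filter_upwards [ae_mem_closedBall_ballUnif μ] with u hu
    rw [hfg]
    rw [mem_closedBall] at hy ⊢
    refine (dist_triangle _ y _).trans ?_
    rw [dist_self_add_left, norm_smul, Real.norm_of_nonneg hγ.le]
    rw [mem_closedBall_zero_iff] at hu
    nlinarith
  rw [hS, hasGradientAt_iff_hasFDerivAt]
  exact (hasGradientAt_iff_hasFDerivAt.1 h).congr_of_eventuallyEq hB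

/-- Nonnegativity of a variance bounds the first absolute moment by the root of the second. This is
what makes the smoothness constant grow like √d instead of d. -/
theorem integral_sphereUnif_abs_inner_le (v : E) :
    ∫ e, |⟪e, v⟫| ∂sphereUnif μ ≤ ‖v‖ / √(Module.finrank ℝ E) := by
  have hd : (0 : ℝ) < Module.finrank ℝ E := by exact_mod_cast Module.finrank_pos
  have h1 : Integrable (fun e => |⟪e, v⟫|) (sphereUnif μ) :=
    integrable_sphereUnif_of_continuous μ (by fun_prop)
  have h2 : Integrable (fun e => |⟪e, v⟫| ^ 2) (sphereUnif μ) :=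
    integrable_sphereUnif_of_continuous μ (by fun_prop)
  have h3 : (∫ e, |⟪e, v⟫| ∂sphereUnif μ) ^ 2 ≤ ‖v‖ ^ 2 / Module.finrank ℝ E := by
    have h4 := integral_sphereUnif_inner_sq μ v
    simp_rw [← sq_abs ⟪_, v⟫] at h4
    rw [← h4]
    set a := ∫ e, |⟪e, v⟫| ∂sphereUnif μ with ha
    have h5 : 0 ≤ ∫ e, (|⟪e, v⟫| - a) ^ 2 ∂sphereUnif μ := integral_nonneg fun e => sq_nonneg _
    have h6 : ∀ e : E, (|⟪e, v⟫| - a) ^ 2 = |⟪e, v⟫| ^ 2 - 2 * a * |⟪e, v⟫| + a ^ 2 := fun e => by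
      ring
    simp_rw [h6] at h5
    rw [integral_add (f := fun e => |⟪e, v⟫| ^ 2 - 2 * a * |⟪e, v⟫|) (h2.sub (h1.const_mul _))
      (integrable_const _),
      integral_sub h2 (h1.const_mul _), integral_const_mul, ← ha] at h5
    simp at h5 ⊢
    linarith
  have h7 : ‖v‖ ^ 2 / Module.finrank ℝ E = (‖v‖ / √(Module.finrank ℝ E)) ^ 2 := by
    rw [div_pow, Real.sq_sqrt hd.le]
  rw [h7] at h3
  exact le_of_sq_le_sq h3 (by positivity)

/-- The gradient of the ball average of an `M`-Lipschitz function is Lipschitz with constant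
`√d M / γ`. -/
theorem norm_sphereGrad_sub_le {f : E → ℝ} (hf : Continuous f) {γ M : ℝ} (hγ : 0 < γ) {x y : E}
    (hM : ∀ e : E, ‖e‖ = 1 → |f (x + γ • e) - f (y + γ • e)| ≤ M * ‖x - y‖) :
    ‖sphereGrad μ f γ x - sphereGrad μ f γ y‖ ≤ √(Module.finrank ℝ E) * M / γ * ‖x - y‖ := by
  have hd : (0 : ℝ) < Module.finrank ℝ E := by exact_mod_cast Module.finrank_pos
  set d : ℝ := (Module.finrank ℝ E : ℝ)
  set v := sphereGrad μ f γ x - sphereGrad μ f γ y with hv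
  have hMxy : 0 ≤ M * ‖x - y‖ := by
    obtain ⟨e, he⟩ := exists_norm_eq E zero_le_one
    exact (abs_nonneg _).trans (hM e he)
  have h1 : ‖v‖ ^ 2 ≤ d / γ * (M * ‖x - y‖ * (‖v‖ / √d)) := by
    have hi : ∀ z : E, Integrable (fun e => f (z + γ • e) * ⟪e, v⟫) (sphereUnif μ) := fun z =>
      integrable_sphereUnif_of_continuous μ (by fun_prop)
    have : ‖v‖ ^ 2 = d / γ * ∫ e, (f (x + γ • e) - f (y + γ • e)) * ⟪e, v⟫ ∂sphereUnif μ := by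
      rw [← real_inner_self_eq_norm_sq]
      nth_rw 1 [hv]
      rw [inner_sub_left, inner_sphereGrad μ hf, inner_sphereGrad μ hf, ← mul_sub,
        ← integral_sub (hi x) (hi y)]
      simp only [sub_mul]; rfl
    rw [this]
    refine mul_le_mul_of_nonneg_left ?_ (by positivity)
    calc ∫ e, (f (x + γ • e) - f (y + γ • e)) * ⟪e, v⟫ ∂sphereUnif μ
        ≤ ∫ e, M * ‖x - y‖ * |⟪e, v⟫| ∂sphereUnif μ := by
          refine integral_mono_ae ?_ ?_ ?_
          · exact integrable_sphereUnif_of_continuous μ (by fun_prop)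
          · exact integrable_sphereUnif_of_continuous μ (by fun_prop)
          · filter_upwards [ae_norm_eq_one_sphereUnif μ] with e he
            refine (le_abs_self _).trans ?_
            rw [abs_mul]
            exact mul_le_mul_of_nonneg_right (hM e he) (abs_nonneg _)
      _ = M * ‖x - y‖ * ∫ e, |⟪e, v⟫| ∂sphereUnif μ := integral_const_mul _ _
      _ ≤ _ := mul_le_mul_of_nonneg_left (integral_sphereUnif_abs_inner_le μ v) hMxy
  have hsq : √d * √d = d := Real.mul_self_sqrt hd.le
  have hsp : 0 < √d := Real.sqrt_pos.2 hd
  have h2 : d / γ * (M * ‖x - y‖ * (‖v‖ / √d)) = (√d * M / γ * ‖x - y‖) * ‖v‖ :=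
    calc d / γ * (M * ‖x - y‖ * (‖v‖ / √d)) = √d * √d / γ * (M * ‖x - y‖ * (‖v‖ / √d)) := by
          rw [hsq]
      _ = _ := by field_simp
  rw [h2, sq] at h1
  rcases (norm_nonneg v).eq_or_lt with h0 | h0
  · rw [← h0]
    have : √d * M / γ * ‖x - y‖ = √d / γ * (M * ‖x - y‖) := by ring
    rw [this]; positivity
  · exact le_of_mul_le_mul_right h1 h0

theorem strongConvexOn_ballSmooth {f : E → ℝ} {m : ℝ} (hf : StrongConvexOn univ m f)
    (hc : Continuous f) (γ : ℝ) : StrongConvexOn univ m (ballSmooth μ f γ) := by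
  refine ⟨convex_univ, fun x _ y _ a b ha hb hab => ?_⟩
  have hi : ∀ z : E, Integrable (fun u => f (z + γ • u)) (ballUnif μ) := fun z =>
    integrable_ballUnif_of_continuous μ (by fun_prop)
  simp only [ballSmooth, smul_eq_mul]
  rw [← integral_const_mul, ← integral_const_mul, ← integral_add ((hi x).const_mul a)
    ((hi y).const_mul b)]
  have hcst : a * b * (m / 2 * ‖x - y‖ ^ 2) =
      ∫ _, a * b * (m / 2 * ‖x - y‖ ^ 2) ∂ballUnif μ := by simp
  rw [hcst, ← integral_sub (f := fun u => a * f (x + γ • u) + b * f (y + γ • u)) (((hi x).const_mul a).add ((hi y).const_mul b)) (integrable_const _)]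
  refine integral_mono (hi _) ((((hi x).const_mul a).add ((hi y).const_mul b)).sub
    (integrable_const _)) fun u => ?_
  have h1 := hf.2 (mem_univ (x + γ • u)) (mem_univ (y + γ • u)) ha hb hab
  have h2 : a • (x + γ • u) + b • (y + γ • u) = a • x + b • y + γ • u := by
    have : γ • u = (a + b) • γ • u := by rw [hab, one_smul]
    nth_rw 3 [this]
    module
  rw [h2, add_sub_add_right_eq_sub] at h1
  simpa using h1

/-- By symmetry of the ball the points x + γu and x - γu may be averaged, and x is their midpoint.
-/
theorem le_ballSmooth {f : E → ℝ} (hf : ConvexOn ℝ univ f) (hc : Continuous f) (γ : ℝ) (x : E) :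
    f x ≤ ballSmooth μ f γ x := by
  have hi : Integrable (fun u => f (x + γ • u)) (ballUnif μ) :=
    integrable_ballUnif_of_continuous μ (by fun_prop)
  have hi' : Integrable (fun u => f (x + γ • -u)) (ballUnif μ) :=
    integrable_ballUnif_of_continuous μ (by fun_prop)
  have h1 : ∫ u, (f (x + γ • u) + f (x + γ • -u)) / 2 ∂ballUnif μ = ballSmooth μ f γ x := by
    rw [integral_div, integral_add hi hi', integral_ballUnif_neg μ fun u => f (x + γ • u),
      ballSmooth]
    ring
  rw [← h1]
  have h2 : f x = ∫ _, f x ∂ballUnif μ := by simp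
  rw [h2]
  refine integral_mono (integrable_const _) ((hi.add hi').div_const 2) fun u => ?_
  have := hf.2 (mem_univ (x + γ • u)) (mem_univ (x + γ • -u)) 
    (by norm_num : (0 : ℝ) ≤ 1 / 2) (by norm_num : (0 : ℝ) ≤ 1 / 2) (by norm_num)
  have h3 : (1 / 2 : ℝ) • (x + γ • u) + (1 / 2 : ℝ) • (x + γ • -u) = x := by module
  rw [h3] at this
  simp only [smul_eq_mul] at this ⊢
  linarith

theorem ballSmooth_sub_le {f : E → ℝ} (hc : Continuous f) {γ x y C}
    (h : ∀ u : E, ‖u‖ ≤ 1 → f (x + γ • u) - f (y + γ • u) ≤ C) :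
    ballSmooth μ f γ x - ballSmooth μ f γ y ≤ C := by
  have hi : ∀ z : E, Integrable (fun u => f (z + γ • u)) (ballUnif μ) := fun z =>
    integrable_ballUnif_of_continuous μ (by fun_prop)
  rw [ballSmooth, ballSmooth, ← integral_sub (hi x) (hi y)]
  have h2 : C = ∫ _, C ∂ballUnif μ := by simp
  rw [h2]
  refine integral_mono_ae ((hi x).sub (hi y)) (integrable_const _) ?_
  filter_upwards [ae_mem_closedBall_ballUnif μ] with u hu
  exact h u (by simpa using hu)

theorem ballSmooth_le {f : E → ℝ} (hc : Continuous f) {γ x C}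
    (h : ∀ u : E, ‖u‖ ≤ 1 → f (x + γ • u) ≤ C) : ballSmooth μ f γ x ≤ C := by
  have h2 : C = ∫ _, C ∂ballUnif μ := by simp
  rw [ballSmooth, h2]
  refine integral_mono_ae (integrable_ballUnif_of_continuous μ (by fun_prop))
    (integrable_const _) ?_
  filter_upwards [ae_mem_closedBall_ballUnif μ] with u hu
  exact h u (by simpa using hu)

end Smoothing

/-! ### Smoothing when the Lipschitz condition holds only near a convex set. -/

section SmoothingOnSet

variable {E : Type*} [NormedAddCommGroup E] [InnerProductSpace ℝ E] [FiniteDimensional ℝ E]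
  [MeasurableSpace E] [BorelSpace E] [Nontrivial E] (μ : Measure E) [μ.IsAddHaarMeasure]

theorem locallyLipschitz_of_strongConvexOn {f : E → ℝ} {m : ℝ} (hm : 0 < m)
    (hf : StrongConvexOn univ m f) : LocallyLipschitz f :=
  locallyLipschitzOn_univ.1 ((hf.strictConvexOn hm).convexOn.locallyLipschitzOn isOpen_univ)

theorem add_smul_mem_add_closedBall {Q : Set E} {γ : ℝ} (hγ : 0 < γ) {x u : E} (hx : x ∈ Q)
    (hu : ‖u‖ ≤ 1) : x + γ • u ∈ Q + closedBall (0 : E) γ := by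
  refine add_mem_add hx ?_
  rw [mem_closedBall_zero_iff, norm_smul, Real.norm_of_nonneg hγ.le]
  exact mul_le_of_le_one_right hγ.le hu

/-- On a convex set near which `f` is `M`-Lipschitz, the ball average of `f` agrees up to first
order with that of a globally Lipschitz convex function. -/
theorem exists_global_ballSmooth {f : E → ℝ} {Q : Set E} {M γ : ℝ} (hγ : 0 < γ) (hM0 : 0 ≤ M)
    (hf : ConvexOn ℝ univ f) (hQ : Convex ℝ Q) (hQne : Q.Nonempty)
    (hLip : ∀ x ∈ Q + closedBall 0 γ, ∀ y ∈ Q + closedBall 0 γ, |f y - f x| ≤ M * ‖y - x‖) :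
    ∃ (F : E → ℝ) (G : E → E), ConvexOn ℝ univ F ∧ (∀ x, HasGradientAt F (G x) x) ∧
      (∀ x y, ‖G x - G y‖ ≤ √(Module.finrank ℝ E) * M / γ * ‖x - y‖) ∧
      (∀ x ∈ Q, F x = ballSmooth μ f γ x) ∧ ∀ x ∈ Q, G x = sphereGrad μ f γ x := by
  have hS : Convex ℝ (Q + closedBall (0 : E) γ) := hQ.add (convex_closedBall 0 γ)
  have hne : (Q + closedBall (0 : E) γ).Nonempty :=
    hQne.add ⟨0, mem_closedBall_self hγ.le⟩
  obtain ⟨g, hg, hgc, hfg⟩ := exists_convex_lipschitz_extension (M := M.toNNReal) hne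
    (hf.subset (subset_univ _) hS) (LipschitzOnWith.of_dist_le_mul fun x hx y hy => by
      rw [Real.coe_toNNReal _ hM0, Real.dist_eq, dist_eq_norm]
      exact hLip y hy x hx)
  refine ⟨ballSmooth μ g γ, sphereGrad μ g γ, ?_,
    hasGradientAt_ballSmooth_of_lipschitz μ hg hγ, fun x y => ?_, fun x hx => ?_, fun x hx => ?_⟩
  · exact strongConvexOn_zero.1 (strongConvexOn_ballSmooth μ (strongConvexOn_zero.2 hgc)
      hg.continuous γ)
  · refine norm_sphereGrad_sub_le μ hg.continuous hγ fun e _ => ?_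
    have := hg.norm_sub_le (x + γ • e) (y + γ • e)
    rwa [Real.coe_toNNReal _ hM0, add_sub_add_right_eq_sub] at this
  · refine integral_congr_ae ?_
    filter_upwards [ae_mem_closedBall_ballUnif μ] with u hu
    exact (hfg (add_smul_mem_add_closedBall hγ hx (by simpa using hu))).symm
  · rw [sphereGrad, sphereGrad]
    congr 1
    refine integral_congr_ae ?_
    filter_upwards [ae_norm_eq_one_sphereUnif μ] with u hu
    rw [hfg (add_smul_mem_add_closedBall hγ hx hu.le)]

theorem ballSmooth_descent {f : E → ℝ} {Q : Set E} {M γ : ℝ} (hγ : 0 < γ) (hM0 : 0 ≤ M)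
    (hf : ConvexOn ℝ univ f) (hQ : Convex ℝ Q)
    (hLip : ∀ x ∈ Q + closedBall 0 γ, ∀ y ∈ Q + closedBall 0 γ, |f y - f x| ≤ M * ‖y - x‖)
    {x y : E} (hx : x ∈ Q) (hy : y ∈ Q) :
    ballSmooth μ f γ y ≤ ballSmooth μ f γ x + ⟪sphereGrad μ f γ x, y - x⟫ +
      √(Module.finrank ℝ E) * M / γ / 2 * ‖y - x‖ ^ 2 := by
  obtain ⟨F, G, -, hG, hGL, hFQ, hGQ⟩ := exists_global_ballSmooth μ hγ hM0 hf hQ ⟨x, hx⟩ hLip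
  rw [← hFQ x hx, ← hFQ y hy, ← hGQ x hx]
  exact le_of_lipschitz_gradient hG hGL x y

/-- Co-coercivity uses a gradient step that may leave Q. It is therefore proved for the globally
smooth convex function of `exists_global_ballSmooth`, which has the same values and gradients on Q.
-/
theorem ballSmooth_cocoercive {f : E → ℝ} {Q : Set E} {M γ : ℝ} (hγ : 0 < γ) (hM0 : 0 < M)
    (hf : ConvexOn ℝ univ f) (hQ : Convex ℝ Q)
    (hLip : ∀ x ∈ Q + closedBall 0 γ, ∀ y ∈ Q + closedBall 0 γ, |f y - f x| ≤ M * ‖y - x‖)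
    {x y : E} (hx : x ∈ Q) (hy : y ∈ Q) :
    ‖sphereGrad μ f γ x - sphereGrad μ f γ y‖ ^ 2 ≤ 2 * (√(Module.finrank ℝ E) * M / γ) *
      (ballSmooth μ f γ x - ballSmooth μ f γ y - ⟪sphereGrad μ f γ y, x - y⟫) := by
  have hd : (0 : ℝ) < Module.finrank ℝ E := by exact_mod_cast Module.finrank_pos
  obtain ⟨F, G, hF, hG, hGL, hFQ, hGQ⟩ := exists_global_ballSmooth μ hγ hM0.le hf hQ ⟨x, hx⟩ hLip
  rw [← hFQ x hx, ← hFQ y hy, ← hGQ x hx, ← hGQ y hy]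
  exact norm_sub_gradient_sq_le (by positivity) hF hG hGL x y

theorem abs_ballSmooth_sub_le {f : E → ℝ} {Q : Set E} {M γ : ℝ} (hγ : 0 < γ) (hc : Continuous f)
    (hLip : ∀ x ∈ Q + closedBall 0 γ, ∀ y ∈ Q + closedBall 0 γ, |f y - f x| ≤ M * ‖y - x‖)
    {x y : E} (hx : x ∈ Q) (hy : y ∈ Q) :
    |ballSmooth μ f γ x - ballSmooth μ f γ y| ≤ M * ‖x - y‖ := by
  have key : ∀ a ∈ Q, ∀ b ∈ Q, ballSmooth μ f γ a - ballSmooth μ f γ b ≤ M * ‖a - b‖ := by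
    intro a ha b hb
    refine ballSmooth_sub_le μ hc fun u hu => (le_abs_self _).trans ?_
    have := hLip _ (add_smul_mem_add_closedBall hγ hb hu) _ (add_smul_mem_add_closedBall hγ ha hu)
    rwa [add_sub_add_right_eq_sub] at this
  refine abs_sub_le_iff.2 ⟨key x hx y hy, ?_⟩
  rw [norm_sub_rev]
  exact key y hy x hx

theorem ballSmooth_le_add {f : E → ℝ} {Q : Set E} {M γ : ℝ} (hγ : 0 < γ) (hM0 : 0 ≤ M)
    (hc : Continuous f)
    (hLip : ∀ x ∈ Q + closedBall 0 γ, ∀ y ∈ Q + closedBall 0 γ, |f y - f x| ≤ M * ‖y - x‖)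
    {x : E} (hx : x ∈ Q) : ballSmooth μ f γ x ≤ f x + γ * M := by
  refine ballSmooth_le μ hc fun u hu => ?_
  have h0 : x ∈ Q + closedBall (0 : E) γ := by
    simpa using add_smul_mem_add_closedBall hγ hx (u := 0) (by simp)
  have h1 := hLip _ h0 _ (add_smul_mem_add_closedBall hγ hx hu)
  rw [add_sub_cancel_left, norm_smul, Real.norm_of_nonneg hγ.le] at h1
  have h2 := le_abs_self (f (x + γ • u) - f x)
  have h3 : M * (γ * ‖u‖) ≤ γ * M := by
    nlinarith [mul_le_mul_of_nonneg_left hu (mul_nonneg hM0 hγ.le)]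
  linarith

/-- The Lipschitz constant of a strongly convex function on a ball bounds its modulus of strong
convexity. -/
theorem strongConvex_modulus_le {f : E → ℝ} {Q : Set E} {m M γ : ℝ} (hγ : 0 < γ)
    (hf : StrongConvexOn univ m f)
    (hLip : ∀ x ∈ Q + closedBall 0 γ, ∀ y ∈ Q + closedBall 0 γ, |f y - f x| ≤ M * ‖y - x‖)
    {x : E} (hx : x ∈ Q) : m ≤ 2 * (M / γ) := by
  obtain ⟨e, he⟩ := exists_norm_eq E zero_le_one
  have h0 : x ∈ Q + closedBall (0 : E) γ := by
    simpa using add_smul_mem_add_closedBall hγ hx (u := 0) (by simp)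
  have h1 := hLip _ h0 _ (add_smul_mem_add_closedBall hγ hx (u := e) he.le)
  have h2 := hLip _ h0 _ (add_smul_mem_add_closedBall hγ hx (u := -e) (by simp [he]))
  rw [add_sub_cancel_left, norm_smul, Real.norm_of_nonneg hγ.le] at h1 h2
  rw [norm_neg] at h2
  rw [he] at h1 h2
  -- At the midpoint of two antipodal points strong convexity gains mγ²/2, whereas the Lipschitz
  -- bound allows only Mγ.
  have h3 := hf.2 (mem_univ (x + γ • e)) (mem_univ (x + γ • -e))
    (by norm_num : (0 : ℝ) ≤ 1 / 2) (by norm_num : (0 : ℝ) ≤ 1 / 2) (by norm_num)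
  have h4 : (1 / 2 : ℝ) • (x + γ • e) + (1 / 2 : ℝ) • (x + γ • -e) = x := by module
  have h5 : ‖x + γ • e - (x + γ • -e)‖ = 2 * γ := by
    have : x + γ • e - (x + γ • -e) = (2 * γ) • e := by module
    rw [this, norm_smul, he, Real.norm_of_nonneg (by positivity), mul_one]
  rw [h4, h5] at h3
  simp only [smul_eq_mul] at h3
  have h6 := (abs_le.1 h1).2
  have h7 := (abs_le.1 h2).2
  have h8 : m * γ ^ 2 ≤ 2 * M * γ := by nlinarith
  rw [← mul_div_assoc, le_div_iff₀ hγ]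
  nlinarith

/-- The sphere average is a gradient, and the derivative of any function is measurable. -/
theorem measurable_sphereGrad {f : E → ℝ} (hf : LocallyLipschitz f) {γ : ℝ} (hγ : 0 < γ) :
    Measurable (sphereGrad μ f γ) := by
  have h : sphereGrad μ f γ =
      fun x => (InnerProductSpace.toDual ℝ E).symm (fderiv ℝ (ballSmooth μ f γ) x) := by
    ext1 x
    rw [(hasGradientAt_ballSmooth μ hf hγ x).hasFDerivAt.fderiv,
      LinearIsometryEquiv.symm_apply_apply]
  rw [h]
  exact (InnerProductSpace.toDual ℝ E).symm.continuous.measurable.comp (measurable_fderiv ℝ _)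

end SmoothingOnSet
end ZOSADOM
end

noncomputable section
namespace ZOSADOM

/-! ### The deterministic contraction of the Lyapunov function in an inner product space. -/

section Lyapunov

variable {E : Type*} [NormedAddCommGroup E] [InnerProductSpace ℝ E]

theorem norm_sub_sq_expand (a b : E) :
    ‖a - b‖ ^ 2 = ‖a‖ ^ 2 - 2 * ⟪a, b⟫ + ‖b‖ ^ 2 := norm_sub_sq_real a b

theorem norm_add_sq_expand (a b : E) :
    ‖a + b‖ ^ 2 = ‖a‖ ^ 2 + 2 * ⟪a, b⟫ + ‖b‖ ^ 2 := norm_add_sq_real a b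

theorem norm_smul_sq (c : ℝ) (a : E) : ‖c • a‖ ^ 2 = c ^ 2 * ‖a‖ ^ 2 := by
  rw [norm_smul, mul_pow, Real.norm_eq_abs, sq_abs]

/-- The primal part of one iteration. -/
theorem primal_step {X Xf Xg X' Xf' Y' q Δ : E} {Df Dg Df' e α m L τ : ℝ}
    (hτ : 0 < τ) (hτ2 : τ ≤ 2) (hα : 0 ≤ α) (hαm : 2 * α ≤ m) (heL : L * τ ≤ e)
    (hX : X = Xg + (1 / τ - 1 / 2) • (Xg - Xf)) (hXf' : Xf' = Xg + τ • (X' - X))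
    (hstep : e • (X' - X) = α • (Xg - X') - (q + Δ - Y'))
    (hdesc : Df' ≤ Dg + ⟪q, Xf' - Xg⟫ + L / 2 * ‖Xf' - Xg‖ ^ 2)
    (hconv : Dg + ⟪q, Xf - Xg⟫ ≤ Df)
    (hstrong : Dg - ⟪q, Xg⟫ + m / 2 * ‖Xg‖ ^ 2 ≤ 0) :
    (e + α) * ‖X'‖ ^ 2 + 2 / τ * Df' ≤
      e * ‖X‖ ^ 2 + (2 / τ - 1) * Df - Dg + 2 * ⟪X', Y'⟫ - 2 * ⟪Δ, X'⟫ := by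
  -- The implicit step is tested with its own endpoint X'. The squared increment ‖X' - X‖² gained in
  -- this way later pays for the smoothness term of the descent inequality.
  have h1 : e * ⟪X' - X, X'⟫ = α * ⟪Xg - X', X'⟫ - (⟪q, X'⟫ + ⟪Δ, X'⟫ - ⟪X', Y'⟫) := by
    have := congrArg (fun a => ⟪a, X'⟫) hstep
    simpa [inner_sub_left, inner_add_left, real_inner_smul_left, real_inner_comm X' Y'] using this
  have h2 : 2 * ⟪X' - X, X'⟫ = ‖X'‖ ^ 2 - ‖X‖ ^ 2 + ‖X' - X‖ ^ 2 := by
    rw [norm_sub_sq_expand, inner_sub_left, real_inner_self_eq_norm_sq, real_inner_comm X' X]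
    ring
  have h3 : 2 * ⟪Xg - X', X'⟫ ≤ ‖Xg‖ ^ 2 - ‖X'‖ ^ 2 := by
    have := norm_sub_sq_expand Xg X'
    rw [inner_sub_left, real_inner_self_eq_norm_sq]
    nlinarith [sq_nonneg ‖Xg - X'‖]
  have h4 : Xf' - Xg = τ • (X' - X) := by rw [hXf']; abel
  rw [h4, real_inner_smul_right, norm_smul_sq] at hdesc
  have h5 : ⟪q, X⟫ = ⟪q, Xg⟫ + (1 / τ - 1 / 2) * (⟪q, Xg⟫ - ⟪q, Xf⟫) := by
    rw [hX, inner_add_right, real_inner_smul_right, inner_sub_right]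
  have h6 : ⟪q, X'⟫ = ⟪q, X⟫ + ⟪q, X' - X⟫ := by rw [inner_sub_right]; ring
  rw [inner_sub_right] at hconv
  have h7 : 2 / τ * Df' ≤ 2 / τ * Dg + 2 * ⟪q, X' - X⟫ + L * τ * ‖X' - X‖ ^ 2 := by
    calc 2 / τ * Df' ≤ 2 / τ * (Dg + τ * ⟪q, X' - X⟫ + L / 2 * (τ ^ 2 * ‖X' - X‖ ^ 2)) := by
          gcongr
      _ = _ := by field_simp
  have h8 : L * τ * ‖X' - X‖ ^ 2 ≤ e * ‖X' - X‖ ^ 2 := by gcongr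
  have hs : 0 ≤ 1 / τ - 1 / 2 := by
    rw [sub_nonneg]; exact one_div_le_one_div_of_le hτ hτ2
  have h9 : (1 / τ - 1 / 2) * (Dg + (⟪q, Xf⟫ - ⟪q, Xg⟫)) ≤ (1 / τ - 1 / 2) * Df := by gcongr
  have h10 : α * (2 * ⟪Xg - X', X'⟫) ≤ α * (‖Xg‖ ^ 2 - ‖X'‖ ^ 2) := by gcongr
  have h11 : 2 * α * ‖Xg‖ ^ 2 ≤ m * ‖Xg‖ ^ 2 := by gcongr
  have h12 : (2 : ℝ) / τ = 2 * (1 / τ) := by ring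
  rw [h12] at h7 ⊢
  have h13 : e * (2 * ⟪X' - X, X'⟫) = e * (‖X'‖ ^ 2 - ‖X‖ ^ 2 + ‖X' - X‖ ^ 2) := by rw [h2]
  linarith [mul_nonneg hα (sq_nonneg ‖Xg‖)]

/-- The implicit line for `y`. -/
theorem dual_step {Y Y' X' w q Δ : E} {t β N : ℝ} (hβ : 0 ≤ β)
    (hstep : t • (Y' - Y) = β • (q + Δ - Y') - (N • w + X')) :
    t * (‖Y'‖ ^ 2 - ‖Y‖ ^ 2 + ‖Y' - Y‖ ^ 2) ≤
      β * ‖q‖ ^ 2 - β * ‖Y'‖ ^ 2 + 2 * β * ⟪Δ, Y'⟫ - 2 * N * ⟪w, Y'⟫ - 2 * ⟪X', Y'⟫ := by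
  have h1 : t * ⟪Y' - Y, Y'⟫ = β * (⟪q, Y'⟫ + ⟪Δ, Y'⟫ - ‖Y'‖ ^ 2) - (N * ⟪w, Y'⟫ + ⟪X', Y'⟫) := by
    have := congrArg (fun a => ⟪a, Y'⟫) hstep
    simpa [inner_sub_left, inner_add_left, real_inner_smul_left, real_inner_self_eq_norm_sq]
      using this
  have h2 : 2 * ⟪Y' - Y, Y'⟫ = ‖Y'‖ ^ 2 - ‖Y‖ ^ 2 + ‖Y' - Y‖ ^ 2 := by
    rw [norm_sub_sq_expand, inner_sub_left, real_inner_self_eq_norm_sq, real_inner_comm Y' Y]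
    ring
  have h3 : 2 * ⟪q, Y'⟫ ≤ ‖q‖ ^ 2 + ‖Y'‖ ^ 2 := by
    have := norm_sub_sq_expand q Y'
    nlinarith [sq_nonneg ‖q - Y'‖]
  have h4 : β * (2 * ⟪q, Y'⟫) ≤ β * (‖q‖ ^ 2 + ‖Y'‖ ^ 2) := by gcongr
  rw [← h2]
  linarith

/-- Expand and drop s‖a - b‖² ≥ 0. -/
theorem inner_extrapolation_ge {a b A : E} {s : ℝ} (hs : 0 ≤ s) (hA : A = a + s • (a - b)) :
    (2 + s) * ‖a‖ ^ 2 - s * ‖b‖ ^ 2 ≤ 2 * ⟪a, A⟫ := by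
  rw [hA, inner_add_right, real_inner_smul_right, inner_sub_right, real_inner_self_eq_norm_sq]
  have := norm_sub_sq_expand a b
  nlinarith [mul_nonneg hs (sq_nonneg ‖a - b‖)]

/-- The cross term is bounded by 2⟪Yg, Y'⟫ ≤ ‖Yg‖² + ‖Y'‖². The term -‖Yg‖²/2 that remains is needed
to absorb the part of ‖Zg‖² produced by the momentum of z. -/
theorem dual_fast_step {Y Yf Yg Y' Yf' : E} {τ : ℝ} (hτ : 0 < τ) (hτ2 : τ ≤ 2)
    (hY : Y = Yg + (1 / τ - 1 / 2) • (Yg - Yf)) (hYf' : Yf' = Yg + τ • (Y' - Y)) :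
    1 / τ * ‖Yf'‖ ^ 2 ≤
      ‖Y'‖ ^ 2 + (1 / τ - 1 / 2) * ‖Yf‖ ^ 2 - 1 / 2 * ‖Yg‖ ^ 2 + τ * ‖Y' - Y‖ ^ 2 := by
  have hs : 0 ≤ 1 / τ - 1 / 2 := by
    rw [sub_nonneg]; exact one_div_le_one_div_of_le hτ hτ2
  have h1 := inner_extrapolation_ge hs hY
  have h2 : 1 / τ * ‖Yf'‖ ^ 2 =
      1 / τ * ‖Yg‖ ^ 2 + 2 * (⟪Yg, Y'⟫ - ⟪Yg, Y⟫) + τ * ‖Y' - Y‖ ^ 2 := by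
    rw [hYf', norm_add_sq_expand, real_inner_smul_right, norm_smul_sq, inner_sub_right]
    field_simp
  have h3 := norm_sub_sq_expand Yg Y'
  nlinarith [sq_nonneg ‖Yg - Y'‖]

/-- The accelerated gossip step for the quadratic coupling term. -/
theorem coupling_step {U Uf w Ww Pw δ Uf' : E} {τ s : ℝ} (hτ : 0 < τ) (hτ2 : τ ≤ 2)
    (hW : 1 / 2 * ‖Ww‖ ^ 2 + s / 2 * ‖Pw‖ ^ 2 ≤ ⟪w, Ww⟫)
    (hU : U = w + (1 / τ - 1 / 2) • (w - Uf)) (hUf' : Uf' = w - (1 / 2 : ℝ) • Ww + τ • δ) :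
    1 / τ * ‖Uf'‖ ^ 2 ≤ (1 / τ - 1 / 2) * ‖Uf‖ ^ 2 - 3 / 2 * ‖w‖ ^ 2 + 2 * ⟪w, δ + U⟫ +
      2 * τ * ‖δ‖ ^ 2 - s / (2 * τ) * ‖Pw‖ ^ 2 := by
  have hs : 0 ≤ 1 / τ - 1 / 2 := by
    rw [sub_nonneg]; exact one_div_le_one_div_of_le hτ hτ2
  have h1 := inner_extrapolation_ge hs hU
  have h2 : ‖Uf'‖ ^ 2 = ‖w‖ ^ 2 - ⟪w, Ww⟫ + 1 / 4 * ‖Ww‖ ^ 2 + τ * (2 * ⟪w, δ⟫ - ⟪Ww, δ⟫) +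
      τ ^ 2 * ‖δ‖ ^ 2 := by
    rw [hUf', norm_add_sq_expand, norm_sub_sq_expand, norm_smul_sq, norm_smul_sq,
      real_inner_smul_right, real_inner_smul_right, inner_sub_left, real_inner_smul_left]
    ring
  -- This quarter of ‖Ww‖² and the one in `h2` together use up the half supplied by the gossip
  -- inequality `hW`.
  have h3 : -(τ * ⟪Ww, δ⟫) ≤ 1 / 4 * ‖Ww‖ ^ 2 + τ ^ 2 * ‖δ‖ ^ 2 := by
    have := norm_add_sq_expand ((1 / 2 : ℝ) • Ww) (τ • δ)
    rw [norm_smul_sq, norm_smul_sq, real_inner_smul_left, real_inner_smul_right] at this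
    nlinarith [sq_nonneg ‖(1 / 2 : ℝ) • Ww + τ • δ‖]
  have h4 : ‖Uf'‖ ^ 2 ≤ ‖w‖ ^ 2 - s / 2 * ‖Pw‖ ^ 2 + 2 * τ * ⟪w, δ⟫ + 2 * τ ^ 2 * ‖δ‖ ^ 2 := by
    linarith
  have h5 : 1 / τ * ‖Uf'‖ ^ 2 ≤
      1 / τ * ‖w‖ ^ 2 - s / (2 * τ) * ‖Pw‖ ^ 2 + 2 * ⟪w, δ⟫ + 2 * τ * ‖δ‖ ^ 2 := by
    calc 1 / τ * ‖Uf'‖ ^ 2 ≤ 1 / τ *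
          (‖w‖ ^ 2 - s / 2 * ‖Pw‖ ^ 2 + 2 * τ * ⟪w, δ⟫ + 2 * τ ^ 2 * ‖δ‖ ^ 2) := by gcongr
      _ = _ := by field_simp
  rw [inner_add_right]
  linarith

/-- The error-feedback gossip step for `z` and `m`; `s` is the inverse of the network constant. -/
theorem gossip_step {Z Zg m m' V V' u : E} {s p : ℝ} (hs : 0 < s) (hs1 : s ≤ 1) (hp : 0 ≤ p)
    (hp2 : 2 * p ≤ 1) (hV : V = Z - m) (hV' : V' = V + p • (Zg - Z) - u)
    (hm' : ‖m'‖ ^ 2 ≤ (1 - s) * ‖u + m‖ ^ 2) :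
    ‖V'‖ ^ 2 + ‖m'‖ ^ 2 ≤ (1 - p) * ‖V‖ ^ 2 + (1 - s / 4 + 2 * p) * ‖m‖ ^ 2 + 2 * p * ‖Zg‖ ^ 2 -
      2 * ⟪u, Z⟫ + 7 / s * ‖u‖ ^ 2 := by
  have hZ : Z = V + m := by rw [hV]; abel
  have h1 : ‖V'‖ ^ 2 = ‖V‖ ^ 2 + 2 * p * ⟪V, Zg - Z⟫ - 2 * ⟪u, V⟫ + ‖p • (Zg - Z) - u‖ ^ 2 := by
    have : V' = V + (p • (Zg - Z) - u) := by rw [hV']; abel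
    rw [this, norm_add_sq_expand, inner_sub_right, real_inner_smul_right, real_inner_comm u V]
    ring
  have h2 : ‖p • (Zg - Z) - u‖ ^ 2 ≤ 2 * p ^ 2 * ‖Zg - Z‖ ^ 2 + 2 * ‖u‖ ^ 2 := by
    have e1 := norm_sub_sq_expand (p • (Zg - Z)) u
    have e2 := norm_add_sq_expand (p • (Zg - Z)) u
    rw [norm_smul_sq] at e1 e2
    nlinarith [sq_nonneg ‖p • (Zg - Z) + u‖]
  have h3 : 2 * ⟪V, Zg - Z⟫ = ‖Zg - m‖ ^ 2 - ‖V‖ ^ 2 - ‖Zg - Z‖ ^ 2 := by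
    have e1 : Zg - m = V + (Zg - Z) := by rw [hZ]; abel
    rw [e1, norm_add_sq_expand]; ring
  have h4 : ‖Zg - m‖ ^ 2 ≤ 2 * ‖Zg‖ ^ 2 + 2 * ‖m‖ ^ 2 := by
    have e1 := norm_sub_sq_expand Zg m
    have e2 := norm_add_sq_expand Zg m
    nlinarith [sq_nonneg ‖Zg + m‖]
  have h5 : ⟪u, Z⟫ = ⟪u, V⟫ + ⟪u, m⟫ := by rw [hZ, inner_add_right]
  have h6 := norm_add_sq_expand u m
  -- The coefficient adds 2(1 - s) from ‖u + m‖² and 2 from replacing V by Z - m. Young's inequality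
  -- with weight 3s/4 leaves a quarter of the gossip contraction for m.
  have h7 : 2 * (2 - s) * ⟪u, m⟫ ≤ 3 / 4 * s * ‖m‖ ^ 2 + (2 - s) ^ 2 * (4 / (3 * s)) * ‖u‖ ^ 2 := by
    have e := norm_sub_sq_expand ((3 / 4 * s) • m) ((2 - s) • u)
    rw [norm_smul_sq, norm_smul_sq, real_inner_smul_left, real_inner_smul_right,
      real_inner_comm u m] at e
    have e0 := sq_nonneg ‖(3 / 4 * s) • m - (2 - s) • u‖
    have e1 : (3 / 4 * s) * (2 * (2 - s) * ⟪u, m⟫) ≤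
        (3 / 4 * s) * (3 / 4 * s * ‖m‖ ^ 2 + (2 - s) ^ 2 * (4 / (3 * s)) * ‖u‖ ^ 2) := by
      have e2 : (3 / 4 * s) * (3 / 4 * s * ‖m‖ ^ 2 + (2 - s) ^ 2 * (4 / (3 * s)) * ‖u‖ ^ 2) =
          (3 / 4 * s) ^ 2 * ‖m‖ ^ 2 + (2 - s) ^ 2 * ‖u‖ ^ 2 := by field_simp
      rw [e2]
      linarith
    exact le_of_mul_le_mul_left e1 (by positivity)
  have h8 : (2 - s) ^ 2 * (4 / (3 * s)) + (1 - s) + 2 ≤ 7 / s := by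
    rw [← sub_nonneg]
    have : 7 / s - ((2 - s) ^ 2 * (4 / (3 * s)) + (1 - s) + 2) =
        (7 - (4 / 3 * (2 - s) ^ 2 + (3 - s) * s)) / s := by field_simp; ring
    rw [this]
    apply div_nonneg _ hs.le
    nlinarith
  have h9 : ((2 - s) ^ 2 * (4 / (3 * s)) + (1 - s) + 2) * ‖u‖ ^ 2 ≤ 7 / s * ‖u‖ ^ 2 := by gcongr
  have h10 : p * (2 * ⟪V, Zg - Z⟫) ≤
      p * (2 * ‖Zg‖ ^ 2 + 2 * ‖m‖ ^ 2 - ‖V‖ ^ 2 - ‖Zg - Z‖ ^ 2) := by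
    rw [h3]; gcongr
  have h11 : 2 * p ^ 2 * ‖Zg - Z‖ ^ 2 ≤ p * ‖Zg - Z‖ ^ 2 := by
    gcongr; nlinarith
  rw [h6] at hm'
  linarith

/-- Since (1/β + L) r² = (1 + βL) μ ≤ 3μ/2, shrinking by r/(32χ) loses at most 3μ/64 + μ/256, which
the extra μ/8 covers. -/
theorem rate_primal_coeff {μ β L χ r : ℝ} (hμ : 0 < μ) (hβ : 0 < β) (hL : 0 ≤ L)
    (hβL : β * L ≤ 1 / 2) (hχ : 1 ≤ χ) (hr2 : r ^ 2 = β * μ) (hr1 : r ≤ 1) :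
    (1 / β + L) * r ≤ (1 - r / (32 * χ)) * ((1 / β + L) * r + μ / 8) := by
  have hχ0 : 0 < χ := by linarith
  have e1 : (1 / β + L) * r * r ≤ 3 / 2 * μ := by
    have : (1 / β + L) * r * r = (1 + β * L) * μ := by
      rw [mul_assoc, ← sq, hr2]; field_simp
    rw [this]; nlinarith
  have e2 : r / (32 * χ) * ((1 / β + L) * r) ≤ 3 / 64 * μ := by
    have : r / (32 * χ) * ((1 / β + L) * r) = ((1 / β + L) * r * r) / (32 * χ) := by ring
    rw [this, div_le_iff₀ (by positivity)]
    nlinarith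
  have e3 : r / (32 * χ) ≤ 1 / 32 := by
    rw [div_le_iff₀ (by positivity)]; linarith
  have e4 : r / (32 * χ) * (μ / 8) ≤ 1 / 32 * (μ / 8) := by gcongr
  linarith

theorem rate_fast_coeff {χ r : ℝ} (hχ : 1 ≤ χ) (hr : 0 < r) :
    2 / r - 1 ≤ (1 - r / (32 * χ)) * (2 / r) := by
  have hχ0 : 0 < χ := by linarith
  have : (1 - r / (32 * χ)) * (2 / r) = 2 / r - 1 / (16 * χ) := by field_simp; ring
  rw [this]
  have : 1 / (16 * χ) ≤ 1 := by rw [div_le_one (by positivity)]; linarith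
  linarith

/-- Here r² = βμ turns the loss into at most β/64 + β/128, which the extra β/4 covers. -/
theorem rate_dual_coeff {μ β χ r : ℝ} (hμ : 0 < μ) (hβ : 0 < β) (hχ : 1 ≤ χ) (hr : 0 < r)
    (hr2 : r ^ 2 = β * μ) (hr1 : r ≤ 1) :
    r / (2 * χ * μ) ≤ (1 - r / (32 * χ)) * (r / (2 * χ * μ) + β / 4) := by
  have hχ0 : 0 < χ := by linarith
  have e1 : r / (32 * χ) * (r / (2 * χ * μ)) ≤ β / 64 := by
    have : r / (32 * χ) * (r / (2 * χ * μ)) = r ^ 2 / (64 * χ ^ 2 * μ) := by field_simp; ring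
    rw [this, hr2, mul_div_mul_right _ _ hμ.ne']
    gcongr
    nlinarith
  have e3 : r / (32 * χ) ≤ 1 / 32 := by
    rw [div_le_iff₀ (by positivity)]; linarith
  have e4 : r / (32 * χ) * (β / 4) ≤ 1 / 32 * (β / 4) := by gcongr
  linarith

/-- The quarter 1/(4χ) left by gossip exceeds the cost 1/(14χ) of the momentum term plus the common
rate, at most 1/(32χ). -/
theorem rate_memory_coeff {χ r : ℝ} (hχ : 1 ≤ χ) (hr1 : r ≤ 1) :
    1 - χ⁻¹ / 4 + r / (14 * χ) ≤ 1 - r / (32 * χ) := by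
  have hχ0 : 0 < χ := by linarith
  have e1 : r / (14 * χ) ≤ χ⁻¹ / 14 := by
    rw [inv_eq_one_div, div_div, mul_comm χ 14]; gcongr
  have e2 : r / (32 * χ) ≤ χ⁻¹ / 32 := by
    rw [inv_eq_one_div, div_div, mul_comm χ 32]; gcongr
  linarith [inv_pos.2 hχ0]

/-- The two copies of ‖Y' - Y‖² created by the extrapolated dual and coupling variables are paid for
by the implicit dual step. The slack is r/(χμ) · (1/4 - βμ/32). -/
theorem rate_slack_coeff {μ β χ r : ℝ} (hμ : 0 < μ) (hχ : 1 ≤ χ) (hr : 0 < r) (hβμ : β * μ ≤ 1) :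
    r * β / (32 * χ) + r / (4 * χ * μ) ≤ r / (2 * χ * μ) := by
  have hχ0 : 0 < χ := by linarith
  have : r / (2 * χ * μ) - (r * β / (32 * χ) + r / (4 * χ * μ)) =
      r / (χ * μ) * (1 / 4 - β * μ / 32) := by field_simp; ring
  have h0 : 0 ≤ r / (χ * μ) * (1 / 4 - β * μ / 32) := by
    apply mul_nonneg (by positivity); linarith
  linarith

/-- The linear arithmetic behind the contraction of the Lyapunov function. -/
theorem lyapunov_combine {μ β ρ a b c d f k c₁ c₂ c₃ M π' N : ℝ}
    {nX nX' nY nY' nYf nYf' nUf nUf' nV nm nVm' nYg nw nδ nZg nPw nq Df Dg Df' : ℝ}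
    {xy dx dy wy wz : ℝ}
    (A : (a + μ / 4) * nX' + b * Df' ≤ a * nX + (b - 1) * Df - Dg + 2 * xy - 2 * dx)
    (B : c * (nY' - nY + nδ) ≤ β * nq - β * nY' + 2 * β * dy - N * wy - 2 * xy)
    (C : d * nYf' ≤ β / 2 * nY' + (1 - ρ) * d * nYf - β / 4 * nYg + c₁ * nδ)
    (D : f * nUf' ≤ (1 - ρ) * f * nUf - c₃ * nw + N * (wy + wz) + c₂ * nδ - M * nPw)
    (F : k * nVm' ≤ (1 - π') * k * nV + (1 - π') * k * nm + β / 8 * nZg - N * wz + M * nPw)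
    (hq : β * nq ≤ Dg) (hZg : β / 8 * nZg ≤ β / 8 * (2 * nw + 2 * nYg))
    (k1 : a * nX ≤ (1 - ρ) * (a + μ / 8) * nX) (k2 : (b - 1) * Df ≤ (1 - ρ) * b * Df)
    (k3 : c * nY ≤ (1 - ρ) * (c + β / 4) * nY) (k4 : (1 - π') * (k * (nV + nm)) ≤
      (1 - ρ) * (k * (nV + nm)))
    (k6 : (c₁ + c₂) * nδ ≤ c * nδ) (k7 : β / 4 * nw ≤ c₃ * nw) :
    (a + μ / 8) * nX' + b * Df' + (c + β / 4) * nY' + d * nYf' + f * nUf' + k * nVm' +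
        μ / 8 * nX' + β / 4 * nY' ≤
      (1 - ρ) * ((a + μ / 8) * nX + b * Df + (c + β / 4) * nY + d * nYf + f * nUf +
        k * (nV + nm)) + (-2 * dx + 2 * β * dy) := by
  linarith

/-- The Lyapunov function of SADOM, in terms of the deviations from the solution. -/
def lyapunov (μ β L χ : ℝ) (X Y Yf Uf V m : E) (Df : ℝ) : ℝ :=
  ((1 / β + L) * √(β * μ) + μ / 8) * ‖X‖ ^ 2 + 2 / √(β * μ) * Df +
    (√(β * μ) / (2 * χ * μ) + β / 4) * ‖Y‖ ^ 2 + 8 * χ * β / √(β * μ) * ‖Yf‖ ^ 2 +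
    32 * χ / (μ * √(β * μ)) * ‖Uf‖ ^ 2 + 7 * √(β * μ) * χ / (4 * μ) * (‖V‖ ^ 2 + ‖m‖ ^ 2)

/-- One iteration contracts the Lyapunov function, up to the error `Δ` of the gradient. -/
theorem lyapunov_step {μ β L χ : ℝ} (hμ : 0 < μ) (hβ : 0 < β) (hL : 0 ≤ L) (hβL : β * L ≤ 1 / 2)
    (hβμ : β * μ ≤ 1) (hχ : 1 ≤ χ)
    {X Xf Xg X' Xf' Y Yf Yg Y' Yf' Z Zg Uf w Ww Pw Uf' V V' m m' q Δ : E} {Df Dg Df' : ℝ}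
    (hDf : 0 ≤ Df) (hq : β * ‖q‖ ^ 2 ≤ Dg)
    (hdesc : Df' ≤ Dg + ⟪q, Xf' - Xg⟫ + L / 2 * ‖Xf' - Xg‖ ^ 2)
    (hconv : Dg + ⟪q, Xf - Xg⟫ ≤ Df)
    (hstrong : Dg - ⟪q, Xg⟫ + μ / 2 / 2 * ‖Xg‖ ^ 2 ≤ 0)
    (hX : X = Xg + (1 / √(β * μ) - 1 / 2) • (Xg - Xf)) (hXf' : Xf' = Xg + √(β * μ) • (X' - X))
    (hX' : ((1 / β + L) * √(β * μ)) • (X' - X) = (μ / 4) • (Xg - X') - (q + Δ - Y'))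
    (hY' : (√(β * μ) / (2 * χ * μ)) • (Y' - Y) = β • (q + Δ - Y') - ((2 / μ) • w + X'))
    (hY : Y = Yg + (1 / (√(β * μ) / (16 * χ)) - 1 / 2) • (Yg - Yf))
    (hYf' : Yf' = Yg + (√(β * μ) / (16 * χ)) • (Y' - Y))
    (hU : Y + Z = w + (1 / (√(β * μ) / (16 * χ)) - 1 / 2) • (w - Uf))
    (hUf' : Uf' = w - (1 / 2 : ℝ) • Ww + (√(β * μ) / (16 * χ)) • (Y' - Y))
    (hw : w = Yg + Zg) (hPw : ⟪Pw, Z⟫ = ⟪w, Z⟫)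
    (hW : 1 / 2 * ‖Ww‖ ^ 2 + χ⁻¹ / 2 * ‖Pw‖ ^ 2 ≤ ⟪w, Ww⟫)
    (hV : V = Z - m)
    (hV' : V' = V + (√(β * μ) / (28 * χ)) • (Zg - Z) - (8 / (7 * √(β * μ) * χ)) • Pw)
    (hm' : ‖m'‖ ^ 2 ≤ (1 - χ⁻¹) * ‖(8 / (7 * √(β * μ) * χ)) • Pw + m‖ ^ 2) :
    lyapunov μ β L χ X' Y' Yf' Uf' V' m' Df' + μ / 8 * ‖X'‖ ^ 2 + β / 4 * ‖Y'‖ ^ 2 ≤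
      (1 - √(β * μ) / (32 * χ)) * lyapunov μ β L χ X Y Yf Uf V m Df +
        (-2 * ⟪Δ, X'⟫ + 2 * β * ⟪Δ, Y'⟫) := by
  have hχ0 : 0 < χ := by linarith
  have hr : 0 < √(β * μ) := Real.sqrt_pos.2 (by positivity)
  have hr2 : √(β * μ) ^ 2 = β * μ := Real.sq_sqrt (by positivity)
  have hr1 : √(β * μ) ≤ 1 := Real.sqrt_le_one.2 hβμ
  unfold lyapunov
  set r := √(β * μ)
  have hβr : β = r ^ 2 / μ := by rw [hr2]; field_simp
  have hϑ2 : r / (16 * χ) ≤ 2 := by rw [div_le_iff₀ (by positivity)]; linarith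
  have hϑ0 : 0 < r / (16 * χ) := by positivity
  have hs1 : χ⁻¹ ≤ 1 := inv_le_one_of_one_le₀ hχ
  have hs0 : 0 < χ⁻¹ := by positivity
  have hrχ : r / χ ≤ 1 := by rw [div_le_one hχ0]; linarith
  have A := primal_step hr (by linarith) (by positivity) (by linarith)
    (by rw [add_mul]; have : 0 ≤ 1 / β * r := by positivity
        linarith) hX hXf' hX' hdesc hconv hstrong
  have B := dual_step hβ.le hY'
  have C := dual_fast_step hϑ0 hϑ2 hY hYf'
  have D := coupling_step hϑ0 hϑ2 hW hU hUf'
  have F := gossip_step hs0 hs1 (by positivity : 0 ≤ r / (28 * χ))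
    (by rw [← mul_div_assoc, div_le_one (by positivity)]; linarith) hV hV' hm'
  have hu1 : ⟪(8 / (7 * r * χ)) • Pw, Z⟫ = 8 / (7 * r * χ) * ⟪w, Z⟫ := by
    rw [real_inner_smul_left, hPw]
  rw [hu1, norm_smul_sq, div_inv_eq_mul] at F
  have hZg : ‖Zg‖ ^ 2 ≤ 2 * ‖w‖ ^ 2 + 2 * ‖Yg‖ ^ 2 := by
    have e1 := norm_sub_sq_expand w Yg
    have e2 := norm_add_sq_expand w Yg
    have e3 : Zg = w - Yg := by rw [hw]; abel
    rw [e3]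
    linarith [sq_nonneg ‖w + Yg‖]
  have hinner : ⟪w, Y' - Y + (Y + Z)⟫ = ⟪w, Y'⟫ + ⟪w, Z⟫ := by
    rw [← inner_add_right]; congr 1; abel
  rw [hinner] at D
  -- the weighted inequalities
  have C' : 8 * χ * β / r * ‖Yf'‖ ^ 2 ≤ β / 2 * ‖Y'‖ ^ 2 +
      (1 - r / (32 * χ)) * (8 * χ * β / r) * ‖Yf‖ ^ 2 - β / 4 * ‖Yg‖ ^ 2 +
      r * β / (32 * χ) * ‖Y' - Y‖ ^ 2 := by
    have := mul_le_mul_of_nonneg_left C (by positivity : 0 ≤ β / 2)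
    refine le_trans (le_of_eq ?_) (this.trans (le_of_eq ?_)) <;> (field_simp; ring)
  have D' : 32 * χ / (μ * r) * ‖Uf'‖ ^ 2 ≤
      (1 - r / (32 * χ)) * (32 * χ / (μ * r)) * ‖Uf‖ ^ 2 - 3 / μ * ‖w‖ ^ 2 +
      4 / μ * (⟪w, Y'⟫ + ⟪w, Z⟫) + r / (4 * χ * μ) * ‖Y' - Y‖ ^ 2 - 16 / (μ * r) * ‖Pw‖ ^ 2 := by
    have := mul_le_mul_of_nonneg_left D (by positivity : 0 ≤ 2 / μ)
    refine le_trans (le_of_eq ?_) (this.trans (le_of_eq ?_)) <;> (field_simp; ring)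
  -- With this weight the terms in ⟪w, Z⟫ and ‖Pw‖² are opposite to those of `D'`, and ‖Zg‖²
  -- acquires the coefficient β/8, which ‖w‖² and ‖Yg‖² can absorb.
  have F' : 7 * r * χ / (4 * μ) * (‖V'‖ ^ 2 + ‖m'‖ ^ 2) ≤
      (1 - r / (28 * χ)) * (7 * r * χ / (4 * μ)) * ‖V‖ ^ 2 +
      (1 - χ⁻¹ / 4 + r / (14 * χ)) * (7 * r * χ / (4 * μ)) * ‖m‖ ^ 2 + β / 8 * ‖Zg‖ ^ 2 -
      4 / μ * ⟪w, Z⟫ + 16 / (μ * r) * ‖Pw‖ ^ 2 := by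
    have := mul_le_mul_of_nonneg_left F (by positivity : 0 ≤ 7 * r * χ / (4 * μ))
    rw [hβr]
    refine this.trans (le_of_eq ?_)
    field_simp
    ring
  -- V contracts slightly faster than required; its rate is weakened to the common one.
  have hπ : (1 - r / (28 * χ)) * (7 * r * χ / (4 * μ)) * ‖V‖ ^ 2 ≤
      (1 - r / (32 * χ)) * (7 * r * χ / (4 * μ)) * ‖V‖ ^ 2 := by
    gcongr; norm_num
  have hm5 : (1 - χ⁻¹ / 4 + r / (14 * χ)) * (7 * r * χ / (4 * μ)) * ‖m‖ ^ 2 ≤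
      (1 - r / (32 * χ)) * (7 * r * χ / (4 * μ)) * ‖m‖ ^ 2 := by
    gcongr ?_ * _ * _
    exact rate_memory_coeff hχ hr1
  refine lyapunov_combine (c₁ := r * β / (32 * χ)) (c₂ := r / (4 * χ * μ)) (c₃ := 3 / μ)
    (M := 16 / (μ * r)) (π' := r / (32 * χ)) (N := 4 / μ) (nδ := ‖Y' - Y‖ ^ 2) (nq := ‖q‖ ^ 2)
    A ?_ C' D' ?_ hq (mul_le_mul_of_nonneg_left hZg (by positivity))
    (mul_le_mul_of_nonneg_right (rate_primal_coeff hμ hβ hL hβL hχ hr2 hr1) (sq_nonneg _))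
    (mul_le_mul_of_nonneg_right (rate_fast_coeff hχ hr) hDf)
    (mul_le_mul_of_nonneg_right (rate_dual_coeff hμ hβ hχ hr hr2 hr1) (sq_nonneg _)) le_rfl
    (mul_le_mul_of_nonneg_right (rate_slack_coeff hμ hχ hr hβμ) (sq_nonneg _))
    (mul_le_mul_of_nonneg_right ?_ (sq_nonneg _))
  · refine B.trans (le_of_eq ?_)
    ring
  · exact F'.trans (by gcongr)
  · rw [le_div_iff₀ hμ]; linarith only [hβμ]

end Lyapunov

/-! ### Gossip matrices, products of them, and the consensus projection. -/

section Gossip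

variable {n p : ℕ}

/-- `A` fixes constant vectors, preserves the sum and contracts vectors of zero sum. -/
structure IsAveraging (A : Matrix (Fin n) (Fin n) ℝ) (ρ : ℝ) : Prop where
  fix : ∀ v : Fin n → ℝ, (∀ i j, v i = v j) → A.mulVec v = v
  sum : ∀ v : Fin n → ℝ, ∑ i, A.mulVec v i = ∑ i, v i
  contraction : ∀ v : Fin n → ℝ, ∑ i, v i = 0 → ∑ i, A.mulVec v i ^ 2 ≤ ρ * ∑ i, v i ^ 2

theorem IsAveraging.one : IsAveraging (1 : Matrix (Fin n) (Fin n) ℝ) 1 where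
  fix v _ := Matrix.one_mulVec v
  sum v := by rw [Matrix.one_mulVec]
  contraction v _ := by rw [Matrix.one_mulVec, one_mul]

theorem IsAveraging.mul {A B : Matrix (Fin n) (Fin n) ℝ} {ρ σ : ℝ} (hA : IsAveraging A ρ)
    (hB : IsAveraging B σ) (hρ : 0 ≤ ρ) : IsAveraging (A * B) (ρ * σ) where
  fix v hv := by rw [← Matrix.mulVec_mulVec, hB.fix v hv, hA.fix v hv]
  sum v := by rw [← Matrix.mulVec_mulVec, hA.sum, hB.sum]
  contraction v hv := by
    rw [← Matrix.mulVec_mulVec, mul_assoc]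
    exact (hA.contraction _ (by rw [hB.sum, hv])).trans
      (mul_le_mul_of_nonneg_left (hB.contraction v hv) hρ)

theorem IsAveraging.mono {A : Matrix (Fin n) (Fin n) ℝ} {ρ σ : ℝ} (hA : IsAveraging A ρ)
    (h : ρ ≤ σ) : IsAveraging A σ where
  fix := hA.fix
  sum := hA.sum
  contraction v hv := (hA.contraction v hv).trans
    (mul_le_mul_of_nonneg_right h (Finset.sum_nonneg fun _ _ => sq_nonneg _))

/-- Preservation of sums is where symmetry of W enters: W kills constants, hence so does its
transpose, and the image of W has zero sum. -/
theorem IsGossipSequence.isAveraging {G : ℕ → SimpleGraph (Fin n)}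
    {W : ℕ → Matrix (Fin n) (Fin n) ℝ} {χ : ℝ} (h : IsGossipSequence G W χ) (q : ℕ) :
    IsAveraging (1 - W q) (1 - χ⁻¹) where
  fix v hv := by rw [Matrix.sub_mulVec, Matrix.one_mulVec, (h.ker q v).2 hv, sub_zero]
  sum v := by
    have hsymm : (W q).transpose = W q := by
      have := (h.posSemidef q).isHermitian.eq
      rwa [Matrix.conjTranspose_eq_transpose_of_trivial] at this
    have h1 : (W q).mulVec (fun _ => 1) = 0 := (h.ker q _).2 fun _ _ => rfl
    have h2 : ∑ i, (W q).mulVec v i = 0 := by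
      have : ∑ i, (W q).mulVec v i = (fun _ => 1) ⬝ᵥ (W q).mulVec v := by simp [dotProduct]
      rw [this, Matrix.dotProduct_mulVec, ← Matrix.mulVec_transpose, hsymm, h1, zero_dotProduct]
    simp [Matrix.sub_mulVec, Finset.sum_sub_distrib, h2]
  contraction v hv := by
    refine le_trans (le_of_eq ?_) (h.contraction q v hv)
    refine Finset.sum_congr rfl fun i _ => ?_
    rw [Matrix.sub_mulVec, Matrix.one_mulVec, Pi.sub_apply]
    ring

/-- A product of different gossip matrices need not be symmetric. The class `IsAveraging` avoids
symmetry and is stable under products, with multiplying contraction factors. -/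
theorem IsGossipSequence.isAveraging_gossipProd {G : ℕ → SimpleGraph (Fin n)}
    {W : ℕ → Matrix (Fin n) (Fin n) ℝ} {χ : ℝ} (h : IsGossipSequence G W χ) (hχ : 1 ≤ χ)
    (q T : ℕ) : IsAveraging (gossipProd W q T) ((1 - χ⁻¹) ^ T) := by
  have h0 : 0 ≤ 1 - χ⁻¹ := sub_nonneg.2 (inv_le_one_of_one_le₀ hχ)
  induction T with
  | zero => simpa [gossipProd] using IsAveraging.one
  | succ T ih =>
    rw [gossipProd, pow_succ']
    exact (h.isAveraging _).mul ih h0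

theorem gossipApply_apply (A : Matrix (Fin n) (Fin n) ℝ) (x : Stacked n p) (i : Fin n)
    (k : Fin p) : gossipApply A x i k = A.mulVec (fun j => x j k) i := by
  simp [gossipApply, Matrix.mulVec, dotProduct]

theorem stacked_ext {x y : Stacked n p} (h : ∀ i k, x i k = y i k) : x = y := by
  ext i k
  exact h i k

theorem gossipApply_add (A : Matrix (Fin n) (Fin n) ℝ) (x y : Stacked n p) :
    gossipApply A (x + y) = gossipApply A x + gossipApply A y := by
  refine stacked_ext fun i k => ?_
  simp [gossipApply, smul_add, Finset.sum_add_distrib]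

theorem gossipApply_smul (A : Matrix (Fin n) (Fin n) ℝ) (c : ℝ) (x : Stacked n p) :
    gossipApply A (c • x) = c • gossipApply A x := by
  refine stacked_ext fun i k => ?_
  simp [gossipApply, Finset.mul_sum, mul_left_comm]

theorem gossipApply_sub (A : Matrix (Fin n) (Fin n) ℝ) (x y : Stacked n p) :
    gossipApply A (x - y) = gossipApply A x - gossipApply A y := by
  rw [sub_eq_add_neg, gossipApply_add, ← neg_one_smul ℝ y, gossipApply_smul, neg_one_smul,
    ← sub_eq_add_neg]

theorem gossipApply_one_sub (A : Matrix (Fin n) (Fin n) ℝ) (x : Stacked n p) :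
    gossipApply (1 - A) x = x - gossipApply A x := by
  refine stacked_ext fun i k => ?_
  rw [gossipApply_apply, Matrix.sub_mulVec, Matrix.one_mulVec]
  simp [gossipApply_apply]

theorem norm_sq_stacked (x : Stacked n p) : ‖x‖ ^ 2 = ∑ k, ∑ i, x i k ^ 2 := by
  rw [PiLp.norm_sq_eq_of_L2, Finset.sum_comm]
  refine Finset.sum_congr rfl fun i _ => ?_
  rw [EuclideanSpace.norm_sq_eq]
  simp

theorem mem_consensusPerp_iff {z : Stacked n p} :
    z ∈ consensusPerp n p ↔ ∀ k, ∑ i, z i k = 0 := by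
  rw [consensusPerp, Set.mem_ofPred_eq]
  constructor
  · intro h k
    have := congrArg (fun v : Node p => v k) h
    simpa using this
  · intro h
    ext k
    simpa using h k

theorem zero_mem_consensusPerp : (0 : Stacked n p) ∈ consensusPerp n p := by
  simp [consensusPerp]

theorem consensusPerp_add {x y : Stacked n p} (hx : x ∈ consensusPerp n p)
    (hy : y ∈ consensusPerp n p) : x + y ∈ consensusPerp n p := by
  simp only [consensusPerp, Set.mem_ofPred_eq] at *
  simp [Finset.sum_add_distrib, hx, hy]

theorem consensusPerp_smul {x : Stacked n p} (c : ℝ) (hx : x ∈ consensusPerp n p) :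
    c • x ∈ consensusPerp n p := by
  simp only [consensusPerp, Set.mem_ofPred_eq] at *
  simp [← Finset.smul_sum, hx]

theorem consensusPerp_sub {x y : Stacked n p} (hx : x ∈ consensusPerp n p)
    (hy : y ∈ consensusPerp n p) : x - y ∈ consensusPerp n p := by
  simp only [consensusPerp, Set.mem_ofPred_eq] at *
  simp [Finset.sum_sub_distrib, hx, hy]

theorem consensus_add {x y : Stacked n p} (hx : x ∈ consensus n p) (hy : y ∈ consensus n p) :
    x + y ∈ consensus n p := fun i j => by simp [hx i j, hy i j]

theorem consensus_sub {x y : Stacked n p} (hx : x ∈ consensus n p) (hy : y ∈ consensus n p) :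
    x - y ∈ consensus n p := fun i j => by simp [hx i j, hy i j]

theorem consensus_smul {x : Stacked n p} (c : ℝ) (hx : x ∈ consensus n p) :
    c • x ∈ consensus n p := fun i j => by simp [hx i j]

theorem inner_consensus_consensusPerp {x z : Stacked n p} (hx : x ∈ consensus n p)
    (hz : z ∈ consensusPerp n p) : ⟪x, z⟫ = 0 := by
  rcases Nat.eq_zero_or_pos n with rfl | hn
  · simp [PiLp.inner_apply]
  · have : ∀ i, ⟪x i, z i⟫ = ⟪x ⟨0, hn⟩, z i⟫ := fun i => by rw [hx i ⟨0, hn⟩]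
    rw [PiLp.inner_apply, Finset.sum_congr rfl fun i _ => this i, ← inner_sum]
    have hz' : ∑ i, z i = 0 := hz
    rw [hz', inner_zero_right]

theorem mem_consensusPerp_of_inner_eq_zero {h : Stacked n p}
    (H : ∀ c ∈ consensus n p, ⟪h, c⟫ = 0) : h ∈ consensusPerp n p := by
  have := H (WithLp.toLp 2 fun _ => ∑ i, h i) fun i j => rfl
  rw [PiLp.inner_apply, ← sum_inner, inner_self_eq_zero] at this
  exact this

/-- The orthogonal projection onto `∑ i, z_i = 0`. -/
def perpProj (x : Stacked n p) : Stacked n p :=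
  WithLp.toLp 2 fun i => x i - (n : ℝ)⁻¹ • ∑ j, x j

theorem sub_perpProj_mem (x : Stacked n p) : x - perpProj x ∈ consensus n p := fun i j => by
  simp [perpProj]

theorem perpProj_mem (x : Stacked n p) : perpProj x ∈ consensusPerp n p := by
  rcases Nat.eq_zero_or_pos n with rfl | hn
  · simp [consensusPerp]
  · have : (n : ℝ) ≠ 0 := by positivity
    simp [consensusPerp, perpProj, Finset.sum_sub_distrib, ← Nat.cast_smul_eq_nsmul ℝ, smul_smul,
      this]

/-- Uniqueness of the orthogonal decomposition. The linearity of `perpProj` and its values on the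
two subspaces all follow from it. -/
theorem perpProj_eq {x c z : Stacked n p} (hc : c ∈ consensus n p) (hz : z ∈ consensusPerp n p)
    (h : x = c + z) : perpProj x = z := by
  have h1 : perpProj x - z ∈ consensusPerp n p := consensusPerp_sub (perpProj_mem x) hz
  have h2 : perpProj x - z ∈ consensus n p := by
    have : perpProj x - z = c - (x - perpProj x) := by rw [h]; abel
    rw [this]
    exact consensus_sub hc (sub_perpProj_mem x)
  exact sub_eq_zero.1 (inner_self_eq_zero.1 (inner_consensus_consensusPerp h2 h1))

theorem perpProj_add (x y : Stacked n p) : perpProj (x + y) = perpProj x + perpProj y :=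
  perpProj_eq (consensus_add (sub_perpProj_mem x) (sub_perpProj_mem y))
    (consensusPerp_add (perpProj_mem x) (perpProj_mem y)) (by abel)

theorem perpProj_sub (x y : Stacked n p) : perpProj (x - y) = perpProj x - perpProj y :=
  perpProj_eq (consensus_sub (sub_perpProj_mem x) (sub_perpProj_mem y))
    (consensusPerp_sub (perpProj_mem x) (perpProj_mem y)) (by abel)

theorem perpProj_smul (c : ℝ) (x : Stacked n p) : perpProj (c • x) = c • perpProj x :=
  perpProj_eq (consensus_smul c (sub_perpProj_mem x))
    (consensusPerp_smul c (perpProj_mem x)) (by module)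

theorem zero_mem_consensus : (0 : Stacked n p) ∈ consensus n p := fun _ _ => rfl

theorem perpProj_of_mem_perp {z : Stacked n p} (hz : z ∈ consensusPerp n p) : perpProj z = z :=
  perpProj_eq zero_mem_consensus hz (by simp)

theorem perpProj_of_mem_consensus {c : Stacked n p} (hc : c ∈ consensus n p) : perpProj c = 0 :=
  perpProj_eq hc zero_mem_consensusPerp (by simp)

theorem inner_perpProj_left (w : Stacked n p) {z : Stacked n p} (hz : z ∈ consensusPerp n p) :
    ⟪perpProj w, z⟫ = ⟪w, z⟫ := by
  have := inner_consensus_consensusPerp (sub_perpProj_mem w) hz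
  rw [inner_sub_left] at this
  linarith

theorem norm_perpProj_le (x : Stacked n p) : ‖perpProj x‖ ≤ ‖x‖ := by
  have h1 := inner_perpProj_left x (perpProj_mem x)
  rw [real_inner_self_eq_norm_sq] at h1
  have h2 := real_inner_le_norm x (perpProj x)
  rcases (norm_nonneg (perpProj x)).eq_or_lt with h0 | h0
  · rw [← h0]; exact norm_nonneg x
  · rw [← h1, sq] at h2
    exact le_of_mul_le_mul_right h2 h0

/-- The properties of the gossip operator `I - A` used in the analysis. -/
structure IsGossip (W : Matrix (Fin n) (Fin n) ℝ) (p : ℕ) (χ : ℝ) : Prop where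
  consensus : ∀ x ∈ consensus n p, gossipApply W x = 0
  perp : ∀ x : Stacked n p, gossipApply W x ∈ consensusPerp n p
  contraction : ∀ z ∈ consensusPerp n p,
    ‖z - gossipApply W z‖ ^ 2 ≤ (1 - χ⁻¹) * ‖z‖ ^ 2

theorem IsAveraging.isGossip {A : Matrix (Fin n) (Fin n) ℝ} {χ : ℝ}
    (hA : IsAveraging A (1 - χ⁻¹)) (p : ℕ) : IsGossip (1 - A) p χ where
  consensus x hx := by
    refine stacked_ext fun i k => ?_
    rw [gossipApply_apply, Matrix.sub_mulVec, Matrix.one_mulVec,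
      hA.fix _ fun i j => by rw [hx i j]]
    simp
  perp x := by
    rw [mem_consensusPerp_iff]
    intro k
    simp only [gossipApply_apply, Matrix.sub_mulVec, Matrix.one_mulVec, Pi.sub_apply,
      Finset.sum_sub_distrib, hA.sum]
    simp
  contraction z hz := by
    rw [gossipApply_one_sub, sub_sub_cancel, norm_sq_stacked, norm_sq_stacked, Finset.mul_sum]
    refine Finset.sum_le_sum fun k _ => ?_
    simp only [gossipApply_apply]
    exact hA.contraction _ (mem_consensusPerp_iff.1 hz k)

theorem IsGossipSequence.isGossip_one {G : ℕ → SimpleGraph (Fin n)}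
    {W : ℕ → Matrix (Fin n) (Fin n) ℝ} {χ : ℝ} (h : IsGossipSequence G W χ) (hχ : 1 ≤ χ)
    (p k : ℕ) : IsGossip (multiGossip W 1 k) p χ := by
  have := h.isAveraging_gossipProd hχ (k * 1) 1
  rw [pow_one] at this
  exact this.isGossip p

/-- About `χ log 2` rounds of gossip contract by a factor `1 / 2`. -/
theorem IsGossipSequence.isGossip_two {G : ℕ → SimpleGraph (Fin n)}
    {W : ℕ → Matrix (Fin n) (Fin n) ℝ} {χ : ℝ} (h : IsGossipSequence G W χ) (hχ : 1 ≤ χ)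
    (p k : ℕ) {T : ℕ} (hT : χ * Real.log 2 ≤ T) : IsGossip (multiGossip W T k) p 2 := by
  have hχ0 : 0 < χ := by linarith
  refine ((h.isAveraging_gossipProd hχ (k * T) T).mono ?_).isGossip p
  have h0 : 0 ≤ 1 - χ⁻¹ := sub_nonneg.2 (inv_le_one_of_one_le₀ hχ)
  have h1 : 1 - χ⁻¹ ≤ Real.exp (-χ⁻¹) := Real.one_sub_le_exp_neg _
  calc (1 - χ⁻¹) ^ T ≤ Real.exp (-χ⁻¹) ^ T := by gcongr
    _ = Real.exp (-(T * χ⁻¹)) := by rw [← Real.exp_nat_mul]; ring_nf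
    _ ≤ Real.exp (-Real.log 2) := by
      gcongr
      rw [← div_eq_mul_inv, le_div_iff₀ hχ0, mul_comm]
      exact hT
    _ = 1 - 2⁻¹ := by
      rw [Real.exp_neg, Real.exp_log two_pos]; norm_num

/-- Expanding the contraction at the projection of w gives this coercivity directly, so the
accelerated gossip step needs no symmetry of W. -/
theorem IsGossip.inner_ge {W : Matrix (Fin n) (Fin n) ℝ} {χ : ℝ} (hW : IsGossip W p χ)
    (w : Stacked n p) : 1 / 2 * ‖gossipApply W w‖ ^ 2 + χ⁻¹ / 2 * ‖perpProj w‖ ^ 2 ≤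
      ⟪w, gossipApply W w⟫ := by
  have h1 := hW.contraction _ (perpProj_mem w)
  have h2 : gossipApply W (perpProj w) = gossipApply W w := by
    have := hW.consensus _ (sub_perpProj_mem w)
    rw [gossipApply_sub, sub_eq_zero] at this
    exact this.symm
  rw [h2, norm_sub_sq_expand, inner_perpProj_left w (hW.perp w)] at h1
  linarith

end Gossip

/-! ### From the abstract contraction to one iteration of SADOM. -/

section StateStep

variable {n p : ℕ}

/-- `H` is `μ`-strongly convex with gradient `G`, is `L`-smooth on the convex set `Q` and has the
minimizer `xs` over the consensus space. -/
structure IsSmoothProblem (H : Stacked n p → ℝ) (G : Stacked n p → Stacked n p)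
    (Q : Set (Stacked n p)) (μ L : ℝ) (xs : Stacked n p) : Prop where
  convex : Convex ℝ Q
  mem : xs ∈ Q
  consensus : xs ∈ consensus n p
  perp : G xs ∈ consensusPerp n p
  descent : ∀ x ∈ Q, ∀ y ∈ Q, H y ≤ H x + ⟪G x, y - x⟫ + L / 2 * ‖y - x‖ ^ 2
  cocoercive : ∀ x ∈ Q, ‖G x - G xs‖ ^ 2 ≤ 2 * L * (H x - H xs - ⟪G xs, x - xs⟫)
  strong : ∀ x y, H x + ⟪G x, y - x⟫ + μ / 2 * ‖y - x‖ ^ 2 ≤ H y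

/-- The Bregman divergence of `H - μ/4 ‖·‖²`. -/
def regBregman (H : Stacked n p → ℝ) (h xs : Stacked n p) (μ : ℝ) (u : Stacked n p) : ℝ :=
  bregman H h u xs - μ / 4 * ‖u - xs‖ ^ 2

/-- The Lyapunov function of a state, relative to the saddle point
`(xs, h - (μ/2) xs, -h)`. -/
def stateLyapunov (H : Stacked n p → ℝ) (h xs : Stacked n p) (μ β L χ : ℝ) (s : State n p) : ℝ :=
  lyapunov μ β L χ (s.x - xs) (s.y - (h - (μ / 2) • xs)) (s.yf - (h - (μ / 2) • xs))
    (s.yf + s.zf + (μ / 2) • xs) (s.z + h - perpProj s.m) (perpProj s.m) (regBregman H h xs μ s.xf)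

/-- The three-point identity: the gradient of `regBregman` at u is G - h - (μ/2)(u - xs) when G is
the gradient of H there. The last bracket is then the Bregman divergence of H - (μ/4)‖·‖² between v
and u. -/
theorem regBregman_sub (H : Stacked n p → ℝ) (G h xs : Stacked n p) (μ : ℝ) (u v : Stacked n p) :
    regBregman H h xs μ v = regBregman H h xs μ u + ⟪G - h - (μ / 2) • (u - xs), v - u⟫ +
      (H v - H u - ⟪G, v - u⟫ - μ / 4 * ‖v - u‖ ^ 2) := by
  unfold regBregman bregman
  have e1 : v - xs = (v - u) + (u - xs) := by abel
  generalize v - u = a at *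
  generalize u - xs = b at *
  rw [e1, norm_add_sq_expand, inner_add_right, inner_sub_left, inner_sub_left,
    real_inner_smul_left, real_inner_comm a b]
  ring

theorem IsSmoothProblem.regBregman_ge {H : Stacked n p → ℝ} {G : Stacked n p → Stacked n p}
    {Q : Set (Stacked n p)} {μ L : ℝ} {xs : Stacked n p} (hH : IsSmoothProblem H G Q μ L xs)
    (u : Stacked n p) : μ / 4 * ‖u - xs‖ ^ 2 ≤ regBregman H (G xs) xs μ u := by
  have := hH.strong xs u
  unfold regBregman bregman
  linarith

/-- By strong convexity the plain divergence is at most twice the regularised one. So co-coercivity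
contributes 8L and the quadratic correction 2μ. -/
theorem IsSmoothProblem.norm_sq_le {H : Stacked n p → ℝ} {G : Stacked n p → Stacked n p}
    {Q : Set (Stacked n p)} {μ β L : ℝ} {xs : Stacked n p} (hH : IsSmoothProblem H G Q μ L xs)
    (hμ : 0 < μ) (hβ : 0 ≤ β) (hβ2 : β * (8 * L + 2 * μ) ≤ 1) (hL : 0 ≤ L) {u : Stacked n p}
    (hu : u ∈ Q) :
    β * ‖G u - G xs - (μ / 2) • (u - xs)‖ ^ 2 ≤ regBregman H (G xs) xs μ u := by
  have h1 := hH.cocoercive u hu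
  have h2 := hH.regBregman_ge u
  have h3 : ‖G u - G xs - (μ / 2) • (u - xs)‖ ^ 2 ≤
      2 * ‖G u - G xs‖ ^ 2 + 2 * ((μ / 2) ^ 2 * ‖u - xs‖ ^ 2) := by
    have e1 := norm_sub_sq_expand (G u - G xs) ((μ / 2) • (u - xs))
    have e2 := norm_add_sq_expand (G u - G xs) ((μ / 2) • (u - xs))
    rw [norm_smul_sq] at e1 e2
    linarith [sq_nonneg ‖G u - G xs + (μ / 2) • (u - xs)‖]
  have h4 : H u - H xs - ⟪G xs, u - xs⟫ ≤ 2 * regBregman H (G xs) xs μ u := by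
    unfold regBregman bregman at *
    linarith
  have h5 : 0 ≤ regBregman H (G xs) xs μ u := le_trans (by positivity) h2
  have h6 : 2 * L * (H u - H xs - ⟪G xs, u - xs⟫) ≤ 2 * L * (2 * regBregman H (G xs) xs μ u) := by
    gcongr
  have h7 : ‖G u - G xs - (μ / 2) • (u - xs)‖ ^ 2 ≤ (8 * L + 2 * μ) * regBregman H (G xs) xs μ u := by
    have : 2 * ((μ / 2) ^ 2 * ‖u - xs‖ ^ 2) = 2 * μ * (μ / 4 * ‖u - xs‖ ^ 2) := by ring
    have h8 : 2 * μ * (μ / 4 * ‖u - xs‖ ^ 2) ≤ 2 * μ * regBregman H (G xs) xs μ u := by gcongr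
    linarith
  calc _ ≤ β * ((8 * L + 2 * μ) * regBregman H (G xs) xs μ u) := by gcongr
    _ = (β * (8 * L + 2 * μ)) * regBregman H (G xs) xs μ u := by ring
    _ ≤ 1 * regBregman H (G xs) xs μ u := by gcongr
    _ = _ := one_mul _

/-- The choice (1/τ + 1/2)⁻¹ of the mixing weight is exactly what makes the inverse relation an
extrapolation of length 1/τ - 1/2, the form used in the energy inequalities. -/
theorem extrapolation {a b g : Stacked n p} {τ : ℝ} (hτ : 0 < τ)
    (h : g = (1 / τ + 1 / 2)⁻¹ • a + (1 - (1 / τ + 1 / 2)⁻¹) • b) (c : Stacked n p) :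
    a - c = (g - c) + (1 / τ - 1 / 2) • ((g - c) - (b - c)) := by
  have hs : 0 < 1 / τ + 1 / 2 := by positivity
  have h1 : (1 / τ + 1 / 2) • g = a + (1 / τ - 1 / 2) • b := by
    rw [h, smul_add, smul_smul, smul_smul, mul_inv_cancel₀ hs.ne', one_smul, mul_sub, mul_one,
      mul_inv_cancel₀ hs.ne']
    congr 2
    ring
  have h2 : a = (1 / τ + 1 / 2) • g - (1 / τ - 1 / 2) • b := by rw [h1]; abel
  rw [h2]
  module

theorem IsStep.mem_perp {a : Params} {W : Matrix (Fin n) (Fin n) ℝ} {g : Stacked n p} {χ : ℝ}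
    {s t : State n p} (h : IsStep a W g s t) (hW : IsGossip W p χ) (hz : s.z ∈ consensusPerp n p)
    (hzf : s.zf ∈ consensusPerp n p) : t.z ∈ consensusPerp n p ∧ t.zf ∈ consensusPerp n p := by
  have hzg : s.zg a ∈ consensusPerp n p :=
    consensusPerp_add (consensusPerp_smul _ hz) (consensusPerp_smul _ hzf)
  constructor
  · rw [h.z]
    exact consensusPerp_sub (consensusPerp_add hz
      (consensusPerp_smul _ (consensusPerp_sub hzg hz))) (hW.perp _)
  · rw [h.zf]
    exact consensusPerp_sub hzg (consensusPerp_smul _ (hW.perp _))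

theorem IsGossip.apply_perpProj {W : Matrix (Fin n) (Fin n) ℝ} {χ : ℝ} (hW : IsGossip W p χ)
    (w : Stacked n p) : gossipApply W (perpProj w) = gossipApply W w := by
  have := hW.consensus _ (sub_perpProj_mem w)
  rw [gossipApply_sub, sub_eq_zero] at this
  exact this.symm

/-- One iteration of SADOM contracts the Lyapunov function, up to the error of the gradient. -/
theorem IsStep.stateLyapunov_le {H : Stacked n p → ℝ} {G : Stacked n p → Stacked n p}
    {Q : Set (Stacked n p)} {μ β L χ : ℝ} {xs : Stacked n p} (hH : IsSmoothProblem H G Q μ L xs)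
    (hμ : 0 < μ) (hβ : 0 < β) (hL : 0 ≤ L) (hβL : β * (8 * L + 2 * μ) ≤ 1) (hχ : 1 ≤ χ)
    {W : Matrix (Fin n) (Fin n) ℝ} (hW : IsGossip W p χ) {g : Stacked n p} {s t : State n p}
    (h : IsStep (params μ L χ β) W g s t) (hz : s.z ∈ consensusPerp n p)
    (hzf : s.zf ∈ consensusPerp n p) (hxg : s.xg (params μ L χ β) ∈ Q)
    (hxf' : t.xf ∈ Q) :
    stateLyapunov H (G xs) xs μ β L χ t + μ / 8 * ‖t.x - xs‖ ^ 2 +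
        β / 4 * ‖t.y - (G xs - (μ / 2) • xs)‖ ^ 2 ≤
      (1 - √(β * μ) / (32 * χ)) * stateLyapunov H (G xs) xs μ β L χ s +
        (-2 * ⟪g - G (s.xg (params μ L χ β)), t.x - xs⟫ +
          2 * β * ⟪g - G (s.xg (params μ L χ β)), t.y - (G xs - (μ / 2) • xs)⟫) := by
  have hχ0 : 0 < χ := by linarith
  have hr : 0 < √(β * μ) := Real.sqrt_pos.2 (by positivity)
  have hr2 : √(β * μ) ^ 2 = β * μ := Real.sq_sqrt (by positivity)
  have hβL' : β * L ≤ 1 / 2 := by nlinarith [mul_nonneg hβ.le hL, mul_pos hβ hμ]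
  have hβμ : β * μ ≤ 1 := by nlinarith [mul_nonneg hβ.le hL, mul_pos hβ hμ]
  obtain ⟨hx, hxf1, hy, hyf1, hz1, hm1, hzf1⟩ := h
  set a := params μ L χ β with ha
  set xg := s.xg a with hxgd
  set yg := s.yg a with hygd
  set zg := s.zg a with hzgd
  set hs := G xs with hhs
  set ys := hs - (μ / 2) • xs with hys
  have e1 : a.ϰ * a.ν⁻¹ = 8 / (7 * √(β * μ) * χ) := by
    simp only [ha, params]; field_simp; norm_num
  have e2 : a.ϰ * a.π = √(β * μ) / (28 * χ) := by
    simp only [ha, params]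
    rw [div_mul_div_comm, div_eq_div_iff (by positivity) (by positivity)]
    rw [show μ / 2 * β * (28 * χ) = 14 * (β * μ) * χ by ring, ← hr2]
    field_simp
    norm_num
  rw [e1] at hm1
  rw [e1, e2] at hz1
  have hzgp : zg ∈ consensusPerp n p :=
    consensusPerp_add (consensusPerp_smul _ hz) (consensusPerp_smul _ hzf)
  have hc : (μ / 2) • xs ∈ ZOSADOM.consensus n p := consensus_smul _ hH.consensus
  have hPw : perpProj (yg + zg + (μ / 2) • xs) = perpProj (yg + zg) := by
    rw [perpProj_add, perpProj_of_mem_consensus hc, add_zero]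
  have hWw : gossipApply W (yg + zg + (μ / 2) • xs) = gossipApply W (yg + zg) := by
    rw [gossipApply_add, hW.consensus _ hc, add_zero]
  -- The initial memory m is arbitrary, but its consensus component is invisible to gossip. The
  -- Lyapunov function therefore contains only `perpProj` of m, which obeys the same recursion.
  set A := (8 / (7 * √(β * μ) * χ)) • (yg + zg) + s.m with hA
  have hPA : perpProj A = (8 / (7 * √(β * μ) * χ)) • perpProj (yg + zg + (μ / 2) • xs) +
      perpProj s.m := by rw [hPw, hA, perpProj_add, perpProj_smul]
  have hPm : perpProj t.m = perpProj A - gossipApply W A := by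
    rw [hm1, perpProj_sub, perpProj_of_mem_perp (hW.perp _)]
  have hd := hH.descent xg hxg t.xf hxf'
  have hst := hH.strong xg xs
  have hst2 := hH.strong xg s.xf
  have hxX : s.x - xs = _ := extrapolation hr (g := xg) rfl xs
  have hyY : s.y - ys = _ := extrapolation (τ := √(β * μ) / (16 * χ)) (by positivity)
    (g := yg) rfl ys
  have hzZ : s.z - -hs = _ := extrapolation (τ := √(β * μ) / (16 * χ)) (by positivity)
    (g := zg) rfl (-hs)
  have key := lyapunov_step (L := L) (X := s.x - xs) (Xf := s.xf - xs) (Xg := xg - xs)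
    (X' := t.x - xs)
    (Xf' := t.xf - xs) (Y := s.y - ys) (Yf := s.yf - ys) (Yg := yg - ys) (Y' := t.y - ys)
    (Yf' := t.yf - ys) (Z := s.z + hs) (Zg := zg + hs) (Uf := s.yf + s.zf + (μ / 2) • xs)
    (w := yg + zg + (μ / 2) • xs) (Ww := gossipApply W (yg + zg + (μ / 2) • xs))
    (Pw := perpProj (yg + zg + (μ / 2) • xs)) (Uf' := t.yf + t.zf + (μ / 2) • xs)
    (V := s.z + hs - perpProj s.m) (V' := t.z + hs - perpProj t.m) (m := perpProj s.m)
    (m' := perpProj t.m) (q := G xg - hs - (μ / 2) • (xg - xs)) (Δ := g - G xg)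
    (Df := regBregman H hs xs μ s.xf) (Dg := regBregman H hs xs μ xg)
    (Df' := regBregman H hs xs μ t.xf) hμ hβ hL hβL' hβμ hχ
    (le_trans (by positivity) (hH.regBregman_ge s.xf))
    (hH.norm_sq_le hμ hβ.le hβL hL hxg) ?_ ?_ ?_ hxX ?_ ?_ ?_ hyY ?_ ?_ ?_ ?_ ?_ ?_ rfl ?_ ?_
  · exact key
  · rw [sub_sub_sub_cancel_right, regBregman_sub H (G xg) hs xs μ xg t.xf]
    have := mul_nonneg hμ.le (sq_nonneg ‖t.xf - xg‖)
    linarith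
  · rw [sub_sub_sub_cancel_right, regBregman_sub H (G xg) hs xs μ xg s.xf]
    have := mul_nonneg hμ.le (sq_nonneg ‖s.xf - xg‖)
    linarith
  · have i1 := regBregman_sub H (G xg) hs xs μ xg xs
    have i2 : regBregman H hs xs μ xs = 0 := by simp [regBregman, bregman]
    rw [← neg_sub xg xs, inner_neg_right, inner_neg_right, norm_neg] at i1
    rw [← neg_sub xg xs, inner_neg_right, norm_neg] at hst
    linarith
  · rw [hxf1, sub_sub_sub_cancel_right]
    change xg + √(β * μ) • (t.x - s.x) - xs = _
    abel
  · have hη : ((1 / β + L) * √(β * μ)) * a.η = 1 := by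
      simp only [ha, params]
      exact mul_inv_cancel₀ (by positivity)
    have i1 : t.x - s.x = a.η • (a.α • (xg - t.x) - (g - a.ν • xg - t.y)) := by
      nth_rw 1 [hx]
      module
    rw [sub_sub_sub_cancel_right, i1, smul_smul, hη, one_smul]
    simp only [ha, params, hys]
    module
  · have hθ : √(β * μ) / (2 * χ * μ) * a.θ = 1 := by
      simp only [ha, params]
      field_simp
      norm_num
    have i1 : t.y - s.y = a.θ • (a.β • (g - a.ν • xg - t.y) -
        (a.ν⁻¹ • (yg + zg) + t.x)) := by
      nth_rw 1 [hy]
      module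
    have i2 : a.ν⁻¹ = 2 / μ := by simp [ha, params]
    have i3 : (2 / μ) • (μ / 2) • xs = xs := by
      rw [smul_smul, show 2 / μ * (μ / 2) = 1 by field_simp, one_smul]
    rw [sub_sub_sub_cancel_right, i1, smul_smul, hθ, one_smul, i2, smul_add (2 / μ) (yg + zg), i3]
    simp only [ha, params, hys]
    module
  · rw [hyf1, sub_sub_sub_cancel_right]
    change yg + (√(β * μ) / (16 * χ)) • (t.y - s.y) - ys = _
    abel
  · have := congrArg₂ (· + ·) hyY hzZ
    have i1 : s.y - ys + (s.z + hs) = s.y - ys + (s.z - -hs) := by abel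
    rw [i1, this, hys]
    module
  · rw [hyf1, hzf1, hWw, sub_sub_sub_cancel_right]
    change yg + (√(β * μ) / (16 * χ)) • (t.y - s.y) + (zg - (1 / 2 : ℝ) • _) + _ = _
    abel
  · rw [hys]; abel
  · exact inner_perpProj_left _ (consensusPerp_add hz hH.perp)
  · exact hW.inner_ge _
  · rw [hPm, hPA, hz1]
    module
  · rw [hPm, ← hPA, ← hW.apply_perpProj]
    exact hW.contraction _ (perpProj_mem _)

end StateStep

/-! ### Solving the implicit update, and the effect of gradient errors. -/

section ExplicitStep

variable {n p : ℕ}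

/-- The determinant of the implicit system for `x` and `y`. -/
def stepDet (a : Params) : ℝ := (1 + a.η * a.α) * (1 + a.θ * a.β) + a.η * a.θ

/-- The solution `x` of the implicit system, for the gradient `g`. -/
def nextX (a : Params) (s : State n p) (g : Stacked n p) : Stacked n p :=
  (stepDet a)⁻¹ • ((1 + a.θ * a.β) • (s.x + (a.η * (a.α + a.ν)) • s.xg a) +
    a.η • (s.y - (a.θ * a.β * a.ν) • s.xg a - (a.θ * a.ν⁻¹) • (s.yg a + s.zg a)) - a.η • g)

/-- The solution `y` of the implicit system, for the gradient `g`. -/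
def nextY (a : Params) (s : State n p) (g : Stacked n p) : Stacked n p :=
  (stepDet a)⁻¹ • ((1 + a.η * a.α) •
      (s.y - (a.θ * a.β * a.ν) • s.xg a - (a.θ * a.ν⁻¹) • (s.yg a + s.zg a)) -
    a.θ • (s.x + (a.η * (a.α + a.ν)) • s.xg a) +
      ((1 + a.η * a.α) * (a.θ * a.β) + a.θ * a.η) • g)

theorem IsStep.x_eq {a : Params} {W : Matrix (Fin n) (Fin n) ℝ} {g : Stacked n p}
    {s t : State n p} (h : IsStep a W g s t) (hD : stepDet a ≠ 0) : t.x = nextX a s g := by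
  have h1 : s.x + (a.η * (a.α + a.ν)) • s.xg a =
      (1 + a.η * a.α) • t.x - a.η • t.y + a.η • g := by
    have e : s.x = t.x - (a.η * a.α) • (s.xg a - t.x) + a.η • (g - a.ν • s.xg a - t.y) := by
      nth_rw 1 [h.x]; abel
    nth_rw 1 [e]; module
  have h2 : s.y - (a.θ * a.β * a.ν) • s.xg a - (a.θ * a.ν⁻¹) • (s.yg a + s.zg a) =
      (1 + a.θ * a.β) • t.y + a.θ • t.x - (a.θ * a.β) • g := by
    have e : s.y = t.y - (a.θ * a.β) • (g - a.ν • s.xg a - t.y) +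
        a.θ • (a.ν⁻¹ • (s.yg a + s.zg a) + t.x) := by nth_rw 1 [h.y]; abel
    nth_rw 1 [e]; module
  rw [nextX, h1, h2, eq_inv_smul_iff₀ hD, stepDet]
  module

theorem IsStep.y_eq {a : Params} {W : Matrix (Fin n) (Fin n) ℝ} {g : Stacked n p}
    {s t : State n p} (h : IsStep a W g s t) (hD : stepDet a ≠ 0) : t.y = nextY a s g := by
  have h1 : s.x + (a.η * (a.α + a.ν)) • s.xg a =
      (1 + a.η * a.α) • t.x - a.η • t.y + a.η • g := by
    have e : s.x = t.x - (a.η * a.α) • (s.xg a - t.x) + a.η • (g - a.ν • s.xg a - t.y) := by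
      nth_rw 1 [h.x]; abel
    nth_rw 1 [e]; module
  have h2 : s.y - (a.θ * a.β * a.ν) • s.xg a - (a.θ * a.ν⁻¹) • (s.yg a + s.zg a) =
      (1 + a.θ * a.β) • t.y + a.θ • t.x - (a.θ * a.β) • g := by
    have e : s.y = t.y - (a.θ * a.β) • (g - a.ν • s.xg a - t.y) +
        a.θ • (a.ν⁻¹ • (s.yg a + s.zg a) + t.x) := by nth_rw 1 [h.y]; abel
    nth_rw 1 [e]; module
  rw [nextY, h1, h2, eq_inv_smul_iff₀ hD, stepDet]
  module

/-- An error v of the gradient enters the next iterate additively with a scalar factor. So the inner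
product of v with the next iterate is one with a quantity fixed before sampling, plus a multiple of
‖v‖². -/
theorem nextX_add (a : Params) (s : State n p) (g v : Stacked n p) :
    nextX a s (g + v) = nextX a s g - (a.η / stepDet a) • v := by
  unfold nextX
  module

theorem nextY_add (a : Params) (s : State n p) (g v : Stacked n p) :
    nextY a s (g + v) =
      nextY a s g + (((1 + a.η * a.α) * (a.θ * a.β) + a.θ * a.η) / stepDet a) • v := by
  unfold nextY
  module

/-- A class of random vectors closed under the operations of the algorithm. -/
structure IsLinearClass {Ω : Type*} (C : (Ω → Stacked n p) → Prop) : Prop where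
  add : ∀ u v, C u → C v → C (fun ω => u ω + v ω)
  smul : ∀ (c : ℝ) u, C u → C (fun ω => c • u ω)
  gossip : ∀ (W : Matrix (Fin n) (Fin n) ℝ) u, C u → C (fun ω => gossipApply W (u ω))

theorem IsLinearClass.sub {Ω : Type*} {C : (Ω → Stacked n p) → Prop} (hC : IsLinearClass C)
    (u v : Ω → Stacked n p) (hu : C u) (hv : C v) : C (fun ω => u ω - v ω) := by
  have := hC.add _ _ hu (hC.smul (-1) v hv)
  simpa [sub_eq_add_neg] using this

/-- All components of a random state belong to the class `C`. -/
structure State.All {Ω : Type*} (C : (Ω → Stacked n p) → Prop) (s : Ω → State n p) : Prop where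
  x : C fun ω => (s ω).x
  xf : C fun ω => (s ω).xf
  y : C fun ω => (s ω).y
  yf : C fun ω => (s ω).yf
  z : C fun ω => (s ω).z
  zf : C fun ω => (s ω).zf
  m : C fun ω => (s ω).m

namespace State.All

variable {Ω : Type*} {C : (Ω → Stacked n p) → Prop} {s t : Ω → State n p} {g : Ω → Stacked n p}

theorem xg (hs : State.All C s) (hC : IsLinearClass C) (a : Params) : C fun ω => (s ω).xg a :=
  hC.add _ _ (hC.smul _ _ hs.x) (hC.smul _ _ hs.xf)

theorem yg (hs : State.All C s) (hC : IsLinearClass C) (a : Params) : C fun ω => (s ω).yg a :=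
  hC.add _ _ (hC.smul _ _ hs.y) (hC.smul _ _ hs.yf)

theorem zg (hs : State.All C s) (hC : IsLinearClass C) (a : Params) : C fun ω => (s ω).zg a :=
  hC.add _ _ (hC.smul _ _ hs.z) (hC.smul _ _ hs.zf)

theorem nextX (hs : State.All C s) (hC : IsLinearClass C) (a : Params) (hg : C g) :
    C fun ω => nextX a (s ω) (g ω) :=
  hC.smul _ _ (hC.sub _ _ (hC.add _ _ (hC.smul _ _ (hC.add _ _ hs.x
    (hC.smul _ _ (hs.xg hC a)))) (hC.smul _ _ (hC.sub _ _ (hC.sub _ _ hs.y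
      (hC.smul _ _ (hs.xg hC a))) (hC.smul _ _ (hC.add _ _ (hs.yg hC a) (hs.zg hC a))))))
        (hC.smul _ _ hg))

theorem nextY (hs : State.All C s) (hC : IsLinearClass C) (a : Params) (hg : C g) :
    C fun ω => nextY a (s ω) (g ω) :=
  hC.smul _ _ (hC.add _ _ (hC.sub _ _ (hC.smul _ _ (hC.sub _ _ (hC.sub _ _ hs.y
      (hC.smul _ _ (hs.xg hC a))) (hC.smul _ _ (hC.add _ _ (hs.yg hC a) (hs.zg hC a)))))
    (hC.smul _ _ (hC.add _ _ hs.x (hC.smul _ _ (hs.xg hC a))))) (hC.smul _ _ hg))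

theorem step (hs : State.All C s) (hC : IsLinearClass C) {a : Params} (hD : stepDet a ≠ 0)
    {W : Matrix (Fin n) (Fin n) ℝ} (hg : C g) (h : ∀ ω, IsStep a W (g ω) (s ω) (t ω)) :
    State.All C t := by
  have hx : C fun ω => (t ω).x := by
    simp only [fun ω => (h ω).x_eq hD]; exact hs.nextX hC a hg
  have hy : C fun ω => (t ω).y := by
    simp only [fun ω => (h ω).y_eq hD]; exact hs.nextY hC a hg
  have hA := hC.add _ _ (hC.smul (a.ϰ * a.ν⁻¹) _ (hC.add _ _ (hs.yg hC a) (hs.zg hC a))) hs.m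
  refine ⟨hx, ?_, hy, ?_, ?_, ?_, ?_⟩
  · simp only [fun ω => (h ω).xf]
    exact hC.add _ _ (hs.xg hC a) (hC.smul _ _ (hC.sub _ _ hx hs.x))
  · simp only [fun ω => (h ω).yf]
    exact hC.add _ _ (hs.yg hC a) (hC.smul _ _ (hC.sub _ _ hy hs.y))
  · simp only [fun ω => (h ω).z]
    exact hC.sub _ _ (hC.add _ _ hs.z (hC.smul _ _ (hC.sub _ _ (hs.zg hC a) hs.z)))
      (hC.gossip _ _ hA)
  · simp only [fun ω => (h ω).zf]
    exact hC.sub _ _ (hs.zg hC a) (hC.smul _ _ (hC.gossip _ _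
      (hC.add _ _ (hs.yg hC a) (hs.zg hC a))))
  · simp only [fun ω => (h ω).m]
    exact hC.sub _ _ hA (hC.gossip _ _ hA)

end State.All

/-- All parameters are nonnegative and both left-hand sides are partial sums of the expanded
determinant. This yields the coefficient bounds of `noise_le`. -/
theorem stepDet_ge {μ L χ β : ℝ} (hμ : 0 < μ) (hβ : 0 < β) (hL : 0 ≤ L) (hχ : 1 ≤ χ) :
    1 ≤ stepDet (params μ L χ β) ∧
      (1 + (params μ L χ β).η * (params μ L χ β).α) * ((params μ L χ β).θ * (params μ L χ β).β) +
        (params μ L χ β).θ * (params μ L χ β).η ≤ stepDet (params μ L χ β) := by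
  have hχ0 : 0 < χ := by linarith
  have hη : 0 ≤ (params μ L χ β).η := by simp only [params]; positivity
  have hα : 0 ≤ (params μ L χ β).α := by simp only [params]; positivity
  have hθ : 0 ≤ (params μ L χ β).θ := by simp only [params]; positivity
  have hβ' : 0 ≤ (params μ L χ β).β := hβ.le
  generalize params μ L χ β = a at *
  unfold stepDet
  have h1 := mul_nonneg hη hα
  have h2 := mul_nonneg hθ hβ'
  have h3 := mul_nonneg hη hθ
  have h4 := mul_nonneg h1 h2
  constructor <;> nlinarith

/-- Here c collects the feedback of ζ through both variables. Twice c plus c from Young's inequality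
gives 3c ≤ 6κ in front of ‖ζ‖², and 8/μ + 4β + c ≤ 14/μ in front of ‖b‖². -/
theorem noise_combine {μ β κ a₁ a₂ c nζ nb nX nY iζX iζY iζb ibX ibY : ℝ} (hc : c = a₁ + β * a₂)
    (f1 : -2 * ibX ≤ μ / 8 * nX + 8 / μ * nb) (f2 : β * (2 * ibY) ≤ β * (1 / 4 * nY + 4 * nb))
    (f3 : c * (2 * iζb) ≤ c * (nζ + nb)) (hc1 : c ≤ 2 * κ)
    (hβκ : β ≤ κ) (hκμ : κ ≤ 1 / μ) (hζ : 0 ≤ nζ) (hb : 0 ≤ nb) :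
    -2 * (iζX - a₁ * (nζ + iζb) + ibX) + 2 * β * (iζY + a₂ * (nζ + iζb) + ibY) ≤
      μ / 8 * nX + β / 4 * nY + (-2 * iζX + 2 * β * iζY) + 6 * κ * nζ + 14 / μ * nb := by
  have hκ : κ * nb ≤ 1 / μ * nb := by gcongr
  have f4 : c * nζ ≤ 2 * κ * nζ := by gcongr
  have f5 : c * nb ≤ 2 * κ * nb := by gcongr
  have f6 : β * nb ≤ κ * nb := by gcongr
  have f7 : 14 / μ * nb = 8 / μ * nb + 6 * (1 / μ * nb) := by ring
  have f8 : a₁ = c - β * a₂ := by rw [hc]; ring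
  rw [f7, f8]
  linarith

/-- The bias b is correlated with the next iterate, and Young's inequality trades it for exactly the
surplus μ/8 and β/4 kept on the left of `stateLyapunov_le`. The sampling error ζ is instead paired
with the noise-free next iterate, a term of mean zero, at the price of a multiple of ‖ζ‖². -/
theorem IsStep.noise_le {μ L χ β : ℝ} (hμ : 0 < μ) (hβ : 0 < β) (hL : 0 ≤ L) (hχ : 1 ≤ χ)
    (hβμ : β * μ ≤ 1) {W : Matrix (Fin n) (Fin n) ℝ} {s t : State n p}
    {G ζ b xs ys : Stacked n p} (h : IsStep (params μ L χ β) W (G + (ζ + b)) s t) :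
    -2 * ⟪ζ + b, t.x - xs⟫ + 2 * β * ⟪ζ + b, t.y - ys⟫ ≤
      μ / 8 * ‖t.x - xs‖ ^ 2 + β / 4 * ‖t.y - ys‖ ^ 2 +
      (-2 * ⟪ζ, nextX (params μ L χ β) s G - xs⟫ +
        2 * β * ⟪ζ, nextY (params μ L χ β) s G - ys⟫) +
      6 * (β / √(β * μ)) * ‖ζ‖ ^ 2 + 14 / μ * ‖b‖ ^ 2 := by
  obtain ⟨hD1, hD2⟩ := stepDet_ge hμ hβ hL hχ
  have hχ0 : 0 < χ := by linarith
  have hD0 : 0 < stepDet (params μ L χ β) := by linarith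
  have hr : 0 < √(β * μ) := Real.sqrt_pos.2 (by positivity)
  have hr2 : √(β * μ) ^ 2 = β * μ := Real.sq_sqrt (by positivity)
  have hr1 : √(β * μ) ≤ 1 := Real.sqrt_le_one.2 hβμ
  have hx := h.x_eq hD0.ne'
  have hy := h.y_eq hD0.ne'
  rw [nextX_add] at hx
  rw [nextY_add] at hy
  set a := params μ L χ β
  have hη0 : 0 ≤ a.η := by simp only [a, params]; positivity
  have hη : a.η ≤ β / √(β * μ) := by
    simp only [a, params]
    rw [inv_le_comm₀ (by positivity) (by positivity), inv_div]
    have : √(β * μ) / β = 1 / β * √(β * μ) := by ring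
    rw [this]
    gcongr
    linarith
  have hA0 : 0 ≤ (1 + a.η * a.α) * (a.θ * a.β) + a.θ * a.η := by
    have hα : 0 ≤ a.α := by simp only [a, params]; positivity
    have hθ : 0 ≤ a.θ := by simp only [a, params]; positivity
    have hβ' : 0 ≤ a.β := hβ.le
    positivity
  set a₁ := a.η / stepDet a with ha1
  set a₂ := ((1 + a.η * a.α) * (a.θ * a.β) + a.θ * a.η) / stepDet a with ha2
  have h10 : 0 ≤ a₁ := by positivity
  have h11 : a₁ ≤ β / √(β * μ) := (div_le_self hη0 hD1).trans hη
  have h20 : 0 ≤ a₂ := by positivity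
  have h21 : a₂ ≤ 1 := (div_le_one hD0).2 hD2
  have hβr : β ≤ β / √(β * μ) := by rw [le_div_iff₀ hr]; nlinarith
  have hrμ : β / √(β * μ) ≤ 1 / μ := by
    rw [div_le_div_iff₀ hr hμ, one_mul]; nlinarith only [hr2, hr1, hr]
  set κ := β / √(β * μ)
  set c := a₁ + β * a₂ with hc
  have hc0 : 0 ≤ c := by positivity
  have hc1 : c ≤ 2 * κ := by nlinarith
  have e1 : ⟪ζ, t.x - xs⟫ = ⟪ζ, nextX a s G - xs⟫ - a₁ * (‖ζ‖ ^ 2 + ⟪ζ, b⟫) := by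
    rw [hx, ← real_inner_self_eq_norm_sq, ← inner_add_right, ← real_inner_smul_right,
      ← inner_sub_right]
    congr 1; abel
  have e2 : ⟪ζ, t.y - ys⟫ = ⟪ζ, nextY a s G - ys⟫ + a₂ * (‖ζ‖ ^ 2 + ⟪ζ, b⟫) := by
    rw [hy, ← real_inner_self_eq_norm_sq, ← inner_add_right, ← real_inner_smul_right,
      ← inner_add_right]
    congr 1; abel
  rw [inner_add_left, inner_add_left, e1, e2]
  have f1 : -2 * ⟪b, t.x - xs⟫ ≤ μ / 8 * ‖t.x - xs‖ ^ 2 + 8 / μ * ‖b‖ ^ 2 := by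
    have := norm_add_sq_expand (8 • b) (μ • (t.x - xs))
    rw [← Nat.cast_smul_eq_nsmul ℝ, norm_smul_sq, norm_smul_sq, real_inner_smul_left,
      real_inner_smul_right] at this
    have h0 := sq_nonneg ‖((8 : ℕ) : ℝ) • b + μ • (t.x - xs)‖
    rw [this] at h0
    push_cast at h0
    have h1 : μ / 8 * ‖t.x - xs‖ ^ 2 + 8 / μ * ‖b‖ ^ 2 + 2 * ⟪b, t.x - xs⟫ =
        (8 ^ 2 * ‖b‖ ^ 2 + 2 * (8 * (μ * ⟪b, t.x - xs⟫)) + μ ^ 2 * ‖t.x - xs‖ ^ 2) / (8 * μ) := by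
      field_simp; ring
    have h2 := div_nonneg h0 (by positivity : 0 ≤ 8 * μ)
    rw [← h1] at h2
    linarith
  have f2 : 2 * ⟪b, t.y - ys⟫ ≤ 1 / 4 * ‖t.y - ys‖ ^ 2 + 4 * ‖b‖ ^ 2 := by
    have := norm_sub_sq_expand ((4 : ℝ) • b) (t.y - ys)
    rw [norm_smul_sq, real_inner_smul_left] at this
    nlinarith [sq_nonneg ‖(4 : ℝ) • b - (t.y - ys)‖]
  have f3 : 2 * ⟪ζ, b⟫ ≤ ‖ζ‖ ^ 2 + ‖b‖ ^ 2 := by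
    have := norm_sub_sq_expand ζ b
    nlinarith [sq_nonneg ‖ζ - b‖]
  have f2' : β * (2 * ⟪b, t.y - ys⟫) ≤ β * (1 / 4 * ‖t.y - ys‖ ^ 2 + 4 * ‖b‖ ^ 2) := by gcongr
  have f3' : c * (2 * ⟪ζ, b⟫) ≤ c * (‖ζ‖ ^ 2 + ‖b‖ ^ 2) := by gcongr
  have f4 : c * ‖ζ‖ ^ 2 ≤ 2 * κ * ‖ζ‖ ^ 2 := by gcongr
  exact noise_combine hc f1 f2' f3' hc1 hβr hrμ (sq_nonneg _) (sq_nonneg _)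

theorem IsStep.stateLyapunov_noisy_le {H : Stacked n p → ℝ} {G : Stacked n p → Stacked n p}
    {Q : Set (Stacked n p)} {μ β L χ : ℝ} {xs : Stacked n p} (hH : IsSmoothProblem H G Q μ L xs)
    (hμ : 0 < μ) (hβ : 0 < β) (hL : 0 ≤ L) (hβL : β * (8 * L + 2 * μ) ≤ 1) (hχ : 1 ≤ χ)
    {W : Matrix (Fin n) (Fin n) ℝ} (hW : IsGossip W p χ) {g ζ b : Stacked n p} {s t : State n p}
    (h : IsStep (params μ L χ β) W g s t) (hz : s.z ∈ consensusPerp n p)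
    (hzf : s.zf ∈ consensusPerp n p) (hxg : s.xg (params μ L χ β) ∈ Q)
    (hxf' : t.xf ∈ Q) (hg : g = G (s.xg (params μ L χ β)) + (ζ + b)) :
    stateLyapunov H (G xs) xs μ β L χ t ≤
      (1 - √(β * μ) / (32 * χ)) * stateLyapunov H (G xs) xs μ β L χ s +
        (-2 * ⟪ζ, nextX (params μ L χ β) s (G (s.xg (params μ L χ β))) - xs⟫ +
          2 * β * ⟪ζ, nextY (params μ L χ β) s (G (s.xg (params μ L χ β))) -
            (G xs - (μ / 2) • xs)⟫) +
        6 * (β / √(β * μ)) * ‖ζ‖ ^ 2 + 14 / μ * ‖b‖ ^ 2 := by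
  have h1 := h.stateLyapunov_le hH hμ hβ hL hβL hχ hW hz hzf hxg hxf'
  have hβμ : β * μ ≤ 1 := by nlinarith [mul_nonneg hβ.le hL, mul_pos hβ hμ]
  subst hg
  have h2 := h.noise_le (xs := xs) (ys := G xs - (μ / 2) • xs) hμ hβ hL hχ hβμ
  rw [add_sub_cancel_left] at h1
  linarith

end ExplicitStep

/-! ### The two-point estimator for a fixed query point. -/

section Oracle

variable {n p : ℕ} {Ξ : Type*} [MeasurableSpace Ξ]

theorem unifSphere_eq : unifSphere n p = sphereUnif volume := rfl

theorem finrank_stacked : Module.finrank ℝ (Stacked n p) = n * p := by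
  rw [LinearEquiv.finrank_eq (WithLp.linearEquiv 2 ℝ (Fin n → Node p)),
    Module.finrank_pi_fintype]
  simp

theorem nontrivial_stacked (hn : 1 ≤ n) (hp : 1 ≤ p) : Nontrivial (Stacked n p) := by
  refine Module.nontrivial_of_finrank_pos (R := ℝ) ?_
  rw [finrank_stacked]
  exact Nat.mul_pos hn hp

theorem inner_gradient_eq_zero {E : Type*} [NormedAddCommGroup E] [InnerProductSpace ℝ E]
    [CompleteSpace E] {H : E → ℝ} {g x c : E} (hG : HasGradientAt H g x)
    (hmin : ∀ t : ℝ, H x ≤ H (x + t • c)) : ⟪g, c⟫ = 0 := by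
  have h1 : HasDerivAt (fun t : ℝ => x + t • c) c 0 := by
    simpa using ((hasDerivAt_id (0 : ℝ)).smul_const c).const_add x
  have h2 : HasFDerivAt H (InnerProductSpace.toDual ℝ _ g) (x + (0 : ℝ) • c) := by
    rw [zero_smul, add_zero]
    exact hG.hasFDerivAt
  have h3 := h2.comp_hasDerivAt (0 : ℝ) h1
  have h4 : IsLocalMin (H ∘ fun t : ℝ => x + t • c) 0 :=
    .of_forall fun t => by simpa using hmin t
  simpa using h4.hasDerivAt_eq_zero h3

/-- The first-order optimality condition over the consensus space. -/
theorem mem_consensusPerp_of_isMinOn {H : Stacked n p → ℝ} {g xs : Stacked n p}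
    (hG : HasGradientAt H g xs) (hxs : xs ∈ consensus n p) (hmin : IsMinOn H (consensus n p) xs) :
    g ∈ consensusPerp n p :=
  mem_consensusPerp_of_inner_eq_zero fun _ hc => inner_gradient_eq_zero hG fun t =>
    isMinOn_iff.1 hmin _ (consensus_add hxs (consensus_smul t hc))

theorem norm_sq_eq_sum (x : Stacked n p) : ‖x‖ ^ 2 = ∑ i, ‖x i‖ ^ 2 := PiLp.norm_sq_eq_of_L2 _ x

namespace Admissible

variable {P : Measure Ξ} {f : Fin n → Node p → Ξ → ℝ} {δ : Stacked n p → Ξ → ℝ}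
  {Q : Set (Stacked n p)} {μ M γ Δ : ℝ}

theorem measurable_total (h : Admissible P f δ Q μ M γ Δ) :
    Measurable (Function.uncurry (total f)) := by
  unfold Function.uncurry total
  refine Finset.measurable_sum _ fun i _ => ?_
  exact (h.measurable_f i).comp (by fun_prop : Measurable fun a : Stacked n p × Ξ => (a.1 i, a.2))

theorem integrable_total (h : Admissible P f δ Q μ M γ Δ) (x : Stacked n p) :
    Integrable (total f x) P := by
  have : total f x = fun ξ => ∑ i, f i (x i) ξ := rfl
  rw [this]
  exact integrable_finsetSum _ fun i _ => h.integrable_f i _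

theorem strongConvexOn_objective (h : Admissible P f δ Q μ M γ Δ) :
    StrongConvexOn Set.univ μ (objective P f) := by
  have e : ∀ x, objective P f x = ∑ i, ∫ ξ, f i (x i) ξ ∂P := fun x =>
    integral_finsetSum _ fun i _ => h.integrable_f i _
  refine ⟨convex_univ, fun x _ y _ a b ha hb hab => ?_⟩
  rw [e, e, e]
  simp only [smul_eq_mul]
  rw [norm_sq_eq_sum, Finset.mul_sum, Finset.mul_sum, Finset.mul_sum, Finset.mul_sum,
    ← Finset.sum_add_distrib, ← Finset.sum_sub_distrib]
  refine Finset.sum_le_sum fun i _ => ?_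
  have := (h.strongConvex i).2 (Set.mem_univ (x i)) (Set.mem_univ (y i)) ha hb hab
  simpa using this

theorem convexOn_objective (h : Admissible P f δ Q μ M γ Δ) (hμ : 0 < μ) :
    ConvexOn ℝ Set.univ (objective P f) :=
  (h.strongConvexOn_objective.strictConvexOn hμ).convexOn

theorem continuous_objective [Nontrivial (Stacked n p)] (h : Admissible P f δ Q μ M γ Δ) (hμ : 0 < μ) :
    Continuous (objective P f) :=
  (locallyLipschitz_of_strongConvexOn hμ h.strongConvexOn_objective).continuous

/-- The mean of the random Lipschitz constant is at most M, because its variance is nonnegative. -/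
theorem lipschitz_objective [IsProbabilityMeasure P] (h : Admissible P f δ Q μ M γ Δ)
    (hM : 0 ≤ M) : ∀ x ∈ Q + Metric.closedBall 0 γ, ∀ y ∈ Q + Metric.closedBall 0 γ,
      |objective P f y - objective P f x| ≤ M * ‖y - x‖ := by
  obtain ⟨K, hK, hK2, hKM, hL⟩ := h.lipschitz
  intro x hx y hy
  have hK1 : Integrable K P :=
    ((memLp_two_iff_integrable_sq hK.aestronglyMeasurable).2 hK2).integrable one_le_two
  have h1 : ∫ ξ, K ξ ∂P ≤ M := by
    have h0 : 0 ≤ ∫ ξ, (K ξ - ∫ ξ, K ξ ∂P) ^ 2 ∂P := integral_nonneg fun _ => sq_nonneg _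
    set c := ∫ ξ, K ξ ∂P with hc
    have h2 : ∫ ξ, (K ξ - c) ^ 2 ∂P = ∫ ξ, K ξ ^ 2 ∂P - c ^ 2 := by
      have : ∀ ξ, (K ξ - c) ^ 2 = K ξ ^ 2 - (2 * c) * K ξ + c ^ 2 := fun ξ => by ring
      simp only [this]
      have i1 : Integrable (fun ξ => K ξ ^ 2 - 2 * c * K ξ) P := hK2.sub (hK1.const_mul _)
      rw [integral_add i1 (integrable_const _),
        integral_sub hK2 (hK1.const_mul _), integral_const_mul, ← hc]
      simp
      ring
    exact abs_le_of_sq_le_sq' (by linarith) hM |>.2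
  calc |objective P f y - objective P f x| = |∫ ξ, (total f y ξ - total f x ξ) ∂P| := by
        rw [integral_sub (h.integrable_total y) (h.integrable_total x)]; rfl
    _ ≤ ∫ ξ, |total f y ξ - total f x ξ| ∂P := abs_integral_le_integral_abs
    _ ≤ ∫ ξ, K ξ * ‖y - x‖ ∂P :=
        integral_mono ((h.integrable_total y).sub (h.integrable_total x)).abs
          (hK1.mul_const _) fun ξ => hL ξ x hx y hy
    _ = (∫ ξ, K ξ ∂P) * ‖y - x‖ := integral_mul_const _ _
    _ ≤ M * ‖y - x‖ := by gcongr

end Admissible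

/-- The two-point estimator without noise, as a function of the sample. -/
def cleanEstimator (f : Fin n → Node p → Ξ → ℝ) (γ : ℝ) (x : Stacked n p) (s : Ξ × Stacked n p) :
    Stacked n p :=
  twoPoint f (fun _ _ => 0) γ x s.1 s.2

theorem cleanEstimator_eq (f : Fin n → Node p → Ξ → ℝ) (γ : ℝ) (x : Stacked n p)
    (s : Ξ × Stacked n p) : cleanEstimator f γ x s =
      (((n * p : ℕ) : ℝ) / (2 * γ) * (total f (x + γ • s.2) s.1 - total f (x - γ • s.2) s.1)) •
        s.2 := by
  simp [cleanEstimator, twoPoint]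

namespace Admissible

variable {P : Measure Ξ} {f : Fin n → Node p → Ξ → ℝ} {δ : Stacked n p → Ξ → ℝ}
  {Q : Set (Stacked n p)} {μ M γ Δ : ℝ}

theorem measurable_cleanEstimator (h : Admissible P f δ Q μ M γ Δ) :
    Measurable (Function.uncurry (cleanEstimator f γ)) := by
  unfold Function.uncurry
  simp only [cleanEstimator_eq]
  have h1 : Measurable fun a : Stacked n p × (Ξ × Stacked n p) =>
      total f (a.1 + γ • a.2.2) a.2.1 :=
    h.measurable_total.comp (by fun_prop :
      Measurable fun a : Stacked n p × (Ξ × Stacked n p) => (a.1 + γ • a.2.2, a.2.1))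
  have h2 : Measurable fun a : Stacked n p × (Ξ × Stacked n p) =>
      total f (a.1 - γ • a.2.2) a.2.1 :=
    h.measurable_total.comp (by fun_prop :
      Measurable fun a : Stacked n p × (Ξ × Stacked n p) => (a.1 - γ • a.2.2, a.2.1))
  exact ((h1.sub h2).const_mul _).smul (by fun_prop)

/-- For fixed ξ the map e ↦ F(x + γe, ξ) is γK(ξ)-Lipschitz on the unit ball, and the estimator sees
only its odd part. Concentration gives (d/2γ)² · 90 γ²K²/d = (45/2) d K². -/
theorem lintegral_cleanEstimator_le [Nontrivial (Stacked n p)] [IsProbabilityMeasure P]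
    (h : Admissible P f δ Q μ M γ Δ)
    (hγ : 0 < γ) {x : Stacked n p} (hx : x ∈ Q) :
    ∫⁻ s, ‖cleanEstimator f γ x s‖ₑ ^ 2 ∂(P.prod (unifSphere n p)) ≤
      ENNReal.ofReal (45 / 2 * (n * p : ℕ) * M ^ 2) := by
  obtain ⟨K, hK, hK2, hKM, hL⟩ := h.lipschitz
  have hd : (0 : ℝ) < (n * p : ℕ) := by
    rw [← finrank_stacked]; exact_mod_cast Module.finrank_pos
  have : IsProbabilityMeasure (unifSphere n p) := by rw [unifSphere_eq]; infer_instance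
  have hmeas : Measurable fun s => ‖cleanEstimator f γ x s‖ₑ ^ 2 :=
    ((h.measurable_cleanEstimator.comp (measurable_const.prodMk measurable_id)).enorm.pow_const 2 :)
  rw [lintegral_prod _ hmeas.aemeasurable]
  have key : ∀ ξ, ∫⁻ e, ‖cleanEstimator f γ x (ξ, e)‖ₑ ^ 2 ∂(unifSphere n p) ≤
      ENNReal.ofReal (45 / 2 * (n * p : ℕ) * K ξ ^ 2) := by
    intro ξ
    set k : Stacked n p → ℝ := fun e => total f (x + γ • e) ξ with hk
    have hkL : LipschitzOnWith (γ * K ξ).toNNReal k (Metric.closedBall 0 1) := by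
      refine LipschitzOnWith.of_dist_le_mul fun a ha b hb => ?_
      rw [Real.dist_eq, dist_eq_norm]
      refine (hL ξ _ (add_smul_mem_add_closedBall hγ hx (by simpa using hb)) _
        (add_smul_mem_add_closedBall hγ hx (by simpa using ha))).trans ?_
      have : x + γ • a - (x + γ • b) = γ • (a - b) := by module
      rw [this, norm_smul, Real.norm_of_nonneg hγ.le, ← mul_assoc, mul_comm (K ξ) γ]
      gcongr
      exact Real.le_coe_toNNReal _
    have h1 := integral_sphereUnif_sub_neg_sq_le volume hkL
    rw [finrank_stacked] at h1
    have hkm : Measurable k := h.measurable_total.comp (by fun_prop :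
      Measurable fun e : Stacked n p => (x + γ • e, ξ))
    have hb : ∀ e : Stacked n p, ‖e‖ = 1 → ‖(k e - k (-e)) ^ 2‖ ≤ (2 * (γ * K ξ).toNNReal) ^ 2 := by
      intro e he
      have h2 := hkL.dist_le_mul e (by simp [he]) (-e) (by simp [he])
      rw [Real.dist_eq, dist_eq_norm, sub_neg_eq_add, ← two_smul ℝ e, norm_smul, he] at h2
      rw [Real.norm_of_nonneg (sq_nonneg _), ← sq_abs]
      gcongr
      refine h2.trans (le_of_eq ?_)
      norm_num [mul_comm]
    have hki : Integrable (fun e => (k e - k (-e)) ^ 2) (unifSphere n p) :=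
      integrable_sphereUnif_of_bound volume
        (((hkm.sub (hkm.comp measurable_neg)).pow_const 2).aestronglyMeasurable) _ hb
    have h3 : ∀ᵐ e ∂(unifSphere n p), ‖cleanEstimator f γ x (ξ, e)‖ₑ ^ 2 =
        ENNReal.ofReal (((n * p : ℕ) / (2 * γ)) ^ 2 * (k e - k (-e)) ^ 2) := by
      filter_upwards [ae_norm_eq_one_sphereUnif volume] with e he
      rw [← ofReal_norm, ← ENNReal.ofReal_pow (norm_nonneg _), cleanEstimator_eq, norm_smul,
        he, mul_one, Real.norm_eq_abs, sq_abs, mul_pow]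
      simp [hk, sub_eq_add_neg]
    rw [lintegral_congr_ae h3, ← ofReal_integral_eq_lintegral_ofReal (hki.const_mul _)
      (.of_forall fun e => by positivity), integral_const_mul]
    refine ENNReal.ofReal_le_ofReal ?_
    have h4 : ((γ * K ξ).toNNReal : ℝ) ^ 2 ≤ (γ * K ξ) ^ 2 := by
      rw [Real.coe_toNNReal', ← sq_abs (γ * K ξ)]
      gcongr
      exact max_le (le_abs_self _) (abs_nonneg _)
    calc _ ≤ ((n * p : ℕ) / (2 * γ)) ^ 2 * (90 * (γ * K ξ) ^ 2 / (n * p : ℕ)) := by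
          gcongr
          exact h1.trans (by gcongr)
      _ = _ := by field_simp; ring
  refine (lintegral_mono key).trans ?_
  rw [← ofReal_integral_eq_lintegral_ofReal (hK2.const_mul _)
    (.of_forall fun e => by positivity), integral_const_mul]
  exact ENNReal.ofReal_le_ofReal (by gcongr)

theorem memLp_cleanEstimator [Nontrivial (Stacked n p)] [IsProbabilityMeasure P]
    (h : Admissible P f δ Q μ M γ Δ)
    (hγ : 0 < γ) {x : Stacked n p} (hx : x ∈ Q) :
    MemLp (cleanEstimator f γ x) 2 (P.prod (unifSphere n p)) := by
  refine ⟨(h.measurable_cleanEstimator.comp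
    (measurable_const.prodMk measurable_id)).aestronglyMeasurable, ?_⟩
  rw [eLpNorm_lt_top_iff_lintegral_rpow_enorm_lt_top two_ne_zero ENNReal.ofNat_ne_top]
  have := h.lintegral_cleanEstimator_le hγ hx
  simpa using this.trans_lt ENNReal.ofReal_lt_top

/-- The reflection e ↦ -e makes the two halves of the difference contribute equally, which cancels
the factor 2 in d/(2γ). -/
theorem integral_cleanEstimator [Nontrivial (Stacked n p)] [IsProbabilityMeasure P]
    (h : Admissible P f δ Q μ M γ Δ) (hμ : 0 < μ)
    (hγ : 0 < γ) {x : Stacked n p} (hx : x ∈ Q) :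
    ∫ s, cleanEstimator f γ x s ∂(P.prod (unifSphere n p)) =
      sphereGrad volume (objective P f) γ x := by
  have : IsProbabilityMeasure (unifSphere n p) := by rw [unifSphere_eq]; infer_instance
  have hi := (h.memLp_cleanEstimator hγ hx).integrable one_le_two
  rw [integral_prod_symm _ hi]
  have hc := h.continuous_objective hμ
  set F := objective P f
  have h1 : ∀ e, ∫ ξ, cleanEstimator f γ x (ξ, e) ∂P =
      ((n * p : ℕ) / (2 * γ) : ℝ) • (F (x + γ • e) • e - F (x - γ • e) • e) := by
    intro e
    simp only [cleanEstimator_eq]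
    rw [integral_smul_const, integral_const_mul,
      integral_sub (h.integrable_total _) (h.integrable_total _), ← sub_smul, smul_smul]
    rfl
  simp only [h1]
  have i1 : Integrable (fun e => F (x + γ • e) • e) (unifSphere n p) :=
    integrable_sphereUnif_of_continuous volume (by fun_prop)
  have i2 : Integrable (fun e => F (x - γ • e) • e) (unifSphere n p) :=
    integrable_sphereUnif_of_continuous volume (by fun_prop)
  rw [integral_smul, integral_sub i1 i2]
  have h2 : ∫ e, F (x - γ • e) • e ∂(unifSphere n p) = -∫ e, F (x + γ • e) • e ∂(unifSphere n p) := by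
    refine ext_inner_left ℝ fun v => ?_
    rw [inner_neg_right, ← integral_inner i2, ← integral_inner i1, unifSphere_eq,
      ← integral_sphereUnif_neg volume, ← integral_neg]
    simp
  rw [h2, sphereGrad, finrank_stacked, sub_neg_eq_add, ← two_smul ℝ, smul_smul]
  congr 1
  field_simp

theorem isSmoothProblem [Nontrivial (Stacked n p)] [IsProbabilityMeasure P]
    (h : Admissible P f δ Q μ M γ Δ) (hμ : 0 < μ) (hM : 0 < M) (hγ : 0 < γ) {xs : Stacked n p}
    (hxs : xs ∈ consensus n p) (hmin : IsMinOn (smoothed (objective P f) γ) (consensus n p) xs)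
    (hQ : xs ∈ Q) :
    IsSmoothProblem (smoothed (objective P f) γ) (sphereGrad volume (objective P f) γ) Q μ
      (√(n * p : ℕ) * M / γ) xs := by
  have hsc := h.strongConvexOn_objective
  have hc := h.convexOn_objective hμ
  have hLip := h.lipschitz_objective hM.le
  have hll := locallyLipschitz_of_strongConvexOn hμ hsc
  have hcont := hll.continuous
  have hG := hasGradientAt_ballSmooth volume hll hγ
  refine ⟨h.convex_Q, hQ, hxs, mem_consensusPerp_of_isMinOn (hG xs) hxs hmin,
    fun x hx y hy => ?_, fun x hx => ?_, fun x y => ?_⟩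
  · have := ballSmooth_descent volume hγ hM.le hc h.convex_Q hLip hx hy
    rwa [finrank_stacked] at this
  · have := ballSmooth_cocoercive volume hγ hM hc h.convex_Q hLip hx hQ
    rwa [finrank_stacked] at this
  · exact strongConvex_first_order (strongConvexOn_ballSmooth volume hsc hcont γ) (hG x) y

theorem gradient_smoothed [Nontrivial (Stacked n p)]
    (h : Admissible P f δ Q μ M γ Δ) (hμ : 0 < μ) (hγ : 0 < γ) (x : Stacked n p) :
    gradient (smoothed (objective P f) γ) x = sphereGrad volume (objective P f) γ x :=
  (hasGradientAt_ballSmooth volume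
    (locallyLipschitz_of_strongConvexOn hμ h.strongConvexOn_objective) hγ x).gradient

end Admissible

end Oracle

/-! ### Integration against independent variables. -/

section Independence

variable {Ω α β : Type*} [MeasurableSpace Ω] [MeasurableSpace α] [MeasurableSpace β]
  {Pr : Measure Ω} [IsProbabilityMeasure Pr] {Y : Ω → α} {Z : Ω → β}

theorem lintegral_comp_indepFun (hY : Measurable Y) (hZ : Measurable Z) (h : IndepFun Y Z Pr)
    {φ : α → β → ENNReal} (hφ : Measurable (Function.uncurry φ)) :
    ∫⁻ ω, φ (Y ω) (Z ω) ∂Pr = ∫⁻ ω, ∫⁻ z, φ (Y ω) z ∂(Pr.map Z) ∂Pr := by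
  have := Measure.isProbabilityMeasure_map hZ.aemeasurable (μ := Pr)
  have h1 := (indepFun_iff_map_prod_eq_prod_map_map hY.aemeasurable hZ.aemeasurable).1 h
  have h2 : ∫⁻ ω, φ (Y ω) (Z ω) ∂Pr =
      ∫⁻ a, Function.uncurry φ a ∂(Pr.map fun ω => (Y ω, Z ω)) := by
    rw [lintegral_map hφ (hY.prodMk hZ)]; rfl
  rw [h2, h1, lintegral_prod _ hφ.aemeasurable, lintegral_map hφ.lintegral_prod_right' hY]
  rfl

theorem integral_comp_indepFun (hY : Measurable Y) (hZ : Measurable Z) (h : IndepFun Y Z Pr)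
    {φ : α → β → ℝ} (hφ : Measurable (Function.uncurry φ))
    (hi : Integrable (fun ω => φ (Y ω) (Z ω)) Pr) :
    ∫ ω, φ (Y ω) (Z ω) ∂Pr = ∫ ω, ∫ z, φ (Y ω) z ∂(Pr.map Z) ∂Pr := by
  have := Measure.isProbabilityMeasure_map hZ.aemeasurable (μ := Pr)
  have h1 := (indepFun_iff_map_prod_eq_prod_map_map hY.aemeasurable hZ.aemeasurable).1 h
  have h2 : ∫ ω, φ (Y ω) (Z ω) ∂Pr =
      ∫ a, Function.uncurry φ a ∂(Pr.map fun ω => (Y ω, Z ω)) := by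
    rw [integral_map (hY.prodMk hZ).aemeasurable hφ.aestronglyMeasurable]; rfl
  have h3 : Integrable (Function.uncurry φ) (Pr.map fun ω => (Y ω, Z ω)) :=
    (integrable_map_measure hφ.aestronglyMeasurable (hY.prodMk hZ).aemeasurable).2 hi
  rw [h1] at h2 h3
  rw [h2, integral_prod _ h3]
  exact integral_map hY.aemeasurable
    hφ.stronglyMeasurable.integral_prod_right.aestronglyMeasurable

theorem integrable_inner_of_memLp {E : Type*} [NormedAddCommGroup E] [InnerProductSpace ℝ E]
    {X V : Ω → E} (hX : MemLp X 2 Pr) (hV : MemLp V 2 Pr) :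
    Integrable (fun ω => ⟪X ω, V ω⟫) Pr := by
  refine ((hX.integrable_norm_pow two_ne_zero).add (hV.integrable_norm_pow two_ne_zero)).mono'
    (hX.1.inner hV.1) (.of_forall fun ω => ?_)
  have h1 := norm_inner_le_norm (𝕜 := ℝ) (X ω) (V ω)
  simp only [Pi.add_apply]
  nlinarith [sq_nonneg (‖X ω‖ - ‖V ω‖), norm_nonneg (X ω), norm_nonneg (V ω)]

end Independence

/-! ### The estimator at a random query point independent of the sample. -/

section Sampling

variable {n p : ℕ} {Ξ : Type*} [MeasurableSpace Ξ] {Ω : Type*} [mΩ : MeasurableSpace Ω]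
  {Pr : Measure Ω} [IsProbabilityMeasure Pr] {P : Measure Ξ} [IsProbabilityMeasure P] {B : ℕ}
  {S : ℕ × Fin B → Ω → Ξ × Stacked n p}

/-- The σ-algebra generated by the samples with indices in `J`. -/
abbrev sampleSigma (S : ℕ × Fin B → Ω → Ξ × Stacked n p) (J : Set (ℕ × Fin B)) : MeasurableSpace Ω :=
  ⨆ j ∈ J, MeasurableSpace.comap (S j) inferInstance

theorem sampleSigma_mono {J K : Set (ℕ × Fin B)} (h : J ⊆ K) : sampleSigma S J ≤ sampleSigma S K :=
  biSup_mono h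

theorem measurable_sample {J : Set (ℕ × Fin B)} {j : ℕ × Fin B} (hj : j ∈ J) :
    Measurable[sampleSigma S J] (S j) :=
  measurable_iff_comap_le.2 (le_biSup (fun j => MeasurableSpace.comap (S j) inferInstance) hj)

theorem IsSampling.sampleSigma_le (hS : IsSampling Pr P S) (J : Set (ℕ × Fin B)) :
    sampleSigma S J ≤ mΩ :=
  iSup₂_le fun j _ => (hS.measurable j).comap_le

theorem IsSampling.indepFun (hS : IsSampling Pr P S) {α : Type*} [MeasurableSpace α]
    {J : Set (ℕ × Fin B)} {i : ℕ × Fin B} (hi : i ∉ J) {Y : Ω → α}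
    (hY : Measurable[sampleSigma S J] Y) : IndepFun Y (S i) Pr := by
  have h1 := indep_iSup_of_disjoint (fun j => (hS.measurable j).comap_le) hS.indep
    (Set.disjoint_singleton_right.2 hi)
  rw [IndepFun_iff_Indep]
  refine indep_of_indep_of_le_left (indep_of_indep_of_le_right h1 ?_)
    (measurable_iff_comap_le.1 hY)
  exact le_biSup (fun j => MeasurableSpace.comap (S j) inferInstance) (Set.mem_singleton i)

variable {f : Fin n → Node p → Ξ → ℝ} {δ : Stacked n p → Ξ → ℝ} {Q : Set (Stacked n p)}
  {μ M γ Δ : ℝ} [Nontrivial (Stacked n p)]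

/-- The variance bound for the two-point estimator. -/
def estimatorVar (n p : ℕ) (M : ℝ) : ℝ := 45 / 2 * (n * p : ℕ) * M ^ 2

theorem estimatorVar_nonneg (n p : ℕ) (M : ℝ) : 0 ≤ estimatorVar n p M := by
  unfold estimatorVar; positivity

theorem IsSampling.measurable_cleanEstimator (h : Admissible P f δ Q μ M γ Δ)
    {m : MeasurableSpace Ω} {X : Ω → Stacked n p} {i : ℕ × Fin B} (hX : Measurable[m] X)
    (hi : Measurable[m] (S i)) : Measurable[m] fun ω => cleanEstimator f γ (X ω) (S i ω) :=
  Measurable.comp (g := Function.uncurry (cleanEstimator f γ)) (f := fun ω => (X ω, S i ω))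
    h.measurable_cleanEstimator (hX.prodMk hi)

theorem IsSampling.lintegral_cleanEstimator_le (hS : IsSampling Pr P S)
    (h : Admissible P f δ Q μ M γ Δ) (hγ : 0 < γ) {J : Set (ℕ × Fin B)} {i : ℕ × Fin B}
    (hi : i ∉ J) {X : Ω → Stacked n p} (hX : Measurable[sampleSigma S J] X)
    (hQ : ∀ᵐ ω ∂Pr, X ω ∈ Q) :
    ∫⁻ ω, ‖cleanEstimator f γ (X ω) (S i ω)‖ₑ ^ 2 ∂Pr ≤ ENNReal.ofReal (estimatorVar n p M) := by
  rw [lintegral_comp_indepFun (φ := fun x s => ‖cleanEstimator f γ x s‖ₑ ^ 2)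
    (hX.mono (hS.sampleSigma_le J) le_rfl) (hS.measurable i) (hS.indepFun hi hX)
    (h.measurable_cleanEstimator.enorm.pow_const 2), hS.law i]
  calc _ ≤ ∫⁻ _, ENNReal.ofReal (estimatorVar n p M) ∂Pr := by
        refine lintegral_mono_ae ?_
        filter_upwards [hQ] with ω hω using h.lintegral_cleanEstimator_le hγ hω
    _ = _ := by simp

theorem memLp_two_of_lintegral_le {X : Ω → Stacked n p} (hX : Measurable X) {C : ℝ}
    (h : ∫⁻ ω, ‖X ω‖ₑ ^ 2 ∂Pr ≤ ENNReal.ofReal C) : MemLp X 2 Pr := by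
  refine ⟨hX.aestronglyMeasurable, ?_⟩
  rw [eLpNorm_lt_top_iff_lintegral_rpow_enorm_lt_top two_ne_zero ENNReal.ofNat_ne_top]
  simpa using h.trans_lt ENNReal.ofReal_lt_top

theorem integral_sq_le_of_lintegral_le {Ω' : Type*} [MeasurableSpace Ω'] {ν : Measure Ω'}
    {X : Ω' → Stacked n p} (hX : AEStronglyMeasurable X ν) {C : ℝ}
    (hC : 0 ≤ C) (h : ∫⁻ ω, ‖X ω‖ₑ ^ 2 ∂ν ≤ ENNReal.ofReal C) : ∫ ω, ‖X ω‖ ^ 2 ∂ν ≤ C := by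
  rw [integral_eq_lintegral_of_nonneg_ae (.of_forall fun ω => sq_nonneg _)
    (hX.norm.pow 2)]
  refine ENNReal.toReal_le_of_le_ofReal hC (le_trans (le_of_eq ?_) h)
  refine lintegral_congr fun ω => ?_
  rw [← ofReal_norm, ENNReal.ofReal_pow (norm_nonneg _)]

/-- A crude bound, from t ≤ 1 + t², whose only role is to make the gradient along the iterates
square integrable. -/
theorem norm_sphereGrad_le (h : Admissible P f δ Q μ M γ Δ) (hμ : 0 < μ) (hγ : 0 < γ)
    {x : Stacked n p} (hx : x ∈ Q) :
    ‖sphereGrad volume (objective P f) γ x‖ ≤ 1 + estimatorVar n p M := by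
  have : IsProbabilityMeasure (unifSphere n p) := by rw [unifSphere_eq]; infer_instance
  have hL := h.memLp_cleanEstimator hγ hx
  have h1 := integral_sq_le_of_lintegral_le hL.1 (estimatorVar_nonneg n p M)
    (h.lintegral_cleanEstimator_le hγ hx)
  rw [← h.integral_cleanEstimator hμ hγ hx]
  refine (norm_integral_le_integral_norm _).trans ?_
  have h2 : Integrable (fun s => ‖cleanEstimator f γ x s‖ ^ 2) (P.prod (unifSphere n p)) :=
    hL.integrable_norm_pow two_ne_zero
  calc _ ≤ ∫ s, (1 + ‖cleanEstimator f γ x s‖ ^ 2) ∂(P.prod (unifSphere n p)) := by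
        refine integral_mono (hL.integrable one_le_two).norm ((integrable_const 1).add h2)
          fun s => ?_
        have := sq_nonneg (‖cleanEstimator f γ x s‖ - 1)
        nlinarith [norm_nonneg (cleanEstimator f γ x s)]
    _ = 1 + ∫ s, ‖cleanEstimator f γ x s‖ ^ 2 ∂(P.prod (unifSphere n p)) := by
        rw [integral_add (integrable_const 1) h2]; simp
    _ ≤ _ := by linarith

/-- The centered two-point estimator. -/
def centeredEstimator (P : Measure Ξ) (f : Fin n → Node p → Ξ → ℝ) (γ : ℝ) (x : Stacked n p)
    (s : Ξ × Stacked n p) : Stacked n p :=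
  cleanEstimator f γ x s - sphereGrad volume (objective P f) γ x

theorem measurable_sphereGrad_objective (h : Admissible P f δ Q μ M γ Δ) (hμ : 0 < μ)
    (hγ : 0 < γ) : Measurable (sphereGrad volume (objective P f) γ : Stacked n p → Stacked n p) :=
  measurable_sphereGrad volume
    (locallyLipschitz_of_strongConvexOn hμ h.strongConvexOn_objective) hγ

theorem IsSampling.measurable_centeredEstimator (h : Admissible P f δ Q μ M γ Δ)
    (hμ : 0 < μ) (hγ : 0 < γ)
    {m : MeasurableSpace Ω} {X : Ω → Stacked n p} {i : ℕ × Fin B} (hX : Measurable[m] X)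
    (hi : Measurable[m] (S i)) : Measurable[m] fun ω => centeredEstimator P f γ (X ω) (S i ω) :=
  (IsSampling.measurable_cleanEstimator h hX hi).sub
    ((measurable_sphereGrad_objective h hμ hγ).comp hX)

theorem memLp_sphereGrad (h : Admissible P f δ Q μ M γ Δ) (hμ : 0 < μ) (hγ : 0 < γ)
    {X : Ω → Stacked n p} (hX : Measurable X) (hQ : ∀ᵐ ω ∂Pr, X ω ∈ Q) :
    MemLp (fun ω => sphereGrad volume (objective P f) γ (X ω)) 2 Pr :=
  MemLp.of_bound ((measurable_sphereGrad_objective h hμ hγ).comp hX).aestronglyMeasurable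
    (1 + estimatorVar n p M) (by
      filter_upwards [hQ] with ω hω using norm_sphereGrad_le h hμ hγ hω)

theorem IsSampling.memLp_cleanEstimator (hS : IsSampling Pr P S)
    (h : Admissible P f δ Q μ M γ Δ) (hγ : 0 < γ) {J : Set (ℕ × Fin B)} {i : ℕ × Fin B}
    (hi : i ∉ J) {X : Ω → Stacked n p} (hX : Measurable[sampleSigma S J] X)
    (hQ : ∀ᵐ ω ∂Pr, X ω ∈ Q) : MemLp (fun ω => cleanEstimator f γ (X ω) (S i ω)) 2 Pr :=
  memLp_two_of_lintegral_le (IsSampling.measurable_cleanEstimator h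
    (hX.mono (hS.sampleSigma_le J) le_rfl) (hS.measurable i))
    (hS.lintegral_cleanEstimator_le h hγ hi hX hQ)

theorem IsSampling.memLp_centeredEstimator (hS : IsSampling Pr P S)
    (h : Admissible P f δ Q μ M γ Δ) (hμ : 0 < μ) (hγ : 0 < γ) {J : Set (ℕ × Fin B)}
    {i : ℕ × Fin B} (hi : i ∉ J) {X : Ω → Stacked n p} (hX : Measurable[sampleSigma S J] X)
    (hQ : ∀ᵐ ω ∂Pr, X ω ∈ Q) : MemLp (fun ω => centeredEstimator P f γ (X ω) (S i ω)) 2 Pr :=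
  (hS.memLp_cleanEstimator h hγ hi hX hQ).sub
    (memLp_sphereGrad h hμ hγ (hX.mono (hS.sampleSigma_le J) le_rfl) hQ)

/-- The centered estimator is orthogonal to everything that depends on other samples only. -/
theorem IsSampling.integral_inner_centeredEstimator (hS : IsSampling Pr P S)
    (h : Admissible P f δ Q μ M γ Δ) (hμ : 0 < μ) (hγ : 0 < γ) {J : Set (ℕ × Fin B)}
    {i : ℕ × Fin B} (hi : i ∉ J) {X V : Ω → Stacked n p} (hX : Measurable[sampleSigma S J] X)
    (hQ : ∀ᵐ ω ∂Pr, X ω ∈ Q) (hV : Measurable[sampleSigma S J] V) (hV2 : MemLp V 2 Pr) :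
    ∫ ω, ⟪centeredEstimator P f γ (X ω) (S i ω), V ω⟫ ∂Pr = 0 := by
  have : IsProbabilityMeasure (unifSphere n p) := by rw [unifSphere_eq]; infer_instance
  have hXV : Measurable[sampleSigma S J] fun ω => (X ω, V ω) := hX.prodMk hV
  have hint : Integrable (fun ω => ⟪centeredEstimator P f γ (X ω) (S i ω), V ω⟫) Pr :=
    integrable_inner_of_memLp (hS.memLp_centeredEstimator h hμ hγ hi hX hQ) hV2
  have hm : Measurable (Function.uncurry fun (a : Stacked n p × Stacked n p)
      (s : Ξ × Stacked n p) => ⟪centeredEstimator P f γ a.1 s, a.2⟫) := by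
    have h1 : Measurable fun a : (Stacked n p × Stacked n p) × (Ξ × Stacked n p) =>
        centeredEstimator P f γ a.1.1 a.2 :=
      (h.measurable_cleanEstimator.comp (by fun_prop :
        Measurable fun a : (Stacked n p × Stacked n p) × (Ξ × Stacked n p) => (a.1.1, a.2))).sub
        ((measurable_sphereGrad_objective h hμ hγ).comp (by fun_prop))
    exact h1.inner (by fun_prop)
  rw [integral_comp_indepFun (Y := fun ω => (X ω, V ω)) (Z := S i)
    (φ := fun a s => ⟪centeredEstimator P f γ a.1 s, a.2⟫)
    (hXV.mono (hS.sampleSigma_le J) le_rfl) (hS.measurable i) (hS.indepFun hi hXV) hm hint,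
    hS.law i]
  refine integral_eq_zero_of_ae ?_
  filter_upwards [hQ] with ω hω
  have hi1 := (h.memLp_cleanEstimator hγ hω).integrable one_le_two
  have hi2 : Integrable (centeredEstimator P f γ (X ω)) (P.prod (unifSphere n p)) :=
    hi1.sub (integrable_const _)
  simp only [real_inner_comm (V ω)]
  rw [integral_inner hi2]
  unfold centeredEstimator
  rw [integral_sub hi1 (integrable_const _), h.integral_cleanEstimator hμ hγ hω]
  simp

/-- Centering does not increase the second moment: the cross term with the conditional mean
vanishes. -/
theorem IsSampling.integral_centeredEstimator_sq_le (hS : IsSampling Pr P S)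
    (h : Admissible P f δ Q μ M γ Δ) (hμ : 0 < μ) (hγ : 0 < γ) {J : Set (ℕ × Fin B)}
    {i : ℕ × Fin B} (hi : i ∉ J) {X : Ω → Stacked n p} (hX : Measurable[sampleSigma S J] X)
    (hQ : ∀ᵐ ω ∂Pr, X ω ∈ Q) :
    ∫ ω, ‖centeredEstimator P f γ (X ω) (S i ω)‖ ^ 2 ∂Pr ≤ estimatorVar n p M := by
  have hX' : Measurable X := hX.mono (hS.sampleSigma_le J) le_rfl
  have hT := hS.memLp_cleanEstimator h hγ hi hX hQ
  have hZ := hS.memLp_centeredEstimator h hμ hγ hi hX hQ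
  have hG := memLp_sphereGrad h hμ hγ hX' hQ
  have h0 := hS.integral_inner_centeredEstimator h hμ hγ hi hX hQ
    ((measurable_sphereGrad_objective h hμ hγ).comp hX) hG
  have h1 := integral_sq_le_of_lintegral_le hT.1 (estimatorVar_nonneg n p M)
    (hS.lintegral_cleanEstimator_le h hγ hi hX hQ)
  have h2 : ∀ ω, ‖centeredEstimator P f γ (X ω) (S i ω)‖ ^ 2 +
      2 * ⟪centeredEstimator P f γ (X ω) (S i ω), sphereGrad volume (objective P f) γ (X ω)⟫ ≤
      ‖cleanEstimator f γ (X ω) (S i ω)‖ ^ 2 := by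
    intro ω
    have e : cleanEstimator f γ (X ω) (S i ω) = centeredEstimator P f γ (X ω) (S i ω) +
      sphereGrad volume (objective P f) γ (X ω) := by simp [centeredEstimator]
    rw [e, norm_add_sq_expand]
    linarith [sq_nonneg ‖sphereGrad volume (objective P f) γ (X ω)‖]
  have i1 : Integrable (fun ω => ‖centeredEstimator P f γ (X ω) (S i ω)‖ ^ 2) Pr :=
    hZ.integrable_norm_pow two_ne_zero
  have i2 : Integrable (fun ω => 2 * ⟪centeredEstimator P f γ (X ω) (S i ω),
      sphereGrad volume (objective P f) γ (X ω)⟫) Pr := (integrable_inner_of_memLp hZ hG).const_mul 2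
  have h3 := integral_mono (i1.add i2) (hT.integrable_norm_pow two_ne_zero) h2
  simp only [Pi.add_apply] at h3
  rw [integral_add i1 i2, integral_const_mul] at h3
  simp only [Function.comp_apply] at h0
  rw [h0] at h3
  linarith

end Sampling

/-! ### Averaging over a batch. -/

section Batch

variable {n p : ℕ} {Ξ : Type*} [MeasurableSpace Ξ] {Ω : Type*} [mΩ : MeasurableSpace Ω]
  {Pr : Measure Ω} [IsProbabilityMeasure Pr] {P : Measure Ξ} [IsProbabilityMeasure P] {B : ℕ}
  {S : ℕ × Fin B → Ω → Ξ × Stacked n p}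
  {f : Fin n → Node p → Ξ → ℝ} {δ : Stacked n p → Ξ → ℝ} {Q : Set (Stacked n p)}
  {μ M γ Δ : ℝ} [Nontrivial (Stacked n p)]

/-- The indices of the samples drawn before iteration `k`. -/
def past (B k : ℕ) : Set (ℕ × Fin B) := {j | j.1 < k}

theorem past_mono {k l : ℕ} (h : k ≤ l) : past B k ⊆ past B l := fun _ hj => lt_of_lt_of_le hj h

theorem notMem_past (k : ℕ) (b : Fin B) : (k, b) ∉ past B k := by simp [past]

theorem mem_past_succ (k : ℕ) (b : Fin B) : (k, b) ∈ past B (k + 1) := by simp [past]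

/-- The error of the batched estimator that is due to sampling. -/
def batchError (P : Measure Ξ) (f : Fin n → Node p → Ξ → ℝ) (γ : ℝ) (x : Stacked n p)
    (σ : Fin B → Ξ × Stacked n p) : Stacked n p :=
  (B : ℝ)⁻¹ • ∑ b, centeredEstimator P f γ x (σ b)

/-- The error of the batched estimator that is due to the noise of the oracle. -/
def batchBias (δ : Stacked n p → Ξ → ℝ) (γ : ℝ) (x : Stacked n p)
    (σ : Fin B → Ξ × Stacked n p) : Stacked n p :=
  (B : ℝ)⁻¹ • ∑ b, twoPoint (fun _ _ _ => 0) δ γ x (σ b).1 (σ b).2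

theorem batchTwoPoint_eq (hB : 1 ≤ B) (P : Measure Ξ) (f : Fin n → Node p → Ξ → ℝ)
    (δ : Stacked n p → Ξ → ℝ) (γ : ℝ) (x : Stacked n p) (σ : Fin B → Ξ × Stacked n p) :
    batchTwoPoint f δ γ σ x = sphereGrad volume (objective P f) γ x +
      (batchError P f γ x σ + batchBias δ γ x σ) := by
  have hB0 : (B : ℝ) ≠ 0 := by positivity
  have h1 : ∀ b, twoPoint f δ γ x (σ b).1 (σ b).2 = cleanEstimator f γ x (σ b) +
      twoPoint (fun _ _ _ => 0) δ γ x (σ b).1 (σ b).2 := by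
    intro b
    simp only [cleanEstimator, twoPoint, ← add_smul]
    congr 1
    simp only [total, Finset.sum_const_zero]
    ring
  simp only [batchTwoPoint, batchError, batchBias, h1, centeredEstimator, Finset.sum_add_distrib,
    Finset.sum_sub_distrib, smul_add, smul_sub]
  simp only [Finset.sum_const, Finset.card_univ, Fintype.card_fin, ← Nat.cast_smul_eq_nsmul ℝ,
    smul_smul, inv_mul_cancel₀ hB0, one_smul]
  abel

theorem norm_batchBias_le (hB : 1 ≤ B) (hγ : 0 < γ) (hδ : ∀ x ξ, |δ x ξ| ≤ Δ) (x : Stacked n p)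
    {σ : Fin B → Ξ × Stacked n p} (hσ : ∀ b, ‖(σ b).2‖ = 1) :
    ‖batchBias δ γ x σ‖ ≤ (n * p : ℕ) * Δ / γ := by
  have hB0 : (0 : ℝ) < B := by positivity
  rw [batchBias, norm_smul, norm_inv, Real.norm_natCast, inv_mul_le_iff₀ hB0]
  calc _ ≤ ∑ _b : Fin B, (n * p : ℕ) * Δ / γ := by
        refine norm_sum_le_of_le _ fun b _ => ?_
        rw [twoPoint, norm_smul, hσ, mul_one, norm_mul, Real.norm_of_nonneg (by positivity),
          Real.norm_eq_abs]
        simp only [total, Finset.sum_const_zero, zero_add]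
        have h1 := abs_sub (δ (x + γ • (σ b).2) (σ b).1) (δ (x - γ • (σ b).2) (σ b).1)
        have h2 := hδ (x + γ • (σ b).2) (σ b).1
        have h3 := hδ (x - γ • (σ b).2) (σ b).1
        calc _ ≤ ((n * p : ℕ) : ℝ) / (2 * γ) * (2 * Δ) := by gcongr; linarith
          _ = _ := by field_simp
    _ = _ := by simp

theorem IsSampling.ae_norm_eq_one (hS : IsSampling Pr P S) :
    ∀ᵐ ω ∂Pr, ∀ i, ‖(S i ω).2‖ = 1 := by
  have : IsProbabilityMeasure (unifSphere n p) := by rw [unifSphere_eq]; infer_instance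
  refine ae_all_iff.2 fun i => ?_
  have h1 : ∀ᵐ a ∂(P.prod (unifSphere n p)), ‖a.2‖ = 1 :=
    Measure.quasiMeasurePreserving_snd.ae (ae_norm_eq_one_sphereUnif volume)
  rw [← hS.law i] at h1
  exact ae_of_ae_map (hS.measurable i).aemeasurable h1

theorem measurable_bias (h : Admissible P f δ Q μ M γ Δ) {m : MeasurableSpace Ω}
    {X : Ω → Stacked n p} {k : ℕ} (hX : Measurable[m] X)
    (hi : ∀ b, Measurable[m] (S (k, b))) :
    Measurable[m] fun ω => batchBias δ γ (X ω) fun b => S (k, b) ω := by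
  have h0 : Measurable (Function.uncurry fun (x : Stacked n p) (s : Ξ × Stacked n p) =>
      twoPoint (fun _ _ _ => 0) δ γ x s.1 s.2) := by
    unfold Function.uncurry
    simp only [twoPoint, total, Finset.sum_const_zero, zero_add]
    have h1 : Measurable fun a : Stacked n p × (Ξ × Stacked n p) =>
        δ (a.1 + γ • a.2.2) a.2.1 :=
      h.measurable_δ.comp (by fun_prop :
        Measurable fun a : Stacked n p × (Ξ × Stacked n p) => (a.1 + γ • a.2.2, a.2.1))
    have h2 : Measurable fun a : Stacked n p × (Ξ × Stacked n p) =>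
        δ (a.1 - γ • a.2.2) a.2.1 :=
      h.measurable_δ.comp (by fun_prop :
        Measurable fun a : Stacked n p × (Ξ × Stacked n p) => (a.1 - γ • a.2.2, a.2.1))
    exact ((h1.sub h2).const_mul _).smul (by fun_prop)
  have h2 : Measurable[m] fun ω => ∑ b, twoPoint (fun _ _ _ => 0) δ γ (X ω) (S (k, b) ω).1
      (S (k, b) ω).2 := Finset.measurable_sum _ fun b _ => ?_
  · exact h2.const_smul (B : ℝ)⁻¹
  exact Measurable.comp (g := Function.uncurry _) (f := fun ω => (X ω, S (k, b) ω)) h0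
    (hX.prodMk (hi b))

theorem measurable_batchError (h : Admissible P f δ Q μ M γ Δ) (hμ : 0 < μ) (hγ : 0 < γ)
    {m : MeasurableSpace Ω} {X : Ω → Stacked n p} {k : ℕ} (hX : Measurable[m] X)
    (hi : ∀ b, Measurable[m] (S (k, b))) :
    Measurable[m] fun ω => batchError P f γ (X ω) fun b => S (k, b) ω := by
  have h2 : Measurable[m] fun ω => ∑ b, centeredEstimator P f γ (X ω) (S (k, b) ω) :=
    Finset.measurable_sum _ fun b _ =>
      IsSampling.measurable_centeredEstimator h hμ hγ hX (hi b)
  exact h2.const_smul (B : ℝ)⁻¹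

theorem IsSampling.memLp_batchError (hS : IsSampling Pr P S) (h : Admissible P f δ Q μ M γ Δ)
    (hμ : 0 < μ) (hγ : 0 < γ) {k : ℕ} {X : Ω → Stacked n p}
    (hX : Measurable[sampleSigma S (past B k)] X) (hQ : ∀ᵐ ω ∂Pr, X ω ∈ Q) :
    MemLp (fun ω => batchError P f γ (X ω) fun b => S (k, b) ω) 2 Pr := by
  have h2 : MemLp (fun ω => ∑ b, centeredEstimator P f γ (X ω) (S (k, b) ω)) 2 Pr :=
    memLp_finsetSum _ fun b _ =>
      hS.memLp_centeredEstimator h hμ hγ (notMem_past k b) hX hQ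
  exact h2.const_smul (B : ℝ)⁻¹

theorem IsSampling.integral_inner_batchError (hS : IsSampling Pr P S)
    (h : Admissible P f δ Q μ M γ Δ) (hμ : 0 < μ) (hγ : 0 < γ) {k : ℕ} {X V : Ω → Stacked n p}
    (hX : Measurable[sampleSigma S (past B k)] X) (hQ : ∀ᵐ ω ∂Pr, X ω ∈ Q)
    (hV : Measurable[sampleSigma S (past B k)] V) (hV2 : MemLp V 2 Pr) :
    ∫ ω, ⟪batchError P f γ (X ω) fun b => S (k, b) ω, V ω⟫ ∂Pr = 0 := by
  simp only [batchError, real_inner_smul_left, sum_inner]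
  rw [integral_const_mul, integral_finsetSum _ fun b _ => integrable_inner_of_memLp
    (hS.memLp_centeredEstimator h hμ hγ (notMem_past k b) hX hQ) hV2]
  rw [Finset.sum_eq_zero fun b _ =>
    hS.integral_inner_centeredEstimator h hμ hγ (notMem_past k b) hX hQ hV hV2, mul_zero]

/-- Averaging over a batch divides the variance by the size of the batch. -/
theorem IsSampling.integral_batchError_sq_le (hS : IsSampling Pr P S)
    (h : Admissible P f δ Q μ M γ Δ) (hμ : 0 < μ) (hγ : 0 < γ) {k : ℕ} {X : Ω → Stacked n p}
    (hX : Measurable[sampleSigma S (past B k)] X) (hQ : ∀ᵐ ω ∂Pr, X ω ∈ Q) :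
    ∫ ω, ‖batchError P f γ (X ω) fun b => S (k, b) ω‖ ^ 2 ∂Pr ≤ estimatorVar n p M / B := by
  rcases Nat.eq_zero_or_pos B with rfl | hB
  · simp [batchError]
  have hB0 : (0 : ℝ) < B := by positivity
  set Z : Fin B → Ω → Stacked n p := fun b ω => centeredEstimator P f γ (X ω) (S (k, b) ω)
  have hZ : ∀ b, MemLp (Z b) 2 Pr := fun b =>
    hS.memLp_centeredEstimator h hμ hγ (notMem_past k b) hX hQ
  have hcross : ∀ b b', b ≠ b' → ∫ ω, ⟪Z b ω, Z b' ω⟫ ∂Pr = 0 := by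
    intro b b' hbb
    -- Adding the single sample b' to the past makes the other member of the batch measurable while
    -- b remains independent, so orthogonality also applies within a batch.
    have hJ : past B k ⊆ past B k ∪ {(k, b')} := Set.subset_union_left
    have hX' := hX.mono (sampleSigma_mono (S := S) hJ) le_rfl
    refine hS.integral_inner_centeredEstimator h hμ hγ (J := past B k ∪ {(k, b')}) ?_ hX' hQ
      (IsSampling.measurable_centeredEstimator h hμ hγ hX'
        (measurable_sample (Or.inr rfl))) (hZ b')
    rintro (h1 | h1)
    · exact notMem_past k b h1
    · exact hbb (Prod.mk.inj h1).2
  have hdiag : ∀ b, ∫ ω, ⟪Z b ω, Z b ω⟫ ∂Pr ≤ estimatorVar n p M := by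
    intro b
    simp only [real_inner_self_eq_norm_sq]
    exact hS.integral_centeredEstimator_sq_le h hμ hγ (notMem_past k b) hX hQ
  have e : ∀ ω, ‖batchError P f γ (X ω) fun b => S (k, b) ω‖ ^ 2 =
      ((B : ℝ)⁻¹) ^ 2 * ∑ b, ∑ b', ⟪Z b ω, Z b' ω⟫ := by
    intro ω
    rw [batchError, norm_smul_sq, ← real_inner_self_eq_norm_sq, sum_inner]
    simp only [inner_sum, Z]
  simp only [e]
  rw [integral_const_mul, integral_finsetSum _ fun b _ => integrable_finsetSum _ fun b' _ =>
    integrable_inner_of_memLp (hZ b) (hZ b')]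
  have h1 : ∀ b, ∫ ω, ∑ b', ⟪Z b ω, Z b' ω⟫ ∂Pr ≤ estimatorVar n p M := by
    intro b
    rw [integral_finsetSum _ fun b' _ => integrable_inner_of_memLp (hZ b) (hZ b'),
      Finset.sum_eq_single b (fun b' _ hb' => hcross b b' hb'.symm) (by simp)]
    exact hdiag b
  calc _ ≤ ((B : ℝ)⁻¹) ^ 2 * ∑ _b : Fin B, estimatorVar n p M := by gcongr; exact h1 _
    _ = _ := by
      rw [Finset.sum_const, Finset.card_univ, Fintype.card_fin, nsmul_eq_mul]
      field_simp

end Batch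

/-! ### Measurable and square integrable random vectors as linear classes. -/

section Classes

variable {n p : ℕ} {Ω : Type*} [mΩ : MeasurableSpace Ω]

theorem continuous_gossipApply (W : Matrix (Fin n) (Fin n) ℝ) :
    Continuous (gossipApply W : Stacked n p → Stacked n p) := by
  unfold gossipApply
  fun_prop

/-- The action of a gossip matrix as a continuous linear map. -/
def gossipCLM (W : Matrix (Fin n) (Fin n) ℝ) : Stacked n p →L[ℝ] Stacked n p where
  toFun := gossipApply W
  map_add' := gossipApply_add W
  map_smul' := gossipApply_smul W
  cont := continuous_gossipApply W

theorem isLinearClass_measurable (m : MeasurableSpace Ω) :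
    IsLinearClass fun u : Ω → Stacked n p => Measurable[m] u where
  add _ _ hu hv := Measurable.add hu hv
  smul c _ hu := Measurable.const_smul hu c
  gossip W _ hu := (continuous_gossipApply W).measurable.comp hu

theorem isLinearClass_memLp (Pr : Measure Ω) :
    IsLinearClass fun u : Ω → Stacked n p => MemLp u 2 Pr where
  add _ _ hu hv := hu.add hv
  smul c _ hu := hu.const_smul c
  gossip W _ hu := (gossipCLM W).comp_memLp' hu

end Classes

/-! ### Measurability and integrability along a run. -/

section Trajectory

variable {n p : ℕ}

theorem lyapunov_ge {E : Type*} [NormedAddCommGroup E] [InnerProductSpace ℝ E] {μ β L χ : ℝ}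
    (hμ : 0 < μ) (hβ : 0 < β) (hL : 0 ≤ L) (hχ : 1 ≤ χ) (X Y Yf Uf V m : E) (Df : ℝ) :
    √(β * μ) / β * ‖X‖ ^ 2 + 2 / √(β * μ) * Df ≤ lyapunov μ β L χ X Y Yf Uf V m Df := by
  have hχ0 : 0 < χ := by linarith
  unfold lyapunov
  have h1 : √(β * μ) / β * ‖X‖ ^ 2 ≤ ((1 / β + L) * √(β * μ) + μ / 8) * ‖X‖ ^ 2 := by
    gcongr
    have : √(β * μ) / β = 1 / β * √(β * μ) := by ring
    rw [this, add_mul]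
    have : 0 ≤ L * √(β * μ) := by positivity
    linarith
  have h2 : 0 ≤ (√(β * μ) / (2 * χ * μ) + β / 4) * ‖Y‖ ^ 2 := by positivity
  have h3 : 0 ≤ 8 * χ * β / √(β * μ) * ‖Yf‖ ^ 2 := by positivity
  have h4 : 0 ≤ 32 * χ / (μ * √(β * μ)) * ‖Uf‖ ^ 2 := by positivity
  have h5 : 0 ≤ 7 * √(β * μ) * χ / (4 * μ) * (‖V‖ ^ 2 + ‖m‖ ^ 2) := by positivity
  linarith

theorem gap_eq (H : Stacked n p → ℝ) (h xs : Stacked n p) (μ : ℝ) (s : State n p) :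
    gap H h xs μ s = μ / 2 * ‖s.x - xs‖ ^ 2 + regBregman H h xs μ s.xf := by
  unfold gap regBregman
  ring

/-- The factor r/2 with r = √(βμ) normalises the coefficient 2/r of the divergence to 1, and turns
r/β into r²/(2β) = μ/2. -/
theorem gap_le_stateLyapunov {μ β L χ : ℝ} (hμ : 0 < μ) (hβ : 0 < β) (hL : 0 ≤ L) (hχ : 1 ≤ χ)
    (H : Stacked n p → ℝ) (h xs : Stacked n p) (s : State n p) :
    gap H h xs μ s ≤ √(β * μ) / 2 * stateLyapunov H h xs μ β L χ s := by
  have hr : 0 < √(β * μ) := Real.sqrt_pos.2 (by positivity)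
  have hr2 : √(β * μ) ^ 2 = β * μ := Real.sq_sqrt (by positivity)
  have h1 := mul_le_mul_of_nonneg_left (lyapunov_ge hμ hβ hL hχ (s.x - xs)
    (s.y - (h - (μ / 2) • xs)) (s.yf - (h - (μ / 2) • xs)) (s.yf + s.zf + (μ / 2) • xs)
    (s.z + h - perpProj s.m) (perpProj s.m) (regBregman H h xs μ s.xf))
    (by positivity : 0 ≤ √(β * μ) / 2)
  refine le_trans (le_of_eq ?_) h1
  rw [gap_eq]
  have e1 : √(β * μ) / 2 * (√(β * μ) / β * ‖s.x - xs‖ ^ 2 +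
      2 / √(β * μ) * regBregman H h xs μ s.xf) =
      √(β * μ) ^ 2 / (2 * β) * ‖s.x - xs‖ ^ 2 + regBregman H h xs μ s.xf := by
    field_simp
  rw [e1, hr2]
  congr 2
  field_simp

/-- The query point is a convex combination because τ₁ ≤ 1. This is why only x and x_f have to be
assumed in Q. -/
theorem xg_mem {Q : Set (Stacked n p)} (hQ : Convex ℝ Q) {μ L χ β : ℝ}
    (hβμ : β * μ ≤ 1) (hr : 0 < √(β * μ)) {s : State n p} (hx : s.x ∈ Q) (hxf : s.xf ∈ Q) :
    s.xg (params μ L χ β) ∈ Q := by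
  have hr1 : √(β * μ) ≤ 1 := Real.sqrt_le_one.2 hβμ
  have h1 : (1 : ℝ) ≤ 1 / √(β * μ) := by rw [le_div_iff₀ hr]; linarith
  have h2 : (1 / √(β * μ) + 1 / 2)⁻¹ ≤ 1 := inv_le_one_of_one_le₀ (by linarith)
  exact hQ hx hxf (by simp only [params]; positivity) (by simp only [params]; linarith) (by ring)

variable {Ξ : Type*} [MeasurableSpace Ξ] {Ω : Type*} [mΩ : MeasurableSpace Ω]
  {Pr : Measure Ω} [IsProbabilityMeasure Pr] {P : Measure Ξ} [IsProbabilityMeasure P] {B : ℕ}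
  {S : ℕ × Fin B → Ω → Ξ × Stacked n p}
  {f : Fin n → Node p → Ξ → ℝ} {δ : Stacked n p → Ξ → ℝ} {Q : Set (Stacked n p)}
  {μ M γ Δ β L χ : ℝ} [Nontrivial (Stacked n p)]
  {W : ℕ → Matrix (Fin n) (Fin n) ℝ} {x₀ y₀ z₀ m₀ : Stacked n p} {s : ℕ → Ω → State n p}

/-- The iterates are determined by the samples drawn so far. -/
theorem measurable_states (h : Admissible P f δ Q μ M γ Δ) (hμ : 0 < μ)
    (hγ : 0 < γ) (hB : 1 ≤ B) {a : Params} (hD : stepDet a ≠ 0)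
    (hrun : ∀ ω, IsRun a W (fun k => batchTwoPoint f δ γ (fun b => S (k, b) ω)) x₀ y₀ z₀ m₀
      (fun k => s k ω)) (k : ℕ) :
    State.All (fun u => Measurable[sampleSigma S (past B k)] u) (s k) := by
  induction k with
  | zero =>
    have : s 0 = fun _ => ⟨x₀, x₀, y₀, y₀, z₀, z₀, m₀⟩ := funext fun ω => (hrun ω).init
    rw [this]
    exact ⟨measurable_const, measurable_const, measurable_const, measurable_const,
      measurable_const, measurable_const, measurable_const⟩
  | succ k ih =>
    have hC := isLinearClass_measurable (n := n) (p := p) (sampleSigma S (past B (k + 1)))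
    have hle := sampleSigma_mono (S := S) (past_mono (B := B) k.le_succ)
    have ih' : State.All (fun u => Measurable[sampleSigma S (past B (k + 1))] u) (s k) :=
      ⟨ih.x.mono hle le_rfl, ih.xf.mono hle le_rfl, ih.y.mono hle le_rfl, ih.yf.mono hle le_rfl,
        ih.z.mono hle le_rfl, ih.zf.mono hle le_rfl, ih.m.mono hle le_rfl⟩
    have hX := ih'.xg hC a
    have hi : ∀ b, Measurable[sampleSigma S (past B (k + 1))] (S (k, b)) := fun b =>
      measurable_sample (mem_past_succ k b)
    refine ih'.step hC hD (W := W k)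
      (g := fun ω => batchTwoPoint f δ γ (fun b => S (k, b) ω) ((s k ω).xg a)) ?_
      fun ω => (hrun ω).step k
    simp only [batchTwoPoint_eq hB P]
    exact hC.add _ _ ((measurable_sphereGrad_objective h hμ hγ).comp hX)
      (hC.add _ _ (measurable_batchError h hμ hγ hX hi) (measurable_bias h hX hi))

theorem states_mem_perp {a : Params} (hW : ∀ k, IsGossip (W k) p χ)
    {g : ℕ → Stacked n p → Stacked n p} {s : ℕ → State n p}
    (hrun : IsRun a W g x₀ y₀ z₀ m₀ s) (hz : z₀ ∈ consensusPerp n p) (k : ℕ) :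
    (s k).z ∈ consensusPerp n p ∧ (s k).zf ∈ consensusPerp n p := by
  induction k with
  | zero => rw [hrun.init]; exact ⟨hz, hz⟩
  | succ k ih => exact (hrun.step k).mem_perp (hW k) ih.1 ih.2

theorem memLp_batchBias (h : Admissible P f δ Q μ M γ Δ) (hS : IsSampling Pr P S) (hB : 1 ≤ B)
    (hγ : 0 < γ) {k : ℕ} {X : Ω → Stacked n p} (hX : Measurable X) :
    MemLp (fun ω => batchBias δ γ (X ω) fun b => S (k, b) ω) 2 Pr :=
  MemLp.of_bound (measurable_bias h hX fun b => hS.measurable (k, b)).aestronglyMeasurable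
    ((n * p : ℕ) * Δ / γ) (by
      filter_upwards [hS.ae_norm_eq_one] with ω hω
      exact norm_batchBias_le hB hγ h.noise _ fun b => hω _)

/-- The iterates are square integrable. -/
theorem memLp_states (h : Admissible P f δ Q μ M γ Δ) (hS : IsSampling Pr P S) (hμ : 0 < μ)
    (hγ : 0 < γ) (hB : 1 ≤ B) {a : Params} (hD : stepDet a ≠ 0)
    (hrun : ∀ ω, IsRun a W (fun k => batchTwoPoint f δ γ (fun b => S (k, b) ω)) x₀ y₀ z₀ m₀
      (fun k => s k ω)) {N : ℕ}
    (hQ : ∀ k < N, ∀ᵐ ω ∂Pr, (s k ω).xg a ∈ Q) :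
    ∀ k ≤ N, State.All (fun u => MemLp u 2 Pr) (s k) := by
  intro k
  induction k with
  | zero =>
    intro _
    have : s 0 = fun _ => ⟨x₀, x₀, y₀, y₀, z₀, z₀, m₀⟩ := funext fun ω => (hrun ω).init
    rw [this]
    exact ⟨memLp_const _, memLp_const _, memLp_const _, memLp_const _, memLp_const _,
      memLp_const _, memLp_const _⟩
  | succ k ih =>
    intro hk
    have hC := isLinearClass_memLp (n := n) (p := p) Pr
    have hX := (measurable_states h hμ hγ hB hD hrun k).xg (isLinearClass_measurable _) a
    have hX' : Measurable fun ω => (s k ω).xg a := hX.mono (hS.sampleSigma_le _) le_rfl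
    have hQk := hQ k (by omega)
    refine (ih (by omega)).step hC hD (W := W k)
      (g := fun ω => batchTwoPoint f δ γ (fun b => S (k, b) ω) ((s k ω).xg a)) ?_
      fun ω => (hrun ω).step k
    simp only [batchTwoPoint_eq hB P]
    exact hC.add _ _ (memLp_sphereGrad h hμ hγ hX' hQk)
      (hC.add _ _ (hS.memLp_batchError h hμ hγ hX hQk) (memLp_batchBias h hS hB hγ hX'))

/-- A function that is Lipschitz on `Q` is integrable along square integrable points of `Q`. -/
theorem integrable_of_lipschitzOn {H : Stacked n p → ℝ} (hH : Continuous H) {xs : Stacked n p}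
    {K : ℝ} (hL : ∀ x ∈ Q, |H x - H xs| ≤ K * ‖x - xs‖) {X : Ω → Stacked n p}
    (hX : MemLp X 2 Pr) (hQ : ∀ᵐ ω ∂Pr, X ω ∈ Q) : Integrable (fun ω => H (X ω)) Pr := by
  have h1 : Integrable (fun ω => H (X ω) - H xs) Pr := by
    refine Integrable.mono' (((hX.sub (memLp_const xs)).integrable one_le_two).norm.const_mul K)
      ((hH.comp_aestronglyMeasurable hX.1).sub aestronglyMeasurable_const) ?_
    filter_upwards [hQ] with ω hω using hL _ hω
  exact (h1.add (integrable_const (H xs))).congr (.of_forall fun ω => by simp)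

theorem integrable_regBregman {H : Stacked n p → ℝ} {h xs : Stacked n p} {X : Ω → Stacked n p}
    (hH : Integrable (fun ω => H (X ω)) Pr) (hX : MemLp X 2 Pr) :
    Integrable (fun ω => regBregman H h xs μ (X ω)) Pr := by
  have hX1 := hX.sub (memLp_const xs)
  exact ((hH.sub (integrable_const _)).sub ((hX1.integrable one_le_two).const_inner h)).sub
    ((hX1.integrable_norm_pow two_ne_zero).const_mul _)

theorem integrable_gap {H : Stacked n p → ℝ} {h xs : Stacked n p} {t : Ω → State n p}
    (ht : State.All (fun u => MemLp u 2 Pr) t) (hH : Integrable (fun ω => H (t ω).xf) Pr) :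
    Integrable (fun ω => gap H h xs μ (t ω)) Pr := by
  simp only [gap_eq]
  exact (((ht.x.sub (memLp_const xs)).integrable_norm_pow two_ne_zero).const_mul _).add
    (integrable_regBregman hH ht.xf)

theorem integrable_stateLyapunov {H : Stacked n p → ℝ} {h xs : Stacked n p} {t : Ω → State n p}
    (ht : State.All (fun u => MemLp u 2 Pr) t) (hH : Integrable (fun ω => H (t ω).xf) Pr) :
    Integrable (fun ω => stateLyapunov H h xs μ β L χ (t ω)) Pr := by
  have hm : MemLp (fun ω => perpProj (t ω).m) 2 Pr := by
    -- The projection is itself a gossip operation, with the complete averaging matrix, so closure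
    -- of the linear class applies to it.
    have e : ∀ x : Stacked n p, perpProj x = gossipApply (1 - Matrix.of fun _ _ => (n : ℝ)⁻¹) x := by
      intro x
      rw [gossipApply_one_sub]
      refine stacked_ext fun i k => ?_
      simp [perpProj, gossipApply, Finset.mul_sum]
    simp only [e]
    exact (isLinearClass_memLp Pr).gossip _ _ ht.m
  have sq : ∀ {X : Ω → Stacked n p} (_ : MemLp X 2 Pr), Integrable (fun ω => ‖X ω‖ ^ 2) Pr :=
    fun hX => hX.integrable_norm_pow two_ne_zero
  have h1 := sq (ht.x.sub (memLp_const xs))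
  have h2 := sq (ht.y.sub (memLp_const (h - (μ / 2) • xs)))
  have h3 := sq (ht.yf.sub (memLp_const (h - (μ / 2) • xs)))
  have h4 := sq ((ht.yf.add ht.zf).add (memLp_const ((μ / 2) • xs)))
  have h5 := sq ((ht.z.add (memLp_const h)).sub hm)
  have h6 := sq hm
  exact (((((h1.const_mul _).add ((integrable_regBregman hH ht.xf).const_mul _)).add
    (h2.const_mul _)).add (h3.const_mul _)).add (h4.const_mul _)).add ((h5.add h6).const_mul _)

end Trajectory

/-! ### The recursion in expectation. -/

section Recursion

variable {n p : ℕ} {Ξ : Type*} [MeasurableSpace Ξ] {Ω : Type*} [mΩ : MeasurableSpace Ω]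
  {Pr : Measure Ω} [IsProbabilityMeasure Pr] {P : Measure Ξ} [IsProbabilityMeasure P] {B : ℕ}
  {S : ℕ × Fin B → Ω → Ξ × Stacked n p}
  {f : Fin n → Node p → Ξ → ℝ} {δ : Stacked n p → Ξ → ℝ} {Q : Set (Stacked n p)}
  {μ M γ Δ β L χ : ℝ} [Nontrivial (Stacked n p)]
  {W : ℕ → Matrix (Fin n) (Fin n) ℝ} {x₀ y₀ z₀ m₀ xs : Stacked n p} {s : ℕ → Ω → State n p}

/-- One stochastic iteration, from a state that depends on the past only. -/
theorem integral_stateLyapunov_step (h : Admissible P f δ Q μ M γ Δ) (hS : IsSampling Pr P S)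
    (hsm : IsSmoothProblem (smoothed (objective P f) γ) (sphereGrad volume (objective P f) γ)
      Q μ L xs)
    (hμ : 0 < μ) (hγ : 0 < γ) (hB : 1 ≤ B) (hβ : 0 < β) (hL : 0 ≤ L)
    (hβL : β * (8 * L + 2 * μ) ≤ 1) (hχ : 1 ≤ χ) {k : ℕ} {W : Matrix (Fin n) (Fin n) ℝ}
    (hW : IsGossip W p χ) {t t' : Ω → State n p}
    (ht : State.All (fun u => Measurable[sampleSigma S (past B k)] u) t)
    (ht2 : State.All (fun u => MemLp u 2 Pr) t)
    (hstep : ∀ ω, IsStep (params μ L χ β) W (batchTwoPoint f δ γ (fun b => S (k, b) ω)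
      ((t ω).xg (params μ L χ β))) (t ω) (t' ω))
    (hz : ∀ ω, (t ω).z ∈ consensusPerp n p) (hzf : ∀ ω, (t ω).zf ∈ consensusPerp n p)
    (hxg : ∀ᵐ ω ∂Pr, (t ω).xg (params μ L χ β) ∈ Q)
    (hxf' : ∀ᵐ ω ∂Pr, (t' ω).xf ∈ Q)
    (hi : Integrable (fun ω => stateLyapunov (smoothed (objective P f) γ)
      (sphereGrad volume (objective P f) γ xs) xs μ β L χ (t ω)) Pr)
    (hi' : Integrable (fun ω => stateLyapunov (smoothed (objective P f) γ)
      (sphereGrad volume (objective P f) γ xs) xs μ β L χ (t' ω)) Pr) :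
    ∫ ω, stateLyapunov (smoothed (objective P f) γ)
        (sphereGrad volume (objective P f) γ xs) xs μ β L χ (t' ω) ∂Pr ≤
      (1 - √(β * μ) / (32 * χ)) * ∫ ω, stateLyapunov (smoothed (objective P f) γ)
        (sphereGrad volume (objective P f) γ xs) xs μ β L χ (t ω) ∂Pr +
      (6 * (β / √(β * μ)) * (estimatorVar n p M / B) + 14 / μ * ((n * p : ℕ) * Δ / γ) ^ 2) := by
  set a := params μ L χ β with ha
  set G := sphereGrad volume (objective P f) γ with hG
  set H := smoothed (objective P f) γ with hH
  have hX : Measurable[sampleSigma S (past B k)] fun ω => (t ω).xg a :=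
    ht.xg (isLinearClass_measurable _) a
  have hX' : Measurable fun ω => (t ω).xg a := hX.mono (hS.sampleSigma_le _) le_rfl
  have hGm : Measurable[sampleSigma S (past B k)] fun ω => G ((t ω).xg a) :=
    (measurable_sphereGrad_objective h hμ hγ).comp hX
  have hG2 : MemLp (fun ω => G ((t ω).xg a)) 2 Pr := memLp_sphereGrad h hμ hγ hX' hxg
  set ζ : Ω → Stacked n p := fun ω => batchError P f γ ((t ω).xg a) fun b => S (k, b) ω with hζ
  set b : Ω → Stacked n p := fun ω => batchBias δ γ ((t ω).xg a) fun b => S (k, b) ω with hb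
  have hζ2 : MemLp ζ 2 Pr := hS.memLp_batchError h hμ hγ hX hxg
  have hζv : ∫ ω, ‖ζ ω‖ ^ 2 ∂Pr ≤ estimatorVar n p M / B :=
    hS.integral_batchError_sq_le h hμ hγ hX hxg
  set U : Ω → Stacked n p := fun ω => nextX a (t ω) (G ((t ω).xg a)) - xs with hU
  set V : Ω → Stacked n p := fun ω => nextY a (t ω) (G ((t ω).xg a)) - (G xs - (μ / 2) • xs)
    with hV
  have hU2 : MemLp U 2 Pr :=
    (ht2.nextX (isLinearClass_memLp Pr) a hG2).sub (memLp_const xs)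
  have hV2 : MemLp V 2 Pr :=
    (ht2.nextY (isLinearClass_memLp Pr) a hG2).sub (memLp_const _)
  have hUm : Measurable[sampleSigma S (past B k)] U :=
    Measurable.sub (ht.nextX (isLinearClass_measurable _) a hGm) measurable_const
  have hVm : Measurable[sampleSigma S (past B k)] V :=
    Measurable.sub (ht.nextY (isLinearClass_measurable _) a hGm) measurable_const
  -- U and V use the exact gradient in place of the estimator, so they depend on the past only and
  -- are orthogonal to the sampling error.
  have hU0 : ∫ ω, ⟪ζ ω, U ω⟫ ∂Pr = 0 := hS.integral_inner_batchError h hμ hγ hX hxg hUm hU2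
  have hV0 : ∫ ω, ⟪ζ ω, V ω⟫ ∂Pr = 0 := hS.integral_inner_batchError h hμ hγ hX hxg hVm hV2
  have iU := integrable_inner_of_memLp hζ2 hU2
  have iV := integrable_inner_of_memLp hζ2 hV2
  have iζ : Integrable (fun ω => ‖ζ ω‖ ^ 2) Pr := hζ2.integrable_norm_pow two_ne_zero
  have hpt : ∀ᵐ ω ∂Pr, stateLyapunov H (G xs) xs μ β L χ (t' ω) ≤
      (1 - √(β * μ) / (32 * χ)) * stateLyapunov H (G xs) xs μ β L χ (t ω) +
        (-2 * ⟪ζ ω, U ω⟫ + 2 * β * ⟪ζ ω, V ω⟫) + 6 * (β / √(β * μ)) * ‖ζ ω‖ ^ 2 +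
        14 / μ * ((n * p : ℕ) * Δ / γ) ^ 2 := by
    filter_upwards [hxg, hxf', hS.ae_norm_eq_one] with ω h2 h3 h4
    refine ((hstep ω).stateLyapunov_noisy_le hsm hμ hβ hL hβL hχ hW (hz ω) (hzf ω) h2 h3
      (batchTwoPoint_eq hB P f δ γ _ _)).trans ?_
    have h5 : ‖b ω‖ ≤ (n * p : ℕ) * Δ / γ := norm_batchBias_le hB hγ h.noise _ fun b => h4 _
    have h6 : 14 / μ * ‖b ω‖ ^ 2 ≤ 14 / μ * ((n * p : ℕ) * Δ / γ) ^ 2 := by gcongr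
    exact add_le_add le_rfl h6
  have i1 := hi.const_mul (1 - √(β * μ) / (32 * χ))
  have i2 := (iU.const_mul (-2)).add (iV.const_mul (2 * β))
  have i3 := iζ.const_mul (6 * (β / √(β * μ)))
  have key := integral_mono_ae hi' (((i1.add i2).add i3).add (integrable_const _)) hpt
  refine key.trans ?_
  have e : ∫ ω, ((1 - √(β * μ) / (32 * χ)) * stateLyapunov H (G xs) xs μ β L χ (t ω) +
        (-2 * ⟪ζ ω, U ω⟫ + 2 * β * ⟪ζ ω, V ω⟫) + 6 * (β / √(β * μ)) * ‖ζ ω‖ ^ 2 +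
        14 / μ * ((n * p : ℕ) * Δ / γ) ^ 2) ∂Pr =
      (1 - √(β * μ) / (32 * χ)) * ∫ ω, stateLyapunov H (G xs) xs μ β L χ (t ω) ∂Pr +
        (-2 * ∫ ω, ⟪ζ ω, U ω⟫ ∂Pr + 2 * β * ∫ ω, ⟪ζ ω, V ω⟫ ∂Pr) +
        6 * (β / √(β * μ)) * ∫ ω, ‖ζ ω‖ ^ 2 ∂Pr + 14 / μ * ((n * p : ℕ) * Δ / γ) ^ 2 := by
    have j1 := integral_add ((i1.add i2).add i3)
      (integrable_const (μ := Pr) (14 / μ * ((n * p : ℕ) * Δ / γ) ^ 2))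
    have j2 := integral_add (i1.add i2) i3
    have j3 := integral_add i1 i2
    have j4 := integral_add (iU.const_mul (-2)) (iV.const_mul (2 * β))
    simp only [Pi.add_apply] at j1 j2 j3 j4
    rw [j1, j2, j3, j4]
    simp only [integral_const_mul, integral_const, probReal_univ, one_smul]
  refine (le_of_eq e).trans ?_
  rw [hU0, hV0]
  have : 6 * (β / √(β * μ)) * ∫ ω, ‖ζ ω‖ ^ 2 ∂Pr ≤
      6 * (β / √(β * μ)) * (estimatorVar n p M / B) := by gcongr
  linarith

theorem geometric_recursion {u : ℕ → ℝ} {ρ c : ℝ} {N : ℕ} (hρ : 0 < ρ) (hρ1 : ρ ≤ 1)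
    (hu : ∀ k < N, u (k + 1) ≤ (1 - ρ) * u k + c) : u N ≤ (1 - ρ) ^ N * (u 0 - c / ρ) + c / ρ := by
  induction N with
  | zero => simp
  | succ N ih =>
    have h1 := hu N (Nat.lt_succ_self N)
    have h2 := mul_le_mul_of_nonneg_left (ih fun k hk => hu k (by omega))
      (by linarith : 0 ≤ 1 - ρ)
    have h3 : (1 - ρ) * (c / ρ) + c = c / ρ := by field_simp; ring
    calc u (N + 1) ≤ _ := h1
      _ ≤ (1 - ρ) * ((1 - ρ) ^ N * (u 0 - c / ρ) + c / ρ) + c := by linarith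
      _ = _ := by rw [mul_add, ← mul_assoc, ← pow_succ', add_assoc, h3]

/-- The expected accuracy after `N` iterations for the smoothed problem. -/
theorem integral_gap_smoothed_le (h : Admissible P f δ Q μ M γ Δ) (hS : IsSampling Pr P S)
    (hxs : xs ∈ consensus n p) (hmin : IsMinOn (smoothed (objective P f) γ) (consensus n p) xs)
    (hxsQ : xs ∈ Q) (hM : 0 < M) (hLdef : L = √(n * p : ℕ) * M / γ)
    (hμ : 0 < μ) (hγ : 0 < γ) (hB : 1 ≤ B) (hβ : 0 < β)
    (hβL : β * (8 * L + 2 * μ) ≤ 1) (hχ : 1 ≤ χ) (hW : ∀ k, IsGossip (W k) p χ)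
    (hz : z₀ ∈ consensusPerp n p)
    (hrun : ∀ ω, IsRun (params μ L χ β) W
      (fun k => batchTwoPoint f δ γ (fun b => S (k, b) ω)) x₀ y₀ z₀ m₀ (fun k => s k ω)) {N : ℕ}
    (hQ : ∀ k ≤ N, ∀ᵐ ω ∂Pr, (s k ω).x ∈ Q ∧ (s k ω).xf ∈ Q) :
    State.All (fun u => MemLp u 2 Pr) (s N) ∧
    Integrable (fun ω => gap (smoothed (objective P f) γ)
      (sphereGrad volume (objective P f) γ xs) xs μ (s N ω)) Pr ∧
    ∫ ω, gap (smoothed (objective P f) γ)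
        (sphereGrad volume (objective P f) γ xs) xs μ (s N ω) ∂Pr ≤
      √(β * μ) / 2 * (1 - √(β * μ) / (32 * χ)) ^ N * stateLyapunov (smoothed (objective P f) γ)
        (sphereGrad volume (objective P f) γ xs) xs μ β L χ ⟨x₀, x₀, y₀, y₀, z₀, z₀, m₀⟩ +
      16 * χ * (6 * (β / √(β * μ)) * (estimatorVar n p M / B) +
        14 / μ * ((n * p : ℕ) * Δ / γ) ^ 2) := by
  have hL : 0 ≤ L := by rw [hLdef]; positivity
  have hχ0 : 0 < χ := by linarith
  have hβμ : β * μ ≤ 1 := by nlinarith [mul_nonneg hβ.le hL, mul_pos hβ hμ]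
  have hr : 0 < √(β * μ) := Real.sqrt_pos.2 (by positivity)
  have hr1 : √(β * μ) ≤ 1 := Real.sqrt_le_one.2 hβμ
  have hsm : IsSmoothProblem (smoothed (objective P f) γ) (sphereGrad volume (objective P f) γ)
      Q μ L xs := by rw [hLdef]; exact h.isSmoothProblem hμ hM hγ hxs hmin hxsQ
  have hD := (stepDet_ge (χ := χ) hμ hβ hL hχ).1
  have hD0 : stepDet (params μ L χ β) ≠ 0 := by linarith
  have hxg : ∀ k ≤ N, ∀ᵐ ω ∂Pr, (s k ω).xg (params μ L χ β) ∈ Q := by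
    intro k hk
    filter_upwards [hQ k hk] with ω hω using xg_mem h.convex_Q hβμ hr hω.1 hω.2
  have hmem := memLp_states h hS hμ hγ hB hD0 hrun fun k hk => hxg k hk.le
  have hcont : Continuous (smoothed (objective P f) γ) :=
    continuous_iff_continuousAt.2 fun x => (hasGradientAt_ballSmooth volume
      (locallyLipschitz_of_strongConvexOn hμ h.strongConvexOn_objective) hγ x).continuousAt
  have hH : ∀ k ≤ N, Integrable (fun ω => smoothed (objective P f) γ (s k ω).xf) Pr := by
    intro k hk
    refine integrable_of_lipschitzOn (Q := Q) (xs := xs) (K := M) hcont (fun x hx => ?_)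
      (hmem k hk).xf ((hQ k hk).mono fun ω hω => hω.2)
    exact abs_ballSmooth_sub_le volume hγ (h.continuous_objective hμ)
      (h.lipschitz_objective hM.le) hx hxsQ
  have hΨ := fun k hk => integrable_stateLyapunov (μ := μ) (β := β) (L := L) (χ := χ)
    (h := sphereGrad volume (objective P f) γ xs) (xs := xs) (hmem k hk) (hH k hk)
  have hgap := integrable_gap (μ := μ) (h := sphereGrad volume (objective P f) γ xs) (xs := xs)
    (hmem N le_rfl) (hH N le_rfl)
  refine ⟨hmem N le_rfl, hgap, ?_⟩
  have hrec := geometric_recursion (N := N) (ρ := √(β * μ) / (32 * χ))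
    (c := 6 * (β / √(β * μ)) * (estimatorVar n p M / B) + 14 / μ * ((n * p : ℕ) * Δ / γ) ^ 2)
    (u := fun k => ∫ ω, stateLyapunov (smoothed (objective P f) γ)
      (sphereGrad volume (objective P f) γ xs) xs μ β L χ (s k ω) ∂Pr) (by positivity)
    (by rw [div_le_one (by positivity)]; linarith) fun k hk =>
      integral_stateLyapunov_step h hS hsm hμ hγ hB hβ hL hβL hχ (hW k)
        (measurable_states h hμ hγ hB hD0 hrun k) (hmem k hk.le) (fun ω => (hrun ω).step k)
        (fun ω => (states_mem_perp hW (hrun ω) hz k).1)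
        (fun ω => (states_mem_perp hW (hrun ω) hz k).2)
        (hxg k hk.le)
        ((hQ (k + 1) hk).mono fun ω hω => hω.2) (hΨ k hk.le) (hΨ (k + 1) hk)
  have h0 : ∀ ω, s 0 ω = ⟨x₀, x₀, y₀, y₀, z₀, z₀, m₀⟩ := fun ω => (hrun ω).init
  simp only [h0, integral_const, probReal_univ, one_smul] at hrec
  set c := 6 * (β / √(β * μ)) * (estimatorVar n p M / B) + 14 / μ * ((n * p : ℕ) * Δ / γ) ^ 2
    with hc
  have hc0 : 0 ≤ c := by
    have := estimatorVar_nonneg n p M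
    positivity
  have h1 : ∫ ω, gap (smoothed (objective P f) γ)
        (sphereGrad volume (objective P f) γ xs) xs μ (s N ω) ∂Pr ≤ √(β * μ) / 2 *
      ∫ ω, stateLyapunov (smoothed (objective P f) γ)
        (sphereGrad volume (objective P f) γ xs) xs μ β L χ (s N ω) ∂Pr := by
    rw [← integral_const_mul]
    exact integral_mono hgap ((hΨ N le_rfl).const_mul _)
      fun ω => gap_le_stateLyapunov hμ hβ hL hχ _ _ _ _
  refine h1.trans ((mul_le_mul_of_nonneg_left hrec (by positivity)).trans ?_)
  have h2 : 0 ≤ √(β * μ) / 2 * ((1 - √(β * μ) / (32 * χ)) ^ N * (c / (√(β * μ) / (32 * χ)))) := by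
    have : 0 ≤ 1 - √(β * μ) / (32 * χ) := by
      rw [sub_nonneg, div_le_one (by positivity)]; linarith
    positivity
  -- The fixed point of the recursion, rescaled to the accuracy measure: the contraction rate
  -- cancels and the error per iteration is amplified only by 16χ.
  have h3 : √(β * μ) / 2 * (c / (√(β * μ) / (32 * χ))) = 16 * χ * c := by field_simp; ring
  rw [mul_add, h3, mul_sub, mul_sub]
  linarith

end Recursion

/-! ### From the smoothed problem to the original one, and the initial error. -/

section Transfer

variable {n p : ℕ}

theorem norm_sub_sq_le_two (a b : Stacked n p) : ‖a - b‖ ^ 2 ≤ 2 * ‖a‖ ^ 2 + 2 * ‖b‖ ^ 2 := by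
  have e1 := norm_sub_sq_expand a b
  have e2 := norm_add_sq_expand a b
  linarith [sq_nonneg ‖a + b‖]

theorem norm_add_sq_le_two (a b : Stacked n p) : ‖a + b‖ ^ 2 ≤ 2 * ‖a‖ ^ 2 + 2 * ‖b‖ ^ 2 := by
  have e1 := norm_sub_sq_expand a b
  have e2 := norm_add_sq_expand a b
  linarith [sq_nonneg ‖a - b‖]

/-- If the minimizers of `F` and of its approximation `H` agree up to `e` in value, then the
distance to the former is controlled by the accuracy for the latter. -/
theorem dist_sq_le_of_gap {H : Stacked n p → ℝ} {h xs xγ : Stacked n p} {μ e : ℝ} {t : State n p}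
    (hμ : 0 ≤ μ) (hr : μ / 2 * ‖xs - xγ‖ ^ 2 ≤ e)
    (hD : μ / 4 * ‖t.xf - xγ‖ ^ 2 ≤ regBregman H h xγ μ t.xf) :
    μ / 2 * ‖t.x - xs‖ ^ 2 ≤ 3 * gap H h xγ μ t + 3 / 2 * e := by
  rw [gap_eq]
  have e1 : t.x - xs = (t.x - xγ) - (xs - xγ) := by abel
  have e2 := norm_sub_sq_expand (t.x - xγ) (xs - xγ)
  have e3 := norm_add_sq_expand ((2 : ℝ) • (t.x - xγ)) (xs - xγ)
  rw [norm_smul_sq, real_inner_smul_left] at e3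
  have e4 := sq_nonneg ‖(2 : ℝ) • (t.x - xγ) + (xs - xγ)‖
  have e5 : ‖t.x - xs‖ ^ 2 ≤ 3 * ‖t.x - xγ‖ ^ 2 + 3 / 2 * ‖xs - xγ‖ ^ 2 := by
    rw [e1]; linarith
  have e6 := mul_le_mul_of_nonneg_left e5 (by positivity : 0 ≤ μ / 2)
  have e7 : 0 ≤ μ / 4 * ‖t.xf - xγ‖ ^ 2 := by positivity
  linarith

/-- The accuracy for `F` is controlled by the accuracy for its approximation `H`. -/
theorem gap_le_of_gap {F H : Stacked n p → ℝ} {h xs xγ : Stacked n p} {μ e : ℝ} {t : State n p}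
    (hμ : 0 ≤ μ) (hh : ⟪h, xs - xγ⟫ = 0) (hr : μ / 2 * ‖xs - xγ‖ ^ 2 ≤ H xs - H xγ)
    (hD : μ / 4 * ‖t.xf - xγ‖ ^ 2 ≤ regBregman H h xγ μ t.xf) (h1 : F t.xf ≤ H t.xf)
    (h2 : H xs ≤ F xs + e) :
    gap F h xs μ t ≤ 5 * gap H h xγ μ t + e := by
  have e1 : t.x - xs = (t.x - xγ) - (xs - xγ) := by abel
  have e2 : t.xf - xs = (t.xf - xγ) - (xs - xγ) := by abel
  unfold gap bregman
  unfold regBregman bregman at hD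
  rw [e1, e2, inner_sub_right h, hh]
  generalize t.x - xγ = X at *
  generalize t.xf - xγ = Y at *
  generalize xs - xγ = ρ at *
  rw [norm_sub_sq_expand, norm_sub_sq_expand]
  -- With the weights 4 and 2 the two squares produce ‖ρ‖²/8 each (in units of μ), which the -‖ρ‖²/4
  -- left over in the expansion cancels exactly. The price is the factor 5.
  have f1 := norm_add_sq_expand ((4 : ℝ) • X) ρ
  have f2 := norm_sub_sq_expand ((2 : ℝ) • Y) ρ
  rw [norm_smul_sq, real_inner_smul_left] at f1 f2
  have f3 := mul_nonneg hμ (sq_nonneg ‖(4 : ℝ) • X + ρ‖)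
  have f4 := mul_nonneg hμ (sq_nonneg ‖(2 : ℝ) • Y - ρ‖)
  rw [f1] at f3
  rw [f2] at f4
  nlinarith

/-- The Bregman divergence is bounded through the Lipschitz constant. -/
theorem IsSmoothProblem.regBregman_le {H : Stacked n p → ℝ} {G : Stacked n p → Stacked n p}
    {Q : Set (Stacked n p)} {μ L M : ℝ} {xs : Stacked n p} (hH : IsSmoothProblem H G Q μ L xs)
    (hμ : 0 ≤ μ) (hL : 0 ≤ L) (hM : ∀ x ∈ Q, ∀ y ∈ Q, |H x - H y| ≤ M * ‖x - y‖) {x : Stacked n p}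
    (hx : x ∈ Q) : regBregman H (G xs) xs μ x ≤ 2 * M * ‖x - xs‖ := by
  have key : -⟪G xs, x - xs⟫ ≤ M * ‖x - xs‖ := by
    -- The directional derivative at xs is bounded by a short step of length t along the segment,
    -- which stays in the convex set Q. The quadratic error of the descent inequality is of order t.
    refine le_of_forall_pos_le_add fun e he => ?_
    set c := L / 2 * ‖x - xs‖ ^ 2 with hc
    have hc0 : 0 ≤ c := by positivity
    set t := min 1 (e / (c + 1)) with ht
    have ht0 : 0 < t := lt_min one_pos (by positivity)
    have ht1 : t ≤ 1 := min_le_left _ _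
    have hte : c * t ≤ e := by
      calc c * t ≤ (c + 1) * (e / (c + 1)) := by
            gcongr
            · linarith
            · exact min_le_right _ _
        _ = e := by field_simp
    have hmem : xs + t • (x - xs) ∈ Q :=
      hH.convex.add_smul_sub_mem hH.mem hx ⟨ht0.le, ht1⟩
    have h1 := hH.descent xs hH.mem _ hmem
    have h2 := (abs_le.1 (hM _ hmem xs hH.mem)).1
    rw [add_sub_cancel_left, norm_smul, Real.norm_of_nonneg ht0.le] at h1 h2
    rw [real_inner_smul_right] at h1
    have h3 : t * (-⟪G xs, x - xs⟫) ≤ t * (M * ‖x - xs‖ + c * t) := by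
      rw [hc]; linarith
    have h4 := le_of_mul_le_mul_left h3 ht0
    linarith
  have h1 := (abs_le.1 (hM x hx xs hH.mem)).2
  unfold regBregman bregman
  have : 0 ≤ μ / 4 * ‖x - xs‖ ^ 2 := by positivity
  linarith

/-- The Lyapunov function of the initial state. -/
theorem stateLyapunov_init_le {H : Stacked n p → ℝ} {h xs x₀ y₀ z₀ m₀ : Stacked n p}
    {μ β L χ M R : ℝ} (hμ : 0 < μ) (hβ : 0 < β) (hL : 0 ≤ L) (hβL : β * L ≤ 1 / 2)
    (hβμ : β * μ ≤ 1) (hχ : 1 ≤ χ) (hM : 0 ≤ M) (hR : 0 ≤ R)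
    (hD : regBregman H h xs μ x₀ ≤ 2 * M * ‖x₀ - xs‖)
    (hinit : μ ^ 2 * ‖x₀ - xs‖ ^ 2 + ‖y₀ - (h - (μ / 2) • xs)‖ ^ 2 + ‖z₀ + h‖ ^ 2 + ‖m₀‖ ^ 2 ≤
      R ^ 2) :
    √(β * μ) / 2 * stateLyapunov H h xs μ β L χ ⟨x₀, x₀, y₀, y₀, z₀, z₀, m₀⟩ ≤
      40 * χ * R ^ 2 / μ + 2 * M * R / μ := by
  have hχ0 : 0 < χ := by linarith
  have hr : 0 < √(β * μ) := Real.sqrt_pos.2 (by positivity)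
  have hr2 : √(β * μ) ^ 2 = β * μ := Real.sq_sqrt (by positivity)
  have hr1 : √(β * μ) ≤ 1 := Real.sqrt_le_one.2 hβμ
  unfold stateLyapunov lyapunov
  simp only
  have hU : y₀ + z₀ + (μ / 2) • xs = (y₀ - (h - (μ / 2) • xs)) + (z₀ + h) := by abel
  rw [hU]
  have b1 := norm_add_sq_le_two (y₀ - (h - (μ / 2) • xs)) (z₀ + h)
  have b2 := norm_sub_sq_le_two (z₀ + h) (perpProj m₀)
  have b3 : ‖perpProj m₀‖ ^ 2 ≤ ‖m₀‖ ^ 2 := by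
    gcongr; exact norm_perpProj_le m₀
  have b4 : ‖x₀ - xs‖ ≤ R / μ := by
    rw [le_div_iff₀ hμ]
    refine abs_le_of_sq_le_sq' ?_ hR |>.2
    nlinarith [sq_nonneg ‖y₀ - (h - (μ / 2) • xs)‖, sq_nonneg ‖z₀ + h‖, sq_nonneg ‖m₀‖]
  set r := √(β * μ)
  set D := regBregman H h xs μ x₀
  generalize ‖y₀ - (h - (μ / 2) • xs) + (z₀ + h)‖ ^ 2 = nU at *
  generalize ‖z₀ + h - perpProj m₀‖ ^ 2 = nV at *
  generalize ‖perpProj m₀‖ ^ 2 = nP at *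
  generalize ‖y₀ - (h - (μ / 2) • xs)‖ = nY at *
  generalize ‖z₀ + h‖ = nZ at *
  generalize ‖m₀‖ = nm at *
  have hβ1 : β ≤ 1 / μ := by rw [le_div_iff₀ hμ]; exact hβμ
  have c1 : r / 2 * (((1 / β + L) * r + μ / 8) * ‖x₀ - xs‖ ^ 2) ≤ 1 / μ * (μ ^ 2 * ‖x₀ - xs‖ ^ 2) := by
    have e : r / 2 * (((1 / β + L) * r + μ / 8) * ‖x₀ - xs‖ ^ 2) =
        ((1 / β + L) * r ^ 2 / 2 + r * μ / 16) * ‖x₀ - xs‖ ^ 2 := by ring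
    have e2 : 1 / μ * (μ ^ 2 * ‖x₀ - xs‖ ^ 2) = μ * ‖x₀ - xs‖ ^ 2 := by field_simp
    rw [e, e2, hr2]
    gcongr
    have e3 : (1 / β + L) * (β * μ) = (1 + β * L) * μ := by field_simp
    rw [e3]
    nlinarith
  have c2 : r / 2 * (2 / r * D) = D := by field_simp
  have c3 : r / 2 * ((r / (2 * χ * μ) + β / 4) * nY ^ 2) ≤ χ / μ * nY ^ 2 := by
    rw [← mul_assoc]
    gcongr
    have e : r / 2 * (r / (2 * χ * μ) + β / 4) = β / (4 * χ) + r * β / 8 := by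
      have : r / 2 * (r / (2 * χ * μ) + β / 4) = r ^ 2 / (4 * χ * μ) + r * β / 8 := by ring
      rw [this, hr2]; field_simp
    have e2 : β / (4 * χ) ≤ β / 4 := by
      gcongr; linarith
    have e3 : 1 / μ ≤ χ / μ := by gcongr
    rw [e]
    nlinarith
  have c4 : r / 2 * (8 * χ * β / r * nY ^ 2) ≤ 4 * (χ / μ * nY ^ 2) := by
    have e : r / 2 * (8 * χ * β / r * nY ^ 2) = 4 * (χ * β * nY ^ 2) := by field_simp; ring
    rw [e, div_eq_mul_one_div χ μ]
    gcongr
  have c5 : r / 2 * (32 * χ / (μ * r) * nU) ≤ 32 * (χ / μ * (nY ^ 2 + nZ ^ 2)) := by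
    have e : r / 2 * (32 * χ / (μ * r) * nU) = 16 * (χ / μ * nU) := by field_simp; ring
    have e2 : χ / μ * nU ≤ χ / μ * (2 * nY ^ 2 + 2 * nZ ^ 2) := by gcongr
    rw [e]
    linarith
  have c6 : r / 2 * (7 * r * χ / (4 * μ) * (nV + nP)) ≤ 3 * (χ / μ * (nZ ^ 2 + nm ^ 2)) := by
    have e : r / 2 * (7 * r * χ / (4 * μ) * (nV + nP)) = r ^ 2 * (7 / 8 * (χ / μ * (nV + nP))) := by
      ring
    have e2 : χ / μ * (nV + nP) ≤ χ / μ * (2 * nZ ^ 2 + 3 * nm ^ 2) :=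
      mul_le_mul_of_nonneg_left (by linarith) (by positivity)
    have e3 : 0 ≤ χ / μ * (2 * nZ ^ 2 + 3 * nm ^ 2) := by positivity
    have e4 : 0 ≤ χ / μ * nZ ^ 2 := by positivity
    have e5 : 0 ≤ χ / μ * nm ^ 2 := by positivity
    rw [e]
    calc r ^ 2 * (7 / 8 * (χ / μ * (nV + nP)))
        ≤ r ^ 2 * (7 / 8 * (χ / μ * (2 * nZ ^ 2 + 3 * nm ^ 2))) := by gcongr
      _ ≤ 1 * (7 / 8 * (χ / μ * (2 * nZ ^ 2 + 3 * nm ^ 2))) := by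
          gcongr; rw [hr2]; exact hβμ
      _ ≤ _ := by linarith
  have c7 : D ≤ 2 * M * R / μ := by
    calc D ≤ 2 * M * ‖x₀ - xs‖ := hD
      _ ≤ 2 * M * (R / μ) := by gcongr
      _ = _ := by ring
  have c8 : 1 / μ * (μ ^ 2 * ‖x₀ - xs‖ ^ 2) ≤ χ / μ * (μ ^ 2 * ‖x₀ - xs‖ ^ 2) := by gcongr
  have c9 : χ / μ * (μ ^ 2 * ‖x₀ - xs‖ ^ 2 + nY ^ 2 + nZ ^ 2 + nm ^ 2) ≤ χ / μ * R ^ 2 := by gcongr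
  have c10 : 40 * χ * R ^ 2 / μ = 40 * (χ / μ * R ^ 2) := by ring
  have p1 : 0 ≤ χ / μ * (μ ^ 2 * ‖x₀ - xs‖ ^ 2) := by positivity
  have p2 : 0 ≤ χ / μ * nY ^ 2 := by positivity
  have p3 : 0 ≤ χ / μ * nZ ^ 2 := by positivity
  have p4 : 0 ≤ χ / μ * nm ^ 2 := by positivity
  rw [c10]
  simp only [mul_add] at *
  linarith

end Transfer

/-! ### Accuracy from explicit bounds on the error terms. -/

section Solves

/-- Sufficient conditions on the parameters for the accuracy `ε`. -/
theorem solves_of_bounds {n p : ℕ} {μ M χ ε Δ R χ₁ β : ℝ} {B T N : ℕ} (hn : 1 ≤ n) (hp : 1 ≤ p)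
    (hμ : 0 < μ) (hM : 0 < M) (hε : 0 < ε) (hR : 0 ≤ R) (hχ₁ : 1 ≤ χ₁)
    (hB : 1 ≤ B) (hβ : 0 < β) (hβL : β * (12 * smoothness (n * p) M ε) ≤ 1)
    (hgossip : ∀ (G : ℕ → SimpleGraph (Fin n)) (W : ℕ → Matrix (Fin n) (Fin n) ℝ),
      IsGossipSequence G W χ → ∀ k, IsGossip (multiGossip W T k) p χ₁)
    (hcond : μ * ε ≤ 4 * M ^ 2 →
      (1 - √(β * μ) / (32 * χ₁)) ^ N * (40 * χ₁ * R ^ 2 / μ + 2 * M * R / μ) ≤ ε / 48 ∧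
      16 * χ₁ * (6 * (β / √(β * μ)) * (estimatorVar n p M / B)) ≤ ε / 48 ∧
      16 * χ₁ * (14 / μ * ((n * p : ℕ) * Δ / smoothingRadius M ε) ^ 2) ≤ ε / 48) :
    Solves.{u, v} n p μ M χ ε Δ R B T χ₁ β N := by
  intro Ξ _ P _ Ω _ Pr _ G W f δ Q S xs xγ x₀ y₀ z₀ m₀ s γ F Fγ g a hG h hS hxs hxsm hxγ hxγm hz
    hinit hrun hxsQ hxγQ hQ
  have := nontrivial_stacked hn hp
  have hγ : 0 < γ := by simp only [γ, smoothingRadius]; positivity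
  have hγM : γ * M = ε / 2 := by simp only [γ, smoothingRadius]; field_simp
  have hLip := h.lipschitz_objective hM.le
  have hcont := h.continuous_objective hμ
  have hconv := h.convexOn_objective hμ
  -- Nothing relates μ to L a priori. Q contains xs, hence f is Lipschitz on a ball around it, and
  -- this forces μ ≤ 2M/γ ≤ 2L, so that 8L + 2μ ≤ 12L.
  have hμM : μ ≤ 2 * (M / γ) := strongConvex_modulus_le hγ h.strongConvexOn_objective hLip hxsQ
  have hμε : μ * ε ≤ 4 * M ^ 2 := by
    have : 2 * (M / γ) = 4 * M ^ 2 / ε := by simp only [γ, smoothingRadius]; field_simp; norm_num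
    rw [this, le_div_iff₀ hε] at hμM
    exact hμM
  set L := smoothness (n * p) M ε with hL
  have hLdef : L = √(n * p : ℕ) * M / γ := rfl
  have hd1 : (1 : ℝ) ≤ √(n * p : ℕ) := by
    rw [Real.one_le_sqrt]; exact_mod_cast Nat.mul_pos hn hp
  have hμL : μ ≤ 2 * L := by
    refine hμM.trans ?_
    rw [hLdef, mul_div_assoc]
    have : 0 ≤ M / γ := by positivity
    nlinarith
  have hL0 : 0 ≤ L := by rw [hLdef]; positivity
  have hβL' : β * (8 * L + 2 * μ) ≤ 1 := by
    refine le_trans ?_ hβL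
    gcongr
    linarith
  have hβμ : β * μ ≤ 1 := by nlinarith [mul_nonneg hβ.le hL0, mul_pos hβ hμ]
  have hβL2 : β * L ≤ 1 / 2 := by nlinarith [mul_nonneg hβ.le hL0, mul_pos hβ hμ]
  have hr : 0 < √(β * μ) := Real.sqrt_pos.2 (by positivity)
  have hr1 : √(β * μ) ≤ 1 := Real.sqrt_le_one.2 hβμ
  have hgrad : g = sphereGrad volume (objective P f) γ xγ := h.gradient_smoothed hμ hγ xγ
  obtain ⟨c1, c2, c3⟩ := hcond hμε
  -- the smoothed problem
  obtain ⟨hmem, hint, hle⟩ := integral_gap_smoothed_le h hS hxγ hxγm hxγQ hM hLdef hμ hγ hB hβ hβL'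
    hχ₁ (hgossip G W hG) hz hrun hQ
  have hsm : IsSmoothProblem Fγ (sphereGrad volume (objective P f) γ) Q μ L xγ := by
    rw [hLdef]; exact h.isSmoothProblem hμ hM hγ hxγ hxγm hxγQ
  rw [← hgrad] at hint hle
  -- The initial state is deterministic, so an almost sure statement about it holds outright.
  have hx₀ : x₀ ∈ Q := by
    obtain ⟨ω, hω⟩ := (hQ 0 (Nat.zero_le N)).exists
    rw [(hrun ω).init] at hω
    exact hω.1
  have hH : ∀ x ∈ Q, ∀ y ∈ Q, |Fγ x - Fγ y| ≤ M * ‖x - y‖ := fun x hx y hy =>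
    abs_ballSmooth_sub_le volume hγ hcont hLip hx hy
  have hD0 := hsm.regBregman_le hμ.le hL0 hH hx₀
  rw [← hgrad] at hD0
  have hΨ := stateLyapunov_init_le (χ := χ₁) hμ hβ hL0 hβL2 hβμ hχ₁ hM.le hR hD0 hinit
  -- Three errors of ε/48 each. The value ε/16 leaves room for the transfer: 5ε/16 + ε/2 ≤ ε and
  -- 3ε/16 + 3ε/4 ≤ ε.
  have hgap : ∫ ω, gap Fγ g xγ μ (s N ω) ∂Pr ≤ ε / 16 := by
    refine hle.trans ?_
    have hρ : 0 ≤ 1 - √(β * μ) / (32 * χ₁) := by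
      rw [sub_nonneg, div_le_one (by positivity)]; linarith
    have e1 := mul_le_mul_of_nonneg_left hΨ (pow_nonneg hρ N)
    have e2 : √(β * μ) / 2 * (1 - √(β * μ) / (32 * χ₁)) ^ N *
        stateLyapunov Fγ g xγ μ β L χ₁ ⟨x₀, x₀, y₀, y₀, z₀, z₀, m₀⟩ =
        (1 - √(β * μ) / (32 * χ₁)) ^ N * (√(β * μ) / 2 *
          stateLyapunov Fγ g xγ μ β L χ₁ ⟨x₀, x₀, y₀, y₀, z₀, z₀, m₀⟩) := by ring
    have e3 := e1.trans c1
    rw [← e2] at e3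
    change _ + _ ≤ _
    rw [mul_add (16 * χ₁)]
    linarith
  refine ⟨⟨hint, hgap.trans (by linarith)⟩, ?_⟩
  -- comparison of the two problems
  have hFle : ∀ x, F x ≤ Fγ x := fun x => le_ballSmooth volume hconv hcont γ x
  have hFge : ∀ x ∈ Q, Fγ x ≤ F x + ε / 2 := fun x hx => by
    rw [← hγM]; exact ballSmooth_le_add volume hγ hM.le hcont hLip hx
  have horth : ⟪g, xs - xγ⟫ = 0 := by
    rw [real_inner_comm, hgrad]
    exact inner_consensus_consensusPerp (consensus_sub hxs hxγ) hsm.perp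
  have hstrong := hsm.strong xγ xs
  rw [← hgrad, horth, add_zero] at hstrong
  have hA : Fγ xs - Fγ xγ ≤ ε / 2 := by
    have e1 := hFge xs hxsQ
    have e2 := hFle xγ
    have e3 : F xs ≤ F xγ := isMinOn_iff.1 hxsm xγ hxγ
    linarith
  have hr2 : μ / 2 * ‖xs - xγ‖ ^ 2 ≤ Fγ xs - Fγ xγ := by linarith
  have hDf : ∀ ω, μ / 4 * ‖(s N ω).xf - xγ‖ ^ 2 ≤ regBregman Fγ g xγ μ (s N ω).xf := fun ω => by
    rw [hgrad]; exact hsm.regBregman_ge _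
  have hFint : Integrable (fun ω => F (s N ω).xf) Pr := by
    have hsub : ∀ x ∈ Q, x ∈ Q + Metric.closedBall 0 γ := fun x hx => by
      simpa using add_smul_mem_add_closedBall hγ hx (u := 0) (by simp)
    exact integrable_of_lipschitzOn (Q := Q) (xs := xs) hcont
      (fun x hx => hLip xs (hsub xs hxsQ) x (hsub x hx)) hmem.xf
      ((hQ N le_rfl).mono fun ω hω => hω.2)
  have hgF := integrable_gap (μ := μ) (h := g) (xs := xs) hmem hFint
  have hsq : Integrable (fun ω => μ / 2 * ‖(s N ω).x - xs‖ ^ 2) Pr :=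
    ((hmem.x.sub (memLp_const xs)).integrable_norm_pow two_ne_zero).const_mul _
  refine ⟨⟨hgF, ?_⟩, hsq, ?_⟩
  · have e := integral_mono hgF ((hint.const_mul 5).add (integrable_const (ε / 2))) fun ω =>
      gap_le_of_gap hμ.le horth hr2 (hDf ω) (hFle _) (hFge xs hxsQ)
    simp only [Pi.add_apply] at e
    rw [integral_add (hint.const_mul 5) (integrable_const _), integral_const_mul] at e
    simp only [integral_const, probReal_univ, one_smul] at e
    linarith
  · have e := integral_mono hsq ((hint.const_mul 3).add (integrable_const (3 / 2 * (ε / 2))))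
      fun ω => dist_sq_le_of_gap hμ.le (hr2.trans hA) (hDf ω)
    simp only [Pi.add_apply] at e
    rw [integral_add (hint.const_mul 3) (integrable_const _), integral_const_mul 3] at e
    simp only [integral_const, probReal_univ, one_smul] at e
    linarith

end Solves

/-! ### The choice of β and the resulting rates. -/

section Constants

/-- The choice of the tuning parameter `β`. -/
def tuning (d : ℕ) (M χ ε μ : ℝ) (B : ℕ) : ℝ :=
  min (1 / (12 * smoothness d M ε)) ((ε * B / (103680 * χ * d * M ^ 2)) ^ 2 * μ)

variable {d B N : ℕ} {M χ χ' ε μ R Δ A : ℝ}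

theorem smoothness_eq (d : ℕ) (hM : 0 < M) (hε : 0 < ε) :
    smoothness d M ε = 2 * √d * M ^ 2 / ε := by
  unfold smoothness smoothingRadius
  field_simp

theorem smoothness_pos (hd : 1 ≤ d) (hM : 0 < M) (hε : 0 < ε) : 0 < smoothness d M ε := by
  rw [smoothness_eq d hM hε]
  have : (0 : ℝ) < d := by positivity
  positivity

theorem tuning_pos (hd : 1 ≤ d) (hM : 0 < M) (hχ : 0 < χ) (hε : 0 < ε) (hμ : 0 < μ) (hB : 1 ≤ B) :
    0 < tuning d M χ ε μ B := by
  have h1 := smoothness_pos hd hM hε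
  have : (0 : ℝ) < d := by positivity
  have : (0 : ℝ) < B := by positivity
  exact lt_min (by positivity) (by positivity)

theorem tuning_mul_le (hd : 1 ≤ d) (hM : 0 < M) (hε : 0 < ε) :
    tuning d M χ ε μ B * (12 * smoothness d M ε) ≤ 1 := by
  have h1 := smoothness_pos hd hM hε
  rw [← le_div_iff₀ (by positivity)]
  exact min_le_left _ _

theorem tuning_le (hd : 1 ≤ d) (hM : 0 < M) (hε : 0 < ε) :
    tuning d M χ ε μ B ≤ 1 / (2 * smoothness d M ε) := by
  have h1 := smoothness_pos hd hM hε
  refine (min_le_left _ _).trans ?_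
  gcongr
  norm_num

/-- The second term in the definition of `tuning` is made for this: it gives β/√(βμ) ≤ κ, and 103680
= 16 · 6 · (45/2) · 48. -/
theorem sampling_error_le (hd : 1 ≤ d) (hM : 0 < M) (hχ : 0 < χ) (hε : 0 < ε) (hμ : 0 < μ)
    (hB : 1 ≤ B) :
    16 * χ * (6 * (tuning d M χ ε μ B / √(tuning d M χ ε μ B * μ)) *
      (45 / 2 * (d : ℝ) * M ^ 2 / B)) ≤ ε / 48 := by
  have hβ := tuning_pos hd hM hχ hε hμ hB
  have hd0 : (0 : ℝ) < d := by positivity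
  have hB0 : (0 : ℝ) < B := by positivity
  set β := tuning d M χ ε μ B with hβd
  set κ := ε * B / (103680 * χ * d * M ^ 2) with hκ
  have hβκ : β ≤ κ ^ 2 * μ := min_le_right _ _
  have h1 : β / √(β * μ) ≤ κ := by
    rw [div_le_iff₀ (Real.sqrt_pos.2 (by positivity))]
    refine abs_le_of_sq_le_sq' ?_ (by positivity) |>.2
    rw [mul_pow, Real.sq_sqrt (by positivity)]
    nlinarith
  calc _ ≤ 16 * χ * (6 * κ * (45 / 2 * (d : ℝ) * M ^ 2 / B)) := by gcongr
    _ = ε / 48 := by rw [hκ]; field_simp; norm_num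

/-- The contraction factor of one iteration in terms of the rate. -/
theorem le_sqrt_tuning_mul_rate (hd : 1 ≤ d) (hM : 0 < M) (hχ : 0 < χ) (hε : 0 < ε) (hμ : 0 < μ)
    (hB : 1 ≤ B) :
    χ / 103680 ≤ √(tuning d M χ ε μ B * μ) * iterationRate d M χ ε μ B := by
  have hd0 : (0 : ℝ) < d := by positivity
  have hB0 : (0 : ℝ) < B := by positivity
  have hεμ : 0 < √(ε * μ) := Real.sqrt_pos.2 (by positivity)
  set ρ := iterationRate d M χ ε μ B with hρ
  have h1 : (d : ℝ) ^ (1 / 4 : ℝ) * M * χ / √(ε * μ) ≤ ρ := le_max_left _ _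
  have h2 : χ ^ 2 * d * M ^ 2 / (ε * B * μ) ≤ ρ := le_max_right _ _
  have hρ0 : 0 < ρ := lt_of_lt_of_le (by positivity) h2
  rw [← div_le_iff₀ hρ0]
  refine Real.le_sqrt_of_sq_le ?_
  have hq2 : ((d : ℝ) ^ (1 / 4 : ℝ)) ^ 2 = √d := by
    rw [Real.sqrt_eq_rpow, ← Real.rpow_natCast, ← Real.rpow_mul hd0.le]; norm_num
  -- Each branch of the minimum is matched with one term of the rate: the smoothness limit with
  -- d^{1/4}Mχ/√(εμ), the sampling limit with χ²dM²/(εBμ).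
  rcases min_choice (1 / (12 * smoothness d M ε)) ((ε * B / (103680 * χ * d * M ^ 2)) ^ 2 * μ)
    with h | h
  · have e : tuning d M χ ε μ B = 1 / (12 * smoothness d M ε) := h
    rw [e, smoothness_eq d hM hε, div_pow]
    have h3 : ((d : ℝ) ^ (1 / 4 : ℝ) * M * χ / √(ε * μ)) ^ 2 ≤ ρ ^ 2 := by gcongr
    rw [div_pow, mul_pow, mul_pow, hq2, Real.sq_sqrt (by positivity)] at h3
    have hsd : 0 < √(d : ℝ) := Real.sqrt_pos.2 hd0
    calc (χ / 103680) ^ 2 / ρ ^ 2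
        ≤ (χ / 103680) ^ 2 / (√d * M ^ 2 * χ ^ 2 / (ε * μ)) := by gcongr
      _ = 1 / 103680 ^ 2 * (ε * μ / (√d * M ^ 2)) := by field_simp
      _ ≤ 1 / 24 * (ε * μ / (√d * M ^ 2)) := by gcongr; norm_num
      _ = _ := by field_simp; norm_num
  · have e : tuning d M χ ε μ B = (ε * B / (103680 * χ * d * M ^ 2)) ^ 2 * μ := h
    rw [e, div_pow]
    have h3 : (χ ^ 2 * d * M ^ 2 / (ε * B * μ)) ^ 2 ≤ ρ ^ 2 := by gcongr
    calc (χ / 103680) ^ 2 / ρ ^ 2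
        ≤ (χ / 103680) ^ 2 / (χ ^ 2 * d * M ^ 2 / (ε * B * μ)) ^ 2 := by gcongr
      _ = _ := by field_simp

/-- The initial error is negligible after sufficiently many iterations. -/
theorem initial_error_le (hd : 1 ≤ d) (hM : 0 < M) (hχ : 1 ≤ χ) (hε : 0 < ε) (hμ : 0 < μ)
    (hB : 1 ≤ B) (hR : 0 ≤ R) (hβμ : tuning d M χ ε μ B * μ ≤ 1) (hA : 3 ≤ A) (hAχ : χ ≤ A)
    (hAK : M ^ 2 / (ε * μ) ≤ A) (hAR : R ^ 2 / M ^ 2 ≤ A)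
    (hN : 33177600 * iterationRate d M χ ε μ B * Real.log A ≤ N) :
    (1 - √(tuning d M χ ε μ B * μ) / (32 * χ)) ^ N * (40 * χ * R ^ 2 / μ + 2 * M * R / μ) ≤
      ε / 48 := by
  have hχ0 : 0 < χ := by linarith
  have hA0 : 0 < A := by linarith
  have hr1 : √(tuning d M χ ε μ B * μ) ≤ 1 := Real.sqrt_le_one.2 hβμ
  have hlog : 0 ≤ Real.log A := Real.log_nonneg (by linarith)
  have h1 := le_sqrt_tuning_mul_rate hd hM hχ0 hε hμ hB
  set r := √(tuning d M χ ε μ B * μ) with hr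
  set ρ := iterationRate d M χ ε μ B
  have hr0 : 0 ≤ r := Real.sqrt_nonneg _
  have hl0 : 0 ≤ 1 - r / (32 * χ) := by
    rw [sub_nonneg, div_le_one (by positivity)]; linarith
  have h2 : (1 - r / (32 * χ)) ^ N ≤ (A ^ 10)⁻¹ := by
    -- The constant is 33177600 = 10 · 32 · 103680. The exponent 10 beats the cubic growth of the
    -- initial error and leaves 42/A⁷, below 1/48 because A ≥ 3.
    have e1 : 10 * Real.log A ≤ N * (r / (32 * χ)) := by
      calc 10 * Real.log A = 33177600 * (χ / 103680) * Real.log A / (32 * χ) := by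
            field_simp; ring
        _ ≤ 33177600 * (r * ρ) * Real.log A / (32 * χ) := by gcongr
        _ = (33177600 * ρ * Real.log A) * (r / (32 * χ)) := by ring
        _ ≤ N * (r / (32 * χ)) := by gcongr
    calc (1 - r / (32 * χ)) ^ N ≤ Real.exp (-(r / (32 * χ))) ^ N := by
          gcongr; exact Real.one_sub_le_exp_neg _
      _ = Real.exp (-(N * (r / (32 * χ)))) := by rw [← Real.exp_nat_mul]; ring_nf
      _ ≤ Real.exp (-(10 * Real.log A)) := by gcongr
      _ = (A ^ 10)⁻¹ := by
          rw [Real.exp_neg, show (10 : ℝ) * Real.log A = ((10 : ℕ) : ℝ) * Real.log A by norm_num,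
            Real.exp_nat_mul, Real.exp_log hA0]
  have hRM : R / M ≤ A := by
    have e1 : (R / M) ^ 2 ≤ A := by rw [div_pow]; exact hAR
    nlinarith [sq_nonneg (R / M - 1)]
  have e1 : 40 * χ * R ^ 2 / μ + 2 * M * R / μ =
      ε * (40 * (χ * (R ^ 2 / M ^ 2) * (M ^ 2 / (ε * μ))) + 2 * ((M ^ 2 / (ε * μ)) * (R / M))) := by
    field_simp
  have e2 : χ * (R ^ 2 / M ^ 2) * (M ^ 2 / (ε * μ)) ≤ A * A * A := by gcongr
  have e3 : (M ^ 2 / (ε * μ)) * (R / M) ≤ A * A := by gcongr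
  have e4 : A * A ≤ A * A * A := le_mul_of_one_le_right (by positivity) (by linarith)
  have e5 : 40 * χ * R ^ 2 / μ + 2 * M * R / μ ≤ ε * (42 * A ^ 3) := by
    rw [e1]
    gcongr
    linarith
  calc _ ≤ (A ^ 10)⁻¹ * (ε * (42 * A ^ 3)) := by gcongr
    _ = ε * 42 / A ^ 7 := by field_simp
    _ ≤ ε * 42 / 3 ^ 7 := by gcongr
    _ ≤ ε / 48 := by linarith

/-- The noise of the oracle is negligible. -/
theorem noise_error_le (hd : 1 ≤ d) (hM : 0 < M) (hχ : 0 < χ) (hε : 0 < ε) (hμ : 0 < μ)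
    (hN : iterationRate d M χ ε μ B ≤ N)
    (hΔ : Δ ^ 2 ≤ 1 / 43008 * noiseRate d M χ' ε μ B N) :
    16 * χ * (14 / μ * ((d : ℝ) * Δ / smoothingRadius M ε) ^ 2) ≤ ε / 48 := by
  have hd0 : (0 : ℝ) < d := by positivity
  have hεμ : 0 < √(ε * μ) := Real.sqrt_pos.2 (by positivity)
  have h1 : (d : ℝ) ^ (1 / 4 : ℝ) * M * χ / √(ε * μ) ≤ N := (le_max_left _ _).trans hN
  -- The first term of the minimum suffices: the lower bound on N turns it into ε³μ/(χd²M²), and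
  -- 43008 = 896 · 48. Hence χ' may differ from the network constant χ.
  have h2 : noiseRate d M χ' ε μ B N ≤
      ε ^ (5 / 2 : ℝ) * μ ^ (1 / 2 : ℝ) / ((d : ℝ) ^ (7 / 4 : ℝ) * M * N) := min_le_left _ _
  have e1 : (d : ℝ) ^ (7 / 4 : ℝ) * (d : ℝ) ^ (1 / 4 : ℝ) = d ^ 2 := by
    rw [← Real.rpow_add hd0, ← Real.rpow_natCast]; norm_num
  have e2 : ε ^ (5 / 2 : ℝ) * μ ^ (1 / 2 : ℝ) * √(ε * μ) = ε ^ 3 * μ := by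
    rw [Real.sqrt_mul hε.le, Real.sqrt_eq_rpow, Real.sqrt_eq_rpow]
    have f1 : ε ^ (5 / 2 : ℝ) * ε ^ (1 / 2 : ℝ) = ε ^ 3 := by
      rw [← Real.rpow_add hε, ← Real.rpow_natCast]; norm_num
    have f2 : μ ^ (1 / 2 : ℝ) * μ ^ (1 / 2 : ℝ) = μ := by
      rw [← Real.rpow_add hμ]; norm_num
    linear_combination f1 * μ ^ (1 / 2 : ℝ) * μ ^ (1 / 2 : ℝ) + ε ^ 3 * f2
  have h3 : ε ^ (5 / 2 : ℝ) * μ ^ (1 / 2 : ℝ) / ((d : ℝ) ^ (7 / 4 : ℝ) * M * N) ≤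
      ε ^ 3 * μ / (χ * d ^ 2 * M ^ 2) := by
    calc _ ≤ ε ^ (5 / 2 : ℝ) * μ ^ (1 / 2 : ℝ) /
          ((d : ℝ) ^ (7 / 4 : ℝ) * M * ((d : ℝ) ^ (1 / 4 : ℝ) * M * χ / √(ε * μ))) := by gcongr
      _ = ε ^ (5 / 2 : ℝ) * μ ^ (1 / 2 : ℝ) * √(ε * μ) /
          (χ * ((d : ℝ) ^ (7 / 4 : ℝ) * (d : ℝ) ^ (1 / 4 : ℝ)) * M ^ 2) := by field_simp
      _ = _ := by rw [e1, e2]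
  have h4 : Δ ^ 2 ≤ 1 / 43008 * (ε ^ 3 * μ / (χ * d ^ 2 * M ^ 2)) :=
    hΔ.trans (mul_le_mul_of_nonneg_left (h2.trans h3) (by norm_num))
  unfold smoothingRadius
  calc 16 * χ * (14 / μ * ((d : ℝ) * Δ / (ε / (2 * M))) ^ 2)
      = 896 * χ * d ^ 2 * M ^ 2 / (μ * ε ^ 2) * Δ ^ 2 := by field_simp; ring
    _ ≤ 896 * χ * d ^ 2 * M ^ 2 / (μ * ε ^ 2) *
        (1 / 43008 * (ε ^ 3 * μ / (χ * d ^ 2 * M ^ 2))) := by gcongr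
    _ = ε / 48 := by field_simp; norm_num

theorem logFactor_facts (hM : 0 < M) (hε : 0 < ε) (hμ : 0 < μ) (hχ : 1 ≤ χ) :
    3 ≤ 2 + χ + M ^ 2 / (ε * μ) + R ^ 2 / M ^ 2 ∧ 1 ≤ logFactor M χ ε μ R := by
  have h1 : 0 ≤ M ^ 2 / (ε * μ) := by positivity
  have h2 : 0 ≤ R ^ 2 / M ^ 2 := by positivity
  have h3 : 3 ≤ 2 + χ + M ^ 2 / (ε * μ) + R ^ 2 / M ^ 2 := by linarith
  refine ⟨h3, ?_⟩
  unfold logFactor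
  rw [Real.le_log_iff_exp_le (by linarith)]
  exact (Real.exp_one_lt_d9.le.trans (by norm_num)).trans h3

/-- The condition χ₁ ≤ 2 + χ covers both χ₁ = χ and χ₁ = 2. It keeps the network constant of the
parameters below the argument of the logarithm, which is formed with χ. -/
theorem solves_of_rate {n p T : ℕ} (hn : 1 ≤ n) (hp : 1 ≤ p) (hμ : 0 < μ) (hM : 0 < M) (hε : 0 < ε)
    (hR : 0 ≤ R) (hχ : 1 ≤ χ) {χ₁ : ℝ} (hχ₁ : 1 ≤ χ₁) (hχχ : χ₁ ≤ 2 + χ) (hB : 1 ≤ B)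
    (hgossip : ∀ (G : ℕ → SimpleGraph (Fin n)) (W : ℕ → Matrix (Fin n) (Fin n) ℝ),
      IsGossipSequence G W χ → ∀ k, IsGossip (multiGossip W T k) p χ₁)
    (hN : 33177600 * iterationRate (n * p) M χ₁ ε μ B * logFactor M χ ε μ R ≤ N)
    (hΔ : Δ ^ 2 ≤ 1 / 43008 * noiseRate (n * p) M χ' ε μ B N) :
    Solves.{u, v} n p μ M χ ε Δ R B T χ₁ (tuning (n * p) M χ₁ ε μ B) N := by
  have hd : 1 ≤ n * p := Nat.mul_pos hn hp
  have hχ0 : 0 < χ₁ := by linarith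
  obtain ⟨hA, hΛ⟩ := logFactor_facts (R := R) hM hε hμ hχ
  have hβL := tuning_mul_le (χ := χ₁) (μ := μ) (B := B) hd hM hε
  have h1 : 0 ≤ M ^ 2 / (ε * μ) := by positivity
  have h2 : 0 ≤ R ^ 2 / M ^ 2 := by positivity
  have hρ : 0 ≤ iterationRate (n * p) M χ₁ ε μ B := le_trans (by positivity) (le_max_right _ _)
  refine solves_of_bounds hn hp hμ hM hε hR hχ₁ hB (tuning_pos hd hM hχ0 hε hμ hB) hβL
    hgossip fun hμε => ⟨?_, ?_, ?_⟩
  · refine initial_error_le hd hM hχ₁ hε hμ hB hR ?_ hA (by linarith) (by linarith) (by linarith) hN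
    have hL := smoothness_eq (n * p) hM hε
    have hd1 : (1 : ℝ) ≤ √(n * p : ℕ) := by
      rw [Real.one_le_sqrt]; exact_mod_cast hd
    have hμL : μ ≤ 12 * smoothness (n * p) M ε := by
      rw [hL, ← mul_div_assoc, le_div_iff₀ hε]
      nlinarith [sq_nonneg M]
    exact le_trans (by gcongr; exact (tuning_pos hd hM hχ0 hε hμ hB).le) hβL
  · exact sampling_error_le hd hM hχ0 hε hμ hB
  · refine noise_error_le hd hM hχ0 hε hμ (le_trans ?_ hN) hΔ
    have : 1 * 1 ≤ 33177600 * logFactor M χ ε μ R := by gcongr; norm_num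
    nlinarith

end Constants

/-- The complexities obtained with the batch size `⌈d^{3/4} M / √(εμ)⌉` and multi-gossip. -/
theorem complexity_le {d N B T : ℕ} {M χ ε μ Λ C₀ : ℝ} (hd : 1 ≤ d) (hM : 0 < M) (hχ : 1 ≤ χ)
    (hε : 0 < ε) (hμ : 0 < μ) (hΛ : 1 ≤ Λ) (hC₀ : 0 ≤ C₀) (hμL : μ ≤ smoothness d M ε)
    (hB : B = ⌈(d : ℝ) ^ (3 / 4 : ℝ) * M / √(ε * μ)⌉₊) (hT : T = ⌈χ * Real.log 2⌉₊)
    (hN : N = ⌈C₀ * iterationRate d M 2 ε μ B * Λ⌉₊) :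
    (oracleCalls N B : ℝ) ≤ (24 * C₀ + 12) * ((d : ℝ) * M ^ 2 / (ε * μ)) * Λ ∧
    (communications N T : ℝ) ≤
      (24 * C₀ + 12) * ((d : ℝ) ^ (1 / 4 : ℝ) * M * χ / √(ε * μ)) * Λ := by
  have hd0 : (0 : ℝ) < d := by positivity
  have hd1 : (1 : ℝ) ≤ d := by exact_mod_cast hd
  have hεμ : 0 < √(ε * μ) := Real.sqrt_pos.2 (by positivity)
  have hεμ2 : √(ε * μ) ^ 2 = ε * μ := Real.sq_sqrt (by positivity)
  set q := (d : ℝ) ^ (1 / 4 : ℝ) with hq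
  have hq0 : 0 < q := by positivity
  have hq1 : 1 ≤ q := Real.one_le_rpow hd1 (by norm_num)
  have hq2 : q ^ 2 = √d := by
    rw [Real.sqrt_eq_rpow, ← Real.rpow_natCast, ← Real.rpow_mul hd0.le]; norm_num
  have hq3 : (d : ℝ) ^ (3 / 4 : ℝ) = q ^ 3 := by
    rw [← Real.rpow_natCast, ← Real.rpow_mul hd0.le]; norm_num
  have hq4 : (d : ℝ) = q ^ 4 := by
    rw [← Real.rpow_natCast, ← Real.rpow_mul hd0.le]; norm_num
  set w := √(ε * μ) with hw
  set ρ := q * M / w with hρ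
  have hρ0 : 0 < ρ := by positivity
  -- This is where μ ≤ L is used: it bounds ρ below, so that rounding B and N up to integers costs
  -- only a constant factor.
  have hρ2 : 1 ≤ 2 * ρ := by
    rw [smoothness_eq d hM hε, le_div_iff₀ hε, ← hq2] at hμL
    have e1 : w ^ 2 ≤ 2 * (q * M) ^ 2 := by rw [hεμ2]; linarith
    rw [hρ, ← mul_div_assoc, one_le_div hεμ]
    refine abs_le_of_sq_le_sq' ?_ (by positivity) |>.2
    nlinarith [sq_nonneg (q * M)]
  have hB1 : q ^ 2 * ρ ≤ B := by
    rw [hB, hq3]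
    refine le_trans (le_of_eq ?_) (Nat.le_ceil _)
    rw [hρ]; ring
  have hB2 : (B : ℝ) ≤ 3 * (q ^ 2 * ρ) := by
    have e1 : (B : ℝ) ≤ q ^ 2 * ρ + 1 := by
      rw [hB, hq3]
      refine (Nat.ceil_lt_add_one (by positivity)).le.trans (le_of_eq ?_)
      rw [hρ]; ring
    have e2 : ρ ≤ q ^ 2 * ρ := le_mul_of_one_le_left hρ0.le (one_le_pow₀ hq1)
    linarith
  have hB0 : (0 : ℝ) < B := lt_of_lt_of_le (by positivity) hB1
  -- The batch size is about √d ρ, just large enough for the sampling term of the rate to be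
  -- comparable with the first one.
  have hrate : iterationRate d M 2 ε μ B ≤ 4 * ρ := by
    refine max_le ?_ ?_
    · have : q * M * 2 / w = 2 * ρ := by rw [hρ]; ring
      rw [this]; linarith
    · calc (2 : ℝ) ^ 2 * d * M ^ 2 / (ε * B * μ) ≤ 2 ^ 2 * d * M ^ 2 / (ε * (q ^ 2 * ρ) * μ) := by
            gcongr
        _ = 4 * q ^ 4 * M ^ 2 / (w ^ 2 * (q ^ 2 * ρ)) := by
            rw [hεμ2, hq4]; norm_num; ring
        _ = 4 * ρ := by rw [hρ]; field_simp
  have hrate0 : 0 ≤ iterationRate d M 2 ε μ B := le_trans (by positivity) (le_max_left _ _)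
  have hN2 : (N : ℝ) ≤ (4 * C₀ + 2) * (ρ * Λ) := by
    have e1 : (N : ℝ) ≤ C₀ * iterationRate d M 2 ε μ B * Λ + 1 := by
      rw [hN]
      exact (Nat.ceil_lt_add_one (by positivity)).le
    have e2 : C₀ * iterationRate d M 2 ε μ B * Λ ≤ C₀ * (4 * ρ) * Λ := by gcongr
    have e3 : ρ ≤ ρ * Λ := le_mul_of_one_le_right hρ0.le hΛ
    linarith
  have hT2 : (T : ℝ) ≤ 2 * χ := by
    have e0 : 0 ≤ χ * Real.log 2 := mul_nonneg (by linarith) (Real.log_nonneg one_le_two)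
    have e1 : (T : ℝ) ≤ χ * Real.log 2 + 1 := by
      rw [hT]; exact (Nat.ceil_lt_add_one e0).le
    have e2 : χ * Real.log 2 ≤ χ * 1 := by
      gcongr; exact Real.log_two_lt_d9.le.trans (by norm_num)
    linarith
  constructor
  · unfold oracleCalls
    push_cast
    calc (N : ℝ) * (2 * B) ≤ (4 * C₀ + 2) * (ρ * Λ) * (2 * (3 * (q ^ 2 * ρ))) := by gcongr
      _ = (24 * C₀ + 12) * (q ^ 4 * M ^ 2 / w ^ 2) * Λ := by rw [hρ]; field_simp; ring
      _ = _ := by rw [hεμ2, ← hq4]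
  · unfold communications
    push_cast
    calc (N : ℝ) * T ≤ (4 * C₀ + 2) * (ρ * Λ) * (2 * χ) := by gcongr
      _ = (8 * C₀ + 4) * (q * M * χ / w) * Λ := by rw [hρ]; ring
      _ ≤ _ := by gcongr <;> norm_num

end ZOSADOM
end

theorem mainTheorem5 :
    ∃ C c : ℝ, 0 < C ∧ 0 < c ∧
      ∀ (n p : ℕ) (μ M χ ε R : ℝ), 1 ≤ n → 1 ≤ p → 0 < μ → 0 < M → 1 ≤ χ → 0 < ε → 0 ≤ R →
        -- rate and tolerated noise for an arbitrary batch size, one gossip round per iteration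
        (∀ B : ℕ, 1 ≤ B →
          ∃ β : ℝ, 0 < β ∧ β ≤ 1 / (2 * ZOSADOM.smoothness (n * p) M ε) ∧
            ∀ N : ℕ, 1 ≤ N →
              C * ZOSADOM.iterationRate (n * p) M χ ε μ B * ZOSADOM.logFactor M χ ε μ R ≤ N →
              ∀ Δ : ℝ, 0 ≤ Δ → Δ ^ 2 ≤ c * ZOSADOM.noiseRate (n * p) M χ ε μ B N →
                ZOSADOM.Solves.{u, v} n p μ M χ ε Δ R B 1 χ β N) ∧
        -- oracle calls and communications with a suitable batch size and multi-gossip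
        (μ ≤ ZOSADOM.smoothness (n * p) M ε →
          ∃ B T N : ℕ, ∃ β : ℝ,
            B = ⌈((n * p : ℕ) : ℝ) ^ (3 / 4 : ℝ) * M / √(ε * μ)⌉₊ ∧
            T = ⌈χ * Real.log 2⌉₊ ∧ 1 ≤ N ∧
            0 < β ∧ β ≤ 1 / (2 * ZOSADOM.smoothness (n * p) M ε) ∧
            (ZOSADOM.oracleCalls N B : ℝ) ≤
              C * (((n * p : ℕ) : ℝ) * M ^ 2 / (ε * μ)) * ZOSADOM.logFactor M χ ε μ R ∧
            (ZOSADOM.communications N T : ℝ) ≤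
              C * (((n * p : ℕ) : ℝ) ^ (1 / 4 : ℝ) * M * χ / √(ε * μ)) *
                ZOSADOM.logFactor M χ ε μ R ∧
            ∀ Δ : ℝ, 0 ≤ Δ → Δ ^ 2 ≤ c * ZOSADOM.noiseRate (n * p) M 2 ε μ B N →
              ZOSADOM.Solves.{u, v} n p μ M χ ε Δ R B T 2 β N) := by
  -- C is the constant of `complexity_le` with C₀ = 33177600, and exceeds the constant needed in the
  -- first part.
  refine ⟨24 * 33177600 + 12, 1 / 43008, by norm_num, by norm_num, ?_⟩
  intro n p μ M χ ε R hn hp hμ hM hχ hε hR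
  have hd : 1 ≤ n * p := Nat.mul_pos hn hp
  have hχ0 : 0 < χ := by linarith
  have hΛ := (ZOSADOM.logFactor_facts (R := R) hM hε hμ hχ).2
  constructor
  · intro B hB
    refine ⟨ZOSADOM.tuning (n * p) M χ ε μ B, ZOSADOM.tuning_pos hd hM hχ0 hε hμ hB,
      ZOSADOM.tuning_le hd hM hε, fun N _ hN Δ _ hΔ => ?_⟩
    refine ZOSADOM.solves_of_rate hn hp hμ hM hε hR hχ hχ (by linarith) hB
      (fun G W hG k => hG.isGossip_one hχ p k) (le_trans ?_ hN) hΔ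
    have : 0 ≤ ZOSADOM.iterationRate (n * p) M χ ε μ B := le_trans (by positivity) (le_max_right _ _)
    gcongr
    norm_num
  · intro hμL
    set B := ⌈((n * p : ℕ) : ℝ) ^ (3 / 4 : ℝ) * M / √(ε * μ)⌉₊ with hBd
    set T := ⌈χ * Real.log 2⌉₊ with hTd
    set N := ⌈33177600 * ZOSADOM.iterationRate (n * p) M 2 ε μ B *
      ZOSADOM.logFactor M χ ε μ R⌉₊ with hNd
    have hd0 : (0 : ℝ) < (n * p : ℕ) := by exact_mod_cast hd
    have hεμ : 0 < √(ε * μ) := Real.sqrt_pos.2 (by positivity)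
    have hB : 1 ≤ B := Nat.one_le_ceil_iff.2 (by positivity)
    have hrate : 0 < ZOSADOM.iterationRate (n * p) M 2 ε μ B :=
      lt_of_lt_of_le (by positivity) (le_max_left _ _)
    obtain ⟨hO, hC⟩ := ZOSADOM.complexity_le hd hM hχ hε hμ hΛ (by norm_num) hμL hBd hTd hNd
    refine ⟨B, T, N, ZOSADOM.tuning (n * p) M 2 ε μ B, rfl, rfl,
      Nat.one_le_ceil_iff.2 (by positivity), ZOSADOM.tuning_pos hd hM two_pos hε hμ hB,
      ZOSADOM.tuning_le hd hM hε, hO, hC, fun Δ _ hΔ => ?_⟩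
    exact ZOSADOM.solves_of_rate hn hp hμ hM hε hR hχ one_le_two (by linarith) hB
      (fun G W hG k => hG.isGossip_two hχ p k (Nat.le_ceil _)) (Nat.le_ceil _) hΔ
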